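/- Let $n\ge 1$ and let $M$ be a random matrix in $SO(2n)$ distributed according to the normalized Haar measure, with eigenvalues $e^{\pm i\theta_1},\dots,e^{\pm i\theta_n}$, $0\le\theta_j\le\pi$, listed with multiplicity. Let $f:\mathbb R\to\mathbb R$ be even, $2\pi$-periodic and continuously differentiable on $[0,\pi]$ (one-sidedly at the endpoints), with Fourier coefficients $\hat f(k)=\frac1{2\pi}\int_{-\pi}^{\pi}f(x)e^{-ikx}\,dx$, $k\in\mathbb Z$. Let $C_{\ell,n}(f)$ be the $\ell$-th cumulant of the random variable $\sum_{j=1}^n f(\theta_j)$, that is, the $\ell$-th derivative at $t=0$ of $\log E\exp\bigl(t\sum_{j=1}^n f(\theta_j)\bigr)$. For real $k_1,\dots,k_\ell$ put $$G(k_1,\dots,k_\ell)=\sum_{\sigma\in S_\ell}\sum_{m=1}^{\ell}\frac{(-1)^m}{m}\sum_{\substack{\ell_1+\dots+\ell_m=\ell\\ \ell_1,\dots,\ell_m\ge1}}\frac1{\ell_1!\cdots\ell_m!}\max\Bigl(0,\sum_{i=1}^{\ell_1}k_{\sigma(i)},\sum_{i=1}^{\ell_1+\ell_2}k_{\sigma(i)},\dots,\sum_{i=1}^{\ell_1+\dots+\ell_{m-1}}k_{\sigma(i)}\Bigr).$$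 Then for every $\ell\ge2$ there are constants $\mathrm{const}_\ell,\mathrm{const}'_\ell$ depending only on $\ell$ such that, for all such $n$ and $f$, $$\Bigl|C_{\ell,n}(f)-\sum_{k_1+\dots+k_\ell=0}\hat f(k_1)\cdots\hat f(k_\ell)\cdot\tfrac12\bigl(G(k_1,\dots,k_\ell)+G(-k_1,\dots,-k_\ell)\bigr)\Bigr|$$ $$\le\mathrm{const}_\ell\sum_{\substack{k_1+\dots+k_\ell=0\\|k_1|+\dots+|k_\ell|>n}}|k_1|\,|\hat f(k_1)|\cdots|\hat f(k_\ell)|+\mathrm{const}'_\ell\sum_{|k_1|+\dots+|k_\ell|>n}|\hat f(k_1)|\cdots|\hat f(k_\ell)|,$$ where all sums run over integers $k_1,\dots,k_\ell$ and the three series converge absolutely. -/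

import Mathlib

open MeasureTheory

noncomputable section

namespace SOCumulants

/-! The special orthogonal group and its normalized Haar measure. -/

/-- The group `SO(m)` of real orthogonal `m × m` matrices of determinant one, with the topology
inherited from the space of matrices. -/
abbrev SO (m : ℕ) : Type := Matrix.specialOrthogonalGroup (Fin m) ℝ

theorem SO.mul_transpose {m : ℕ} (M : SO m) : M.1 * M.1.transpose = 1 :=
  (Matrix.mem_orthogonalGroup_iff (Fin m) ℝ).1 M.2.1

theorem SO.transpose_mul {m : ℕ} (M : SO m) : M.1.transpose * M.1 = 1 :=
  (Matrix.mem_orthogonalGroup_iff' (Fin m) ℝ).1 M.2.1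

theorem SO.det_eq_one {m : ℕ} (M : SO m) : M.1.det = 1 :=
  (Matrix.mem_specialOrthogonalGroup_iff.1 M.2).2

instance instTopGroup (m : ℕ) : IsTopologicalGroup (SO m) where
  continuous_mul := by
    refine Continuous.subtype_mk ?_ _
    exact (continuous_subtype_val.comp continuous_fst).mul
      (continuous_subtype_val.comp continuous_snd)
  continuous_inv := by
    refine Continuous.subtype_mk (f := fun M : SO m => M.1.transpose) ?_ _
    exact continuous_subtype_val.matrix_transpose

theorem SO.abs_entry_le {m : ℕ} (M : SO m) (i j : Fin m) : M.1 i j ∈ Set.Icc (-1 : ℝ) 1 := by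
  have h := congrFun (congrFun (SO.mul_transpose M) i) i
  rw [Matrix.mul_apply, Matrix.one_apply_eq] at h
  have h2 : M.1 i j * M.1 i j ≤ ∑ k, M.1 i k * M.1.transpose k i :=
    Finset.single_le_sum (f := fun k => M.1 i k * M.1.transpose k i)
      (fun k _ => by simpa [Matrix.transpose_apply] using mul_self_nonneg (M.1 i k))
      (Finset.mem_univ j)
  rw [h] at h2
  exact ⟨by nlinarith, by nlinarith⟩

instance instCompact (m : ℕ) : CompactSpace (SO m) := by
  suffices h : IsCompact (Matrix.specialOrthogonalGroup (Fin m) ℝ :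
      Set (Matrix (Fin m) (Fin m) ℝ)) from isCompact_iff_compactSpace.1 h
  have hK : IsCompact (Set.univ.pi fun _ : Fin m => Set.univ.pi fun _ : Fin m =>
      Set.Icc (-1 : ℝ) 1) :=
    isCompact_univ_pi fun _ => isCompact_univ_pi fun _ => isCompact_Icc
  refine IsCompact.of_isClosed_subset (s := (Set.univ.pi fun _ : Fin m =>
    Set.univ.pi fun _ : Fin m => Set.Icc (-1 : ℝ) 1 : Set (Matrix (Fin m) (Fin m) ℝ))) hK ?_ ?_
  · have : (Matrix.specialOrthogonalGroup (Fin m) ℝ : Set (Matrix (Fin m) (Fin m) ℝ)) =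
        {A | A * A.transpose = 1} ∩ {A | A.det = 1} := by
      ext A
      exact Matrix.mem_specialOrthogonalGroup_iff.trans
        (and_congr_left' (Matrix.mem_orthogonalGroup_iff (Fin m) ℝ))
    rw [this]
    exact (isClosed_eq (by fun_prop) continuous_const).inter
      (isClosed_eq (by fun_prop) continuous_const)
  · intro A hA i _ j _
    exact SO.abs_entry_le ⟨A, hA⟩ i j

instance instMeasurableSpace (m : ℕ) : MeasurableSpace (SO m) := borel (SO m)

instance instBorelSpace (m : ℕ) : BorelSpace (SO m) := ⟨rfl⟩

/-- The normalized Haar measure on `SO(m)`: the Haar measure giving mass one to the group. -/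
def haarSO (m : ℕ) : Measure (SO m) := Measure.haarMeasure ⊤

instance instProb (m : ℕ) : IsProbabilityMeasure (haarSO m) :=
  ⟨by simpa [haarSO] using Measure.haarMeasure_self (K₀ := (⊤ : TopologicalSpace.PositiveCompacts (SO m)))⟩

/-! Eigenvalue angles. -/

/-- `θ₁, …, θₙ ∈ [0, π]` are the eigenvalue angles of the real `2n × 2n` matrix `M`: its
eigenvalues, with multiplicity, are `exp (± i θ₁), …, exp (± i θₙ)`. -/
def IsEigenangles {n : ℕ} (M : Matrix (Fin (2 * n)) (Fin (2 * n)) ℝ) (θ : Fin n → ℝ) : Prop :=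
  (∀ j, θ j ∈ Set.Icc 0 Real.pi) ∧
    (M.map Complex.ofReal).charpoly.roots =
      ∑ j, ({Complex.exp (θ j * Complex.I), Complex.exp (-(θ j * Complex.I))} : Multiset ℂ)

theorem SO.norm_root {m : ℕ} (M : SO m) {z : ℂ}
    (hz : z ∈ (M.1.map Complex.ofReal).charpoly.roots) : ‖z‖ = 1 := by
  have hU : M.1.map Complex.ofReal ∈ unitary (Matrix (Fin m) (Fin m) ℂ) := by
    refine (Matrix.mem_unitaryGroup_iff (α := ℂ)).2 ?_
    have hs : star (M.1.map Complex.ofReal) = M.1.transpose.map Complex.ofReal := by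
      ext i j
      simp [Matrix.star_apply]
    have h := congrArg (fun A : Matrix (Fin m) (Fin m) ℝ => A.map Complex.ofRealHom)
      (SO.mul_transpose M)
    simp only [Matrix.map_mul, Matrix.map_one _ (map_zero _) (map_one _)] at h
    rw [hs]
    exact h
  have hs := Matrix.mem_spectrum_of_isRoot_charpoly (Polynomial.isRoot_of_mem_roots hz)
  open scoped Matrix.Norms.L2Operator in
  exact spectrum.norm_eq_one_of_unitary hU hs

theorem SO.roots_map_conj {m : ℕ} (M : SO m) :
    (M.1.map Complex.ofReal).charpoly.roots.map (starRingEnd ℂ) =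
      (M.1.map Complex.ofReal).charpoly.roots := by
  have h1 : (M.1.map Complex.ofReal).charpoly = M.1.charpoly.map Complex.ofRealHom :=
    Matrix.charpoly_map M.1 Complex.ofRealHom
  have h2 : (M.1.map Complex.ofReal).charpoly.map (starRingEnd ℂ) =
      (M.1.map Complex.ofReal).charpoly := by
    rw [h1, Polynomial.map_map]
    congr 1
    ext x
    simp
  rw [← (IsAlgClosed.splits _).roots_map (starRingEnd ℂ), h2]

theorem exists_fin_of_card {n : ℕ} (T : Multiset ℝ) (hT : T.card = n) :
    ∃ θ : Fin n → ℝ, Finset.univ.val.map θ = T := by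
  obtain ⟨L, rfl⟩ : ∃ L : List ℝ, T = (L : Multiset ℝ) := ⟨T.toList, (Multiset.coe_toList T).symm⟩
  rw [Multiset.coe_card] at hT
  subst hT
  exact ⟨L.get, by rw [Fin.univ_val_map, List.ofFn_get]⟩

theorem exists_isEigenangles {n : ℕ} (M : SO (2 * n)) : ∃ θ : Fin n → ℝ, IsEigenangles M.1 θ := by
  classical
  set R := (M.1.map Complex.ofReal).charpoly.roots with hR
  have hnorm : ∀ z ∈ R, ‖z‖ = 1 := fun z hz => SO.norm_root M hz
  have hconj : R.map (starRingEnd ℂ) = R := SO.roots_map_conj M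
  have hcard : R.card = 2 * n := by
    rw [hR, ← (IsAlgClosed.splits _).natDegree_eq_card_roots, Matrix.charpoly_natDegree_eq_dim,
      Fintype.card_fin]
  have hprod : R.prod = 1 := by
    rw [hR, ← Matrix.det_eq_prod_roots_charpoly]
    have h : (M.1.map Complex.ofRealHom).det = Complex.ofRealHom M.1.det :=
      (RingHom.map_det Complex.ofRealHom M.1).symm
    rw [SO.det_eq_one, map_one] at h
    exact h
  set A := R.filter (fun z => 0 < z.im) with hA
  set a := R.count 1
  set b := R.count (-1)
  have hneg : R.filter (fun z => z.im < 0) = A.map (starRingEnd ℂ) := by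
    conv_lhs => rw [← hconj]
    rw [Multiset.filter_map, hA]
    congr 2
    ext z
    simp
  have hreal : R.filter (fun z => z.im = 0) =
      Multiset.replicate a 1 + Multiset.replicate b (-1) := by
    ext w
    rw [Multiset.count_filter, Multiset.count_add, Multiset.count_replicate,
      Multiset.count_replicate]
    by_cases h1 : w = 1
    · subst h1
      have : ¬ ((-1 : ℂ) = 1) := by norm_num
      simp [this, a]
    by_cases h2 : w = -1
    · subst h2
      have : ¬ ((1 : ℂ) = -1) := by norm_num
      simp [this, b]
    rw [if_neg (Ne.symm h1), if_neg (Ne.symm h2)]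
    split_ifs with him
    · refine Multiset.count_eq_zero.2 fun hw => ?_
      have hn := hnorm w hw
      have hw' : w = (w.re : ℂ) := Complex.ext rfl (by simpa using him)
      rw [hw', Complex.norm_real, Real.norm_eq_abs] at hn
      rcases (abs_eq zero_le_one).1 hn with h | h
      · exact h1 (by rw [hw', h]; simp)
      · exact h2 (by rw [hw', h]; simp)
    · rfl
  have hsplit : R = A + A.map (starRingEnd ℂ) +
      (Multiset.replicate a 1 + Multiset.replicate b (-1)) := by
    rw [← hneg, ← hreal, hA]
    ext w
    simp only [Multiset.count_add, Multiset.count_filter]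
    rcases lt_trichotomy w.im 0 with h | h | h
    · simp [h, h.le, h.ne]
    · simp [h]
    · simp [h, h.ne', not_lt.2 h.le]
  have hb : Even b := by
    have h := hprod
    rw [hsplit] at h
    simp only [Multiset.prod_add, Multiset.prod_replicate, one_pow, one_mul] at h
    rw [← map_multiset_prod, Complex.mul_conj] at h
    have hA1 : Complex.normSq A.prod = 1 := by
      have hm : ∀ B : Multiset ℂ, (∀ z ∈ B, ‖z‖ = 1) → Complex.normSq B.prod = 1 := by
        intro B
        induction B using Multiset.induction_on with
        | empty => simp
        | cons z B ih =>
          intro hB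
          rw [Multiset.prod_cons, map_mul, ih fun w hw => hB w (Multiset.mem_cons_of_mem hw),
            Complex.normSq_eq_norm_sq, hB z (Multiset.mem_cons_self z B)]
          norm_num
      exact hm A fun z hz => hnorm z (Multiset.mem_of_mem_filter hz)
    rw [hA1, Complex.ofReal_one, one_mul] at h
    by_contra hodd
    rw [(Nat.not_even_iff_odd.1 hodd).neg_one_pow] at h
    norm_num at h
  have hcard2 : 2 * n = 2 * A.card + a + b := by
    have h := congrArg Multiset.card hsplit
    rw [hcard] at h
    simp only [Multiset.card_add, Multiset.card_map, Multiset.card_replicate] at h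
    omega
  obtain ⟨b', hb'⟩ := hb
  obtain ⟨a', ha'⟩ : Even a := by
    rw [Nat.even_iff]
    omega
  obtain ⟨θ, hθ⟩ := exists_fin_of_card (n := n)
    (A.map Complex.arg + (Multiset.replicate a' 0 + Multiset.replicate b' Real.pi))
    (by simp only [Multiset.card_add, Multiset.card_map, Multiset.card_replicate]; omega)
  refine ⟨θ, fun j => ?_, ?_⟩
  · have hj : θ j ∈ Finset.univ.val.map θ := Multiset.mem_map_of_mem θ (Finset.mem_univ j)
    rw [hθ, Multiset.mem_add, Multiset.mem_add, Multiset.mem_map] at hj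
    rcases hj with ⟨z, hz, hzj⟩ | hj | hj
    · rw [← hzj]
      exact ⟨Complex.arg_nonneg_iff.2 (Multiset.mem_filter.1 hz).2.le, Complex.arg_le_pi z⟩
    · rw [Multiset.eq_of_mem_replicate hj]
      exact ⟨le_rfl, Real.pi_pos.le⟩
    · rw [Multiset.eq_of_mem_replicate hj]
      exact ⟨Real.pi_pos.le, le_rfl⟩
  · have hsum : ∑ j, ({Complex.exp (θ j * Complex.I), Complex.exp (-(θ j * Complex.I))} :
        Multiset ℂ) = ((Finset.univ.val.map θ).map fun t : ℝ =>
          ({Complex.exp (t * Complex.I)} + {Complex.exp (-(t * Complex.I))} : Multiset ℂ)).sum := by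
      rw [Multiset.map_map]
      rfl
    rw [hsum, hθ, ← hR, hsplit]
    simp only [Multiset.map_add, Multiset.sum_add, Multiset.map_replicate, Multiset.sum_replicate,
      Multiset.map_map]
    congr 1
    · rw [Multiset.map_congr rfl (g := fun z : ℂ => ({z} + {starRingEnd ℂ z} : Multiset ℂ)) ?_]
      · rw [Multiset.sum_map_add, Multiset.sum_map_singleton]
        congr 1
        rw [← Multiset.sum_map_singleton (A.map (starRingEnd ℂ)), Multiset.map_map]
        rfl
      · intro z hz
        have h1 : Complex.exp (z.arg * Complex.I) = z := by
          have h := Complex.norm_mul_exp_arg_mul_I z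
          rwa [hnorm z (Multiset.mem_of_mem_filter hz), Complex.ofReal_one, one_mul] at h
        have h2 : Complex.exp (-(z.arg * Complex.I)) = starRingEnd ℂ z := by
          rw [← h1, ← Complex.exp_conj]
          simp [h1]
        simp only [Function.comp_apply, h1, h2]
    · congr 1
      · rw [ha', nsmul_add, Multiset.nsmul_singleton, Multiset.nsmul_singleton,
          Multiset.replicate_add]
        simp
      · rw [hb', nsmul_add, Multiset.nsmul_singleton, Multiset.nsmul_singleton,
          Multiset.replicate_add, Complex.exp_neg, Complex.exp_pi_mul_I]
        norm_num

/-- The eigenvalue angles `θ₁, …, θₙ ∈ [0, π]` of a matrix in `SO(2n)`; they are unique up to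
their order. -/
def eigenangle {n : ℕ} (M : SO (2 * n)) : Fin n → ℝ := (exists_isEigenangles M).choose

theorem isEigenangles_eigenangle {n : ℕ} (M : SO (2 * n)) : IsEigenangles M.1 (eigenangle M) :=
  (exists_isEigenangles M).choose_spec

/-- The linear statistic `f(θ₁) + ⋯ + f(θₙ)` of a matrix in `SO(2n)`. -/
def linStat (n : ℕ) (f : ℝ → ℝ) (M : SO (2 * n)) : ℝ := ∑ j, f (eigenangle M j)

/-! Cumulants, Fourier coefficients and the function `G`. -/

/-- The `l`-th cumulant of a random variable `X` under `μ`, i.e. the `l`-th derivative at `0` of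
`t ↦ log E exp (t X)`. -/
def cumulant {Ω : Type*} [MeasurableSpace Ω] (X : Ω → ℝ) (μ : Measure Ω) (l : ℕ) : ℝ :=
  iteratedDeriv l (ProbabilityTheory.cgf X μ) 0

/-- `C_{l,n}(f)`: the `l`-th cumulant of `f(θ₁) + ⋯ + f(θₙ)` for a Haar distributed matrix
in `SO(2n)`. -/
def cumulantSO (l n : ℕ) (f : ℝ → ℝ) : ℝ := cumulant (linStat n f) (haarSO (2 * n)) l

/-- The Fourier coefficient `(2π)⁻¹ ∫_{-π}^{π} f(x) exp (-i k x) dx`. -/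
def fhat (f : ℝ → ℝ) (k : ℤ) : ℂ :=
  (1 / (2 * Real.pi) : ℂ) *
    ∫ x in (-Real.pi)..Real.pi, (f x : ℂ) * Complex.exp (-(k * x * Complex.I))

/-- For a composition `c = (l₁, …, l_m)` of `l`, the maximum of `0` and the partial sums of
`k` over the first `l₁ + ⋯ + l_j` indices, `1 ≤ j ≤ m - 1`. -/
def maxPartialSum {l : ℕ} (c : Composition l) (k : Fin l → ℝ) : ℝ :=
  (insert 0 ((Finset.Ico 1 c.length).image
    fun j => ∑ i with i.val < c.sizeUpTo j, k i)).max' (Finset.insert_nonempty _ _)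

/-- The function `G(k₁, …, k_l)`; the double sum over `m` and over `l₁ + ⋯ + l_m = l`, `l_i ≥ 1`,
is a single sum over the compositions of `l`. -/
def G {l : ℕ} (k : Fin l → ℝ) : ℝ :=
  ∑ σ : Equiv.Perm (Fin l), ∑ c : Composition l,
    (-1 : ℝ) ^ c.length / c.length * (1 / ∏ i, ((c.blocksFun i).factorial : ℝ)) *
      maxPartialSum c (fun i => k (σ i))

/-- The integer vectors `(k₁, …, k_l)` with `k₁ + ⋯ + k_l = 0`. -/
abbrev ZeroSum (l : ℕ) : Type := {k : Fin l → ℤ // ∑ i, k i = 0}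

/-- The term `f̂(k₁) ⋯ f̂(k_l) · (1/2) (G(k) + G(-k))`. -/
def mainTerm {l : ℕ} (f : ℝ → ℝ) (k : Fin l → ℤ) : ℂ :=
  (∏ i, fhat f (k i)) * ((1 / 2 * (G (fun i => (k i : ℝ)) + G (fun i => -(k i : ℝ))) : ℝ) : ℂ)

/-- The term `|f̂(k₁)| ⋯ |f̂(k_l)|`. -/
def absTerm {l : ℕ} (f : ℝ → ℝ) (k : Fin l → ℤ) : ℝ := ∏ i, ‖fhat f (k i)‖

end SOCumulants

end

noncomputable section

namespace SOCumulants

/-! ### Laurent polynomials in the eigenvalues -/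

/-! For an even trigonometric polynomial the cumulants are computed exactly as sums over lattice
paths, the paths are compared with `G`, and a limit gives general `f`.

Haar side. The expectation of a polynomial in the traces `tr M ^ k` equals the constant coefficient
of the corresponding symmetric Laurent polynomial against the squared Vandermonde factor `Δ²`,
normalized (`integral_evTr`). This case of Weyl's formula is derived from loop equations. Left
invariance under plane rotations shows that every `loopOp k P` has Haar mean zero
(`integral_loopOp`). On the torus, `Δ²` times the same expression is a sum of total derivatives
(`sum_euler_loop`), so its constant coefficient is zero. The radial Laplacian `∑ ∂_j Δ² ∂_j`,
divided by `Δ²`, takes values that are combinations of such expressions. It preserves a filtration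
by finite dimensional spaces, and by positivity its kernel consists of constants
(`euler_eq_zero_of_lapl`). It is therefore bijective on the elements of mean zero for `Δ²`, which
then have Haar mean zero as well.

Determinants. In the basis `1, z ^ b + z ^ (-b)` the Vandermonde factor is a determinant, and
`andreief` turns the exponential moment series of a linear statistic `F` into the determinant of `∑
t ^ d / d! · cosMat (F ^ d)` (`moment_series_eq_det`). Since `log det = tr log`, the `l`-th cumulant
is a sum over compositions `(l₁, …, l_m)` of traces of `cosMat (F ^ l₁) ⋯ cosMat (F ^ l_m)` with the
weights that occur in `G` (`formal_cumulant`).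

Paths. A cosine matrix is a Toeplitz matrix on the window `(-n, n)` restricted to even vectors, so
such a trace is half of a trace plus half of an antitrace of a Toeplitz product
(`trace_prod_cosMat`). The entries of the product count paths whose positions at the block ends lie
in the window. For steps `k` of sum zero, the number of closed paths is `max(0, 2n - 1 - (p + q))`,
where `p` and `q` are the maxima of partial sums entering `G k` and `G (-k)`. There is at most one
path from `x` to `-x`, and none if the sum of the steps is odd. If `∑ |k i| ≤ n`, the first count
has no truncation and the second equals the parity indicator. The terms that do not depend on the
composition disappear because the weights sum to zero for `l ≥ 2` (`sum_compWeight`); `p + q` gives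
the main term. Only vectors with `∑ |k i| > n` leave an error, at most `∑ |k i|` for closed paths
and `1` for the others (`abs_trace_cumulant_sub_le`).

Limit. The Fourier coefficients of `f` are absolutely summable (`summable_norm_fhat`), cumulants are
continuous under bounded pointwise convergence (`tendsto_cumulant`), and the constants do not depend
on the truncation. -/

/-- Laurent polynomials in `n` variables with real coefficients. -/
abbrev Laurent (n : ℕ) : Type := AddMonoidAlgebra ℝ (Fin n → ℤ)

namespace Laurent

variable {n : ℕ}

/-- The monomial `z_j ^ k`. -/
def z (j : Fin n) (k : ℤ) : Laurent n := AddMonoidAlgebra.single (Pi.single j k) 1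

/-- `z_j ^ k + z_j ^ (-k)`. -/
def c (j : Fin n) (k : ℤ) : Laurent n := z j k + z j (-k)

/-- `z_j ^ k - z_j ^ (-k)`. -/
def s (j : Fin n) (k : ℤ) : Laurent n := z j k - z j (-k)

/-- The power sum `∑ j, (z_j ^ k + z_j ^ (-k))`. -/
def p (n : ℕ) (k : ℤ) : Laurent n := ∑ j, c j k

theorem z_mul_z (j : Fin n) (a b : ℤ) : z j a * z j b = z j (a + b) := by
  simp [z, AddMonoidAlgebra.single_mul_single, Pi.single_add]

@[simp] theorem z_zero (j : Fin n) : z j 0 = 1 := by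
  simp [z, AddMonoidAlgebra.one_def]

@[simp] theorem c_neg (j : Fin n) (k : ℤ) : c j (-k) = c j k := by
  simp [c, add_comm]

theorem c_zero (j : Fin n) : c j 0 = 2 := by
  simp [c]; norm_num

theorem c_mul_c (j : Fin n) (a b : ℤ) : c j a * c j b = c j (a + b) + c j (a - b) := by
  simp only [c, add_mul, mul_add, z_mul_z]
  rw [show -a + b = -(a - b) by ring, show -a + -b = -(a + b) by ring, ← sub_eq_add_neg]
  ring

theorem s_mul_s (j : Fin n) (a b : ℤ) : s j a * s j b = c j (a + b) - c j (a - b) := by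
  simp only [c, s, sub_mul, mul_sub, z_mul_z]
  rw [show -a + b = -(a - b) by ring, show -a + -b = -(a + b) by ring, ← sub_eq_add_neg]
  ring

@[simp] theorem p_neg (k : ℤ) : p n (-k) = p n k := by simp [p]

theorem p_abs (k : ℤ) : p n |k| = p n k := by
  rcases abs_choice k with h | h <;> simp [h]

/-- The Euler operator multiplying the monomial `z ^ m` by `m j`, as a linear map. -/
def eulerLin (j : Fin n) : Laurent n →ₗ[ℝ] Laurent n :=
  (Finsupp.lsum ℝ fun m : Fin n → ℤ => (m j : ℝ) • AddMonoidAlgebra.lsingle (R := ℝ) m) ∘ₗ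
    (AddMonoidAlgebra.coeffLinearEquiv ℝ).toLinearMap

theorem eulerLin_single (j : Fin n) (m : Fin n → ℤ) (a : ℝ) :
    eulerLin j (AddMonoidAlgebra.single m a) = AddMonoidAlgebra.single m (m j * a) := by
  simp [eulerLin]

theorem eulerLin_coeff (j : Fin n) (F : Laurent n) (m : Fin n → ℤ) :
    (eulerLin j F).coeff m = m j * F.coeff m := by
  classical
  induction F using AddMonoidAlgebra.induction_linear with
  | zero => simp
  | add f g hf hg => simp [hf, hg, mul_add]
  | single m' a =>
    simp only [eulerLin_single, AddMonoidAlgebra.coeff_single, Finsupp.single_apply]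
    split_ifs with h <;> simp [h]

/-- The Euler derivation `z_j ∂ / ∂ z_j`. -/
def euler (j : Fin n) : Derivation ℝ (Laurent n) (Laurent n) :=
  Derivation.mk' (eulerLin j) fun a b => by
    induction a using AddMonoidAlgebra.induction_linear with
    | zero => simp
    | add f g hf hg =>
      simp only [add_mul, map_add, hf, hg, smul_eq_mul, mul_add]
      ring
    | single m r =>
      induction b using AddMonoidAlgebra.induction_linear with
      | zero => simp
      | add f g hf hg =>
        simp only [add_mul, map_add, hf, hg, smul_eq_mul, mul_add]
        ring
      | single m' r' =>
        simp only [AddMonoidAlgebra.single_mul_single, eulerLin_single, smul_eq_mul]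
        rw [add_comm m' m, ← AddMonoidAlgebra.single_add]
        congr 1
        push_cast [Pi.add_apply]
        ring

theorem euler_coeff (j : Fin n) (F : Laurent n) (m : Fin n → ℤ) :
    (euler j F).coeff m = m j * F.coeff m := eulerLin_coeff j F m

theorem euler_z (i j : Fin n) (k : ℤ) : euler i (z j k) = if i = j then (k : ℝ) • z j k else 0 := by
  change eulerLin i (z j k) = _
  rw [z, eulerLin_single]
  split_ifs with h
  · subst h; simp
  · simp [h]

theorem euler_c (i j : Fin n) (k : ℤ) : euler i (c j k) = if i = j then (k : ℝ) • s j k else 0 := by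
  rw [c, map_add, euler_z, euler_z]
  split_ifs
  · push_cast
    rw [s, smul_sub, neg_smul, sub_eq_add_neg]
  · simp

theorem euler_s (i j : Fin n) (k : ℤ) : euler i (s j k) = if i = j then (k : ℝ) • c j k else 0 := by
  rw [s, map_sub, euler_z, euler_z]
  split_ifs
  · push_cast
    rw [c, smul_add, neg_smul, sub_neg_eq_add]
  · simp

theorem euler_p (i : Fin n) (k : ℤ) : euler i (p n k) = (k : ℝ) • s i k := by
  simp [p, map_sum, euler_c]

/-- The constant coefficient of a Laurent polynomial. -/
def ct : Laurent n →ₗ[ℝ] ℝ := Finsupp.lapply 0 ∘ₗ (AddMonoidAlgebra.coeffLinearEquiv ℝ).toLinearMap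

theorem ct_apply (F : Laurent n) : ct F = F.coeff 0 := rfl

theorem ct_euler (j : Fin n) (F : Laurent n) : ct (euler j F) = 0 := by
  simp [ct_apply, euler_coeff]

/-! ### The Vandermonde factor and its logarithmic derivative -/

/-- The symmetric kernel obtained by dividing
`2 (s_b(k) s_b(1) - s_a(k) s_a(1))` by `c_b(1) - c_a(1)`. -/
def divKernel (k : ℕ) (a b : Fin n) : Laurent n :=
  ∑ m ∈ Finset.range k, (c a (m + 1) * c b (k - (m + 1)) + c b (m + 1) * c a (k - (m + 1)))

/-- Multiplication by `c_b(1) - c_a(1)` shifts the indices of each summand by one up and down, and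
the resulting sum telescopes to its boundary terms. -/
theorem divKernel_half (k : ℕ) (a b : Fin n) :
    (c b 1 - c a 1) * ∑ m ∈ Finset.range k, c a (m + 1) * c b (k - (m + 1)) =
      c a 1 * c b k - 2 * c a (k + 1) + c a k * c b 1 - 2 * c b (k - 1) := by
  have key : ∀ m : ℕ, (c b 1 - c a 1) * (c a (m + 1) * c b (k - (m + 1))) =
      (c a (m + 1) * c b (k - m) + c a (m + 1) * c b (k - 2 - m)) -
        (c a (m + 2) * c b (k - (m + 1)) + c a m * c b (k - (m + 1))) := by
    intro m
    have h1 := c_mul_c b (k - (m + 1)) 1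
    have h2 := c_mul_c a (m + 1) 1
    rw [show (k : ℤ) - (m + 1) + 1 = k - m by ring,
      show (k : ℤ) - (m + 1) - 1 = k - 2 - m by ring] at h1
    rw [show (m : ℤ) + 1 + 1 = m + 2 by ring, show (m : ℤ) + 1 - 1 = m by ring] at h2
    linear_combination c a (m + 1) * h1 - c b (k - (m + 1)) * h2
  rw [Finset.mul_sum, Finset.sum_congr rfl fun m _ => key m]
  have tel : ∀ N : ℕ, ∑ m ∈ Finset.range N,
      ((c a (m + 1) * c b (k - m) + c a (m + 1) * c b (k - 2 - m)) -
        (c a (m + 2) * c b (k - (m + 1)) + c a m * c b (k - (m + 1)))) =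
      c a 1 * c b k - c a (N + 1) * c b (k - N) + c a N * c b (k - 1 - N) -
        c a 0 * c b (k - 1) := by
    intro N
    induction N with
    | zero => simp
    | succ N ih =>
      rw [Finset.sum_range_succ, ih]
      push_cast
      rw [show (N : ℤ) + 1 + 1 = N + 2 by ring, show (k : ℤ) - 1 - (N + 1) = k - 2 - N by ring,
        show (k : ℤ) - 1 - N = k - (N + 1) by ring]
      ring
  rw [tel k, c_zero, sub_self, c_zero, show (k : ℤ) - 1 - k = -1 by ring, c_neg]
  ring

/-- The two halves of the kernel are exchanged by `a ↔ b`, under which the factor changes sign;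
subtracting, the mixed boundary terms cancel. -/
theorem sub_mul_divKernel (k : ℕ) (a b : Fin n) :
    (c b 1 - c a 1) * divKernel k a b = 2 * (s b k * s b 1 - s a k * s a 1) := by
  rw [divKernel, Finset.sum_add_distrib, mul_add, divKernel_half]
  have h := divKernel_half k b a
  rw [s_mul_s, s_mul_s]
  linear_combination -h

/-- The Vandermonde product `∏_{i < j} (c_j(1) - c_i(1))`. -/
def vand (n : ℕ) : Laurent n := ∏ i : Fin n, ∏ j ∈ Finset.Ioi i, (c j 1 - c i 1)

/-- Additivity of logarithmic derivatives, in a form that needs no division. -/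
theorem _root_.Derivation.prod_of_eigen {A ι : Type*} [CommRing A] [Algebra ℝ A]
    (D : Derivation ℝ A A) (t : Finset ι) (f g : ι → A) (h : ∀ i ∈ t, D (f i) = g i * f i) :
    D (∏ i ∈ t, f i) = (∑ i ∈ t, g i) * ∏ i ∈ t, f i := by
  classical
  induction t using Finset.induction_on with
  | empty => simp
  | insert i t hi ih =>
    rw [Finset.prod_insert hi, Finset.sum_insert hi, D.leibniz, smul_eq_mul, smul_eq_mul,
      ih fun j hj => h j (Finset.mem_insert_of_mem hj), h i (Finset.mem_insert_self i t)]
    ring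

/-- The vector field `∑ j, s_j(k) z_j ∂ / ∂ z_j`. -/
def field (n k : ℕ) : Derivation ℝ (Laurent n) (Laurent n) := ∑ j, s j k • euler j

theorem field_apply (k : ℕ) (F : Laurent n) : field n k F = ∑ j, s j k * euler j F := by
  have h : ∀ t : Finset (Fin n), (∑ j ∈ t, s j k • euler j) F = ∑ j ∈ t, s j k * euler j F := by
    intro t
    classical
    induction t using Finset.induction_on with
    | empty => simp
    | insert a t ha ih => rw [Finset.sum_insert ha, Finset.sum_insert ha, Derivation.add_apply, ih,
        Derivation.smul_apply, smul_eq_mul]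
  exact h _

/-- The field sends the factor `c_j(1) - c_i(1)` to `s_j(k) s_j(1) - s_i(k) s_i(1)`, which the
factor divides with quotient half of `divKernel`. -/
theorem field_vand (k : ℕ) :
    field n k (vand n) =
      ((1 / 2 : ℝ) • ∑ i, ∑ j ∈ Finset.Ioi i, divKernel k i j) * vand n := by
  rw [Finset.smul_sum]
  refine Derivation.prod_of_eigen _ _ _ _ fun i _ => ?_
  rw [Finset.smul_sum]
  refine Derivation.prod_of_eigen _ _ _ _ fun j _ => ?_
  have h := sub_mul_divKernel k i j
  have hf : ∀ a : Fin n, field n k (c a 1) = s a k * s a 1 := by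
    intro a
    simp [field_apply, euler_c]
  rw [map_sub, hf, hf, smul_mul_assoc, mul_comm (divKernel k i j), h, two_mul, ← two_smul ℝ (_ - _), smul_smul]
  norm_num

/-- In the product of two power sums the off-diagonal part yields `divKernel`, while the diagonal
yields `p k` and `p (2 (m + 1) - k)`; the `k` copies of `p k` make up the first term. Thus the
divergence of the field together with the logarithmic derivative of `Δ²` is a polynomial in power
sums, namely `loopQuad`. -/
theorem sum_divKernel (k : ℕ) :
    (k : ℝ) • p n k + ∑ i, ∑ j ∈ Finset.Ioi i, divKernel k i j =
      ∑ m ∈ Finset.range k,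
        (p n (m + 1) * p n (k - (m + 1)) - p n (2 * (m + 1) - k)) := by
  have h1 : ∑ i : Fin n, ∑ j ∈ Finset.Ioi i, divKernel k i j =
      ∑ i : Fin n, ∑ j ∈ Finset.univ.erase i, ∑ m ∈ Finset.range k,
        c i (m + 1) * c j (k - (m + 1)) := by
    have e : ∀ F : Fin n → Fin n → Laurent n, ∑ i, ∑ j ∈ Finset.univ.erase i, F i j =
        ∑ i, ∑ j ∈ Finset.Ioi i, (F i j + F j i) := by
      intro F
      have hs : ∀ i : Fin n, (Finset.univ.erase i) = Finset.Ioi i ∪ Finset.Iio i := by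
        intro i; ext j
        simp only [Finset.mem_erase, Finset.mem_univ, and_true, Finset.mem_union, Finset.mem_Ioi,
          Finset.mem_Iio]
        constructor
        · exact fun h => (lt_or_gt_of_ne h).symm
        · rintro (h | h)
          · exact h.ne'
          · exact h.ne
      simp_rw [hs]
      rw [Finset.sum_congr rfl fun i _ => Finset.sum_union (f := F i) (by
        rw [Finset.disjoint_left]; intro a ha hb
        simp only [Finset.mem_Ioi, Finset.mem_Iio] at ha hb
        exact lt_asymm ha hb)]
      simp_rw [Finset.sum_add_distrib]
      congr 1
      rw [Finset.sum_comm' (t' := Finset.univ) (s' := fun j => Finset.Ioi j)]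
      simp
    rw [e]
    refine Finset.sum_congr rfl fun i _ => Finset.sum_congr rfl fun j _ => ?_
    rw [divKernel, Finset.sum_add_distrib]
  have h2 : ∀ m : ℕ, p n (m + 1) * p n (k - (m + 1)) =
      (p n k + p n (2 * (m + 1) - k)) +
        ∑ i : Fin n, ∑ j ∈ Finset.univ.erase i, c i (m + 1) * c j (k - (m + 1)) := by
    intro m
    have h3 : ∀ i : Fin n, ∑ j, c i (m + 1) * c j (k - (m + 1)) =
        c i k + c i (2 * (m + 1) - k) +
          ∑ j ∈ Finset.univ.erase i, c i (m + 1) * c j (k - (m + 1)) := by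
      intro i
      rw [← Finset.add_sum_erase _ _ (Finset.mem_univ i), c_mul_c]
      rw [show (m : ℤ) + 1 + (k - (m + 1)) = k by ring,
        show (m : ℤ) + 1 - (k - (m + 1)) = 2 * (m + 1) - k by ring]
    simp only [p]
    rw [Finset.sum_mul_sum, Finset.sum_congr rfl fun i _ => h3 i, Finset.sum_add_distrib,
      Finset.sum_add_distrib]
  rw [h1]
  simp_rw [h2]
  rw [Finset.sum_congr rfl fun (m : ℕ) _ => show
    (p n k + p n (2 * (m + 1) - k)) + ∑ i : Fin n, ∑ j ∈ Finset.univ.erase i,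
      c i (m + 1) * c j (k - (m + 1)) - p n (2 * (m + 1) - k) = p n k +
      ∑ i : Fin n, ∑ j ∈ Finset.univ.erase i, c i (m + 1) * c j (k - (m + 1)) by ring,
    Finset.sum_add_distrib]
  congr 1
  · simp [Nat.cast_smul_eq_nsmul]
  · rw [Finset.sum_comm]
    refine Finset.sum_congr rfl fun i _ => ?_
    rw [Finset.sum_comm]

/-! ### The loop operators on abstract power sums -/

/-- Evaluation of abstract power sums at the power sums `p n k`. -/
def evP (n : ℕ) : MvPolynomial ℕ ℝ →ₐ[ℝ] Laurent n := MvPolynomial.aeval fun k => p n k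

end Laurent

open Laurent

/-- The derivation `X_m ↦ m (X_{k+m} - X_{|k-m|})` of the ring of abstract power sums. -/
def loopDer (k : ℕ) : Derivation ℝ (MvPolynomial ℕ ℝ) (MvPolynomial ℕ ℝ) :=
  MvPolynomial.mkDerivation ℝ fun m =>
    (m : ℝ) • (MvPolynomial.X (k + m) - MvPolynomial.X ((k : ℤ) - m).natAbs)

/-- The quadratic part of the loop operator. -/
def loopQuad (k : ℕ) : MvPolynomial ℕ ℝ :=
  ∑ m ∈ Finset.range k,
    (MvPolynomial.X (m + 1) * MvPolynomial.X (k - (m + 1)) -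
      MvPolynomial.X (2 * (m + 1 : ℤ) - k).natAbs)

/-- The loop operator. -/
def loopOp (k : ℕ) (P : MvPolynomial ℕ ℝ) : MvPolynomial ℕ ℝ := loopQuad k * P + loopDer k P

namespace Laurent

variable {n : ℕ}

@[simp] theorem evP_X (k : ℕ) : evP n (MvPolynomial.X k) = p n k := by simp [evP]

theorem evP_natAbs (k : ℤ) : evP n (MvPolynomial.X k.natAbs) = p n k := by
  rw [evP_X, Int.natCast_natAbs, p_abs]

/-- The chain rule. Allowing every `N` beyond a threshold lets all `j` share one finite range of
variables. -/
theorem euler_evP (j : Fin n) (P : MvPolynomial ℕ ℝ) :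
    ∃ N₀ : ℕ, ∀ N, N₀ ≤ N → euler j (evP n P) =
      ∑ m ∈ Finset.range N, (m : ℝ) • (s j m * evP n (MvPolynomial.pderiv m P)) := by
  induction P using MvPolynomial.induction_on with
  | C a =>
    refine ⟨0, fun N _ => ?_⟩
    rw [evP, MvPolynomial.aeval_C, Derivation.map_algebraMap]
    simp
  | add P Q hP hQ =>
    obtain ⟨N₁, h₁⟩ := hP
    obtain ⟨N₂, h₂⟩ := hQ
    refine ⟨max N₁ N₂, fun N hN => ?_⟩
    rw [map_add, map_add, h₁ N (le_of_max_le_left hN), h₂ N (le_of_max_le_right hN),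
      ← Finset.sum_add_distrib]
    refine Finset.sum_congr rfl fun m _ => ?_
    rw [map_add, map_add, mul_add, smul_add]
  | mul_X P i hP =>
    obtain ⟨N₁, h₁⟩ := hP
    refine ⟨max N₁ (i + 1), fun N hN => ?_⟩
    rw [map_mul, Derivation.leibniz, h₁ N (le_of_max_le_left hN), evP_X, euler_p]
    have h2 : ∀ m ∈ Finset.range N,
        (m : ℝ) • (s j m * evP n (MvPolynomial.pderiv m (P * MvPolynomial.X i))) =
        p n i • ((m : ℝ) • (s j m * evP n (MvPolynomial.pderiv m P))) +
          if i = m then evP n P • ((i : ℝ) • s j i) else 0 := by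
      intro m _
      rw [Derivation.leibniz, MvPolynomial.pderiv_X, map_add, smul_eq_mul, smul_eq_mul, map_mul,
        map_mul, evP_X]
      by_cases h : i = m
      · subst h
        rw [Pi.single_eq_same, if_pos rfl, map_one, smul_eq_mul, smul_eq_mul, mul_smul_comm,
          mul_smul_comm, ← smul_add]
        congr 1
        ring
      · rw [Pi.single_eq_of_ne h, if_neg h, map_zero, smul_eq_mul, mul_smul_comm,
          mul_zero, zero_add, add_zero]
        congr 1
        ring
    rw [Finset.sum_congr rfl h2, Finset.sum_add_distrib, ← Finset.smul_sum, add_comm,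
      Finset.sum_ite_eq, if_pos (Finset.mem_range.2 (by omega)), Int.cast_natCast]

/-- On generators this is `s_j(k) s_j(m) = c_j(k + m) - c_j(k - m)`, summed over `j`. -/
theorem field_evP (k : ℕ) (P : MvPolynomial ℕ ℝ) :
    field n k (evP n P) = evP n (loopDer k P) := by
  induction P using MvPolynomial.induction_on with
  | C a => 
    rw [evP, MvPolynomial.aeval_C, Derivation.map_algebraMap, ← MvPolynomial.algebraMap_eq,
      Derivation.map_algebraMap, map_zero]
  | add P Q hP hQ => simp only [map_add, hP, hQ]
  | mul_X P m hP =>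
    rw [map_mul, Derivation.leibniz, Derivation.leibniz, hP]
    simp only [smul_eq_mul, map_add, map_mul, loopDer, MvPolynomial.mkDerivation_X,
      map_smul, map_sub, evP_natAbs]
    simp only [evP_X]
    congr 2
    rw [field_apply]
    simp_rw [euler_p, mul_smul_comm, s_mul_s]
    rw [← Finset.smul_sum, Finset.sum_sub_distrib]
    simp [p]

theorem evP_loopQuad (k : ℕ) : evP n (loopQuad k) =
    ∑ m ∈ Finset.range k, (p n (m + 1) * p n (k - (m + 1)) - p n (2 * (m + 1) - k)) := by
  rw [loopQuad, map_sum]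
  refine Finset.sum_congr rfl fun m hm => ?_
  rw [map_sub, map_mul, evP_natAbs, evP_X, evP_X, Nat.cast_sub (Finset.mem_range.1 hm)]
  push_cast
  rfl

/-- The loop equation on the torus. The square of the Vandermonde factor doubles its logarithmic
derivative, which absorbs the `1 / 2` of `field_vand`. -/
theorem sum_euler_loop (k : ℕ) (P : MvPolynomial ℕ ℝ) :
    ∑ j, euler j (vand n ^ 2 * (s j k * evP n P)) = vand n ^ 2 * evP n (loopOp k P) := by
  have h : ∀ j : Fin n, euler j (vand n ^ 2 * (s j k * evP n P)) =
      (k : ℝ) • c j k * (vand n ^ 2 * evP n P) + s j k * euler j (vand n ^ 2 * evP n P) := by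
    intro j
    rw [mul_left_comm, Derivation.leibniz, euler_s, if_pos rfl, smul_eq_mul, smul_eq_mul,
      Int.cast_natCast]
    ring
  rw [Finset.sum_congr rfl fun j _ => h j, Finset.sum_add_distrib, ← Finset.sum_mul,
    ← Finset.smul_sum, ← field_apply, Derivation.leibniz, field_evP, sq, Derivation.leibniz,
    field_vand, loopOp, map_add, map_mul, evP_loopQuad, ← sum_divKernel]
  simp only [smul_eq_mul]
  have h2 : ∀ q : Laurent n, q = (1 / 2 : ℝ) • q + (1 / 2 : ℝ) • q := by
    intro q
    rw [← add_smul]; norm_num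
  rw [show ∑ j : Fin n, c j k = p n k from rfl]
  generalize hq : (∑ i : Fin n, ∑ j ∈ Finset.Ioi i, divKernel k i j) = q
  conv_rhs => rw [h2 q]
  ring

end Laurent

end SOCumulants

end

noncomputable section

namespace SOCumulants

/-! ### The loop equations for Haar measure -/

section Rotation

variable {N : ℕ}

/-- The elementary antisymmetric matrix `E_ab - E_ba`. -/
def antisym (a b : Fin N) : Matrix (Fin N) (Fin N) ℝ := Matrix.single a b 1 - Matrix.single b a 1

theorem antisym_transpose (a b : Fin N) : (antisym a b).transpose = -antisym a b := by
  simp [antisym]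

/-- This relation makes `rot` the one-parameter group generated by `antisym a b` in closed form
(Rodrigues' formula). -/
theorem antisym_cube (a b : Fin N) : antisym a b * antisym a b * antisym a b = -antisym a b := by
  rcases eq_or_ne a b with rfl | h
  · simp [antisym]
  · simp [antisym, sub_mul, mul_sub, h, h.symm]
    abel

/-- Rotation by the angle `t` in the coordinate plane `(a, b)`. -/
def rot (a b : Fin N) (t : ℝ) : Matrix (Fin N) (Fin N) ℝ :=
  1 + Real.sin t • antisym a b + (1 - Real.cos t) • (antisym a b * antisym a b)

theorem rot_mul_transpose (a b : Fin N) (t : ℝ) : rot a b t * (rot a b t).transpose = 1 := by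
  have h3 := antisym_cube a b
  have ht := antisym_transpose a b
  unfold rot
  set X := antisym a b
  have h3' : X * (X * X) = -X := by rw [← mul_assoc, h3]
  have h4 : X * X * (X * X) = -(X * X) := by rw [← mul_assoc, h3, neg_mul]
  have hs := Real.sin_sq_add_cos_sq t
  simp only [Matrix.transpose_add, Matrix.transpose_one, Matrix.transpose_smul,
    Matrix.transpose_mul, ht, add_mul, mul_add, one_mul, mul_one, Matrix.smul_mul, Matrix.mul_smul,
    neg_mul, mul_neg, neg_neg, h3, h3', h4]
  have : Real.sin t ^ 2 = 1 - Real.cos t ^ 2 := by linarith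
  match_scalars <;> linarith

theorem rot_half (a b : Fin N) (t : ℝ) : rot a b t = rot a b (t / 2) * rot a b (t / 2) := by
  have h3 := antisym_cube a b
  unfold rot
  set X := antisym a b
  have h3' : X * (X * X) = -X := by rw [← mul_assoc, h3]
  have h4 : X * X * (X * X) = -(X * X) := by rw [← mul_assoc, h3, neg_mul]
  have h1 : Real.sin t = 2 * Real.sin (t / 2) * Real.cos (t / 2) := by
    rw [← Real.sin_two_mul]; congr 1; ring
  have h2 : Real.cos t = 2 * Real.cos (t / 2) ^ 2 - 1 := by
    rw [← Real.cos_two_mul]; congr 1; ring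
  have hs := Real.sin_sq_add_cos_sq (t / 2)
  have : Real.sin (t / 2) ^ 2 = 1 - Real.cos (t / 2) ^ 2 := by linarith
  simp only [add_mul, mul_add, one_mul, mul_one, Matrix.smul_mul, Matrix.mul_smul, h3, h3',
    h4, h1, h2]
  match_scalars <;> linarith

/-- A rotation is the square of the rotation by half the angle, whose determinant squares to one by
orthogonality. -/
theorem rot_det (a b : Fin N) (t : ℝ) : (rot a b t).det = 1 := by
  have h := congrArg Matrix.det (rot_mul_transpose a b (t / 2))
  rw [Matrix.det_mul, Matrix.det_transpose, Matrix.det_one] at h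
  rw [rot_half, Matrix.det_mul, h]

/-- Rotations as elements of `SO(N)`. -/
def rotSO (a b : Fin N) (t : ℝ) : SO N :=
  ⟨rot a b t, Matrix.mem_specialOrthogonalGroup_iff.2
    ⟨(Matrix.mem_orthogonalGroup_iff (Fin N) ℝ).2 (rot_mul_transpose a b t), rot_det a b t⟩⟩

@[simp] theorem rot_zero (a b : Fin N) : rot a b 0 = 1 := by simp [rot]

theorem trace_mul_antisym (A : Matrix (Fin N) (Fin N) ℝ) (a b : Fin N) :
    (A * antisym a b).trace = A b a - A a b := by
  simp [antisym, mul_sub, Matrix.trace_mul_single]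

/-- Contraction over a spanning family of the Lie algebra `so(N)`: two traces merge into one. The
factor 2 comes from summing over ordered pairs. -/
theorem sum_trace_antisym (A B : Matrix (Fin N) (Fin N) ℝ) :
    ∑ a, ∑ b, (A * antisym a b).trace * (B * antisym a b).trace =
      2 * ((A * B.transpose).trace - (A * B).trace) := by
  have h1 : (A * B.transpose).trace = ∑ a, ∑ b, A a b * B a b := by
    simp [Matrix.trace, Matrix.mul_apply]
  have h2 : (A * B).trace = ∑ a, ∑ b, A a b * B b a := by
    simp [Matrix.trace, Matrix.mul_apply]
  have e1 : ∑ a, ∑ b, A b a * B b a = ∑ a, ∑ b, A a b * B a b := Finset.sum_comm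
  have e2 : ∑ a, ∑ b, A b a * B a b = ∑ a, ∑ b, A a b * B b a := Finset.sum_comm
  simp only [trace_mul_antisym]
  simp only [sub_mul, mul_sub, Finset.sum_sub_distrib]
  rw [h1, h2, e1, e2]
  ring

/-- The companion contraction, in which one trace splits into two. -/
theorem sum_trace_antisym_antisym (A B : Matrix (Fin N) (Fin N) ℝ) :
    ∑ a, ∑ b, (A * antisym a b * B * antisym a b).trace =
      2 * ((A * B.transpose).trace - A.trace * B.trace) := by
  have key : ∀ a b c d : Fin N, (A * Matrix.single a b 1 * B * Matrix.single c d 1).trace =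
      A d a * B b c := by
    intro a b c d
    rw [Matrix.trace_mul_single, Matrix.mul_apply]
    simp [Matrix.mul_apply, Matrix.single_apply, ite_and]
  have h1 : (A * B.transpose).trace = ∑ a, ∑ b, A a b * B a b := by
    simp [Matrix.trace, Matrix.mul_apply]
  have e1 : ∑ a, ∑ b, A b a * B b a = ∑ a, ∑ b, A a b * B a b := Finset.sum_comm
  have h2 : A.trace * B.trace = ∑ a, ∑ b, A a a * B b b := by
    simp [Matrix.trace, Finset.sum_mul_sum]
  have e2 : ∑ a, ∑ b, A b b * B a a = ∑ a, ∑ b, A a a * B b b := Finset.sum_comm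
  simp only [antisym, mul_sub, sub_mul, Matrix.trace_sub, key, Finset.sum_sub_distrib]
  rw [h1, h2, e1, e2]
  ring

end Rotation

/-- Evaluation of abstract power sums at the traces of powers of a matrix. -/
def evTr {N : ℕ} (A : Matrix (Fin N) (Fin N) ℝ) : MvPolynomial ℕ ℝ →ₐ[ℝ] ℝ :=
  MvPolynomial.aeval fun k => (A ^ k).trace

section Haar

attribute [local instance] Matrix.linftyOpNormedRing Matrix.linftyOpNormedAlgebra

variable {N : ℕ}

theorem integral_rot (F : Matrix (Fin N) (Fin N) ℝ → ℝ) (a b : Fin N) (t : ℝ) :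
    ∫ M : SO N, F (rot a b t * M.1) ∂haarSO N = ∫ M : SO N, F M.1 ∂haarSO N := by
  have : (haarSO N).IsMulLeftInvariant := by unfold haarSO; infer_instance
  exact integral_mul_left_eq_self (μ := haarSO N) (fun M : SO N => F M.1) (rotSO a b t)

theorem hasDerivAt_rot (a b : Fin N) (t : ℝ) :
    HasDerivAt (rot a b)
      (Real.cos t • antisym a b + Real.sin t • (antisym a b * antisym a b)) t := by
  have h := (((Real.hasDerivAt_sin t).smul_const (antisym a b)).const_add 1).add
    (((Real.hasDerivAt_cos t).const_sub 1).smul_const (antisym a b * antisym a b))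
  rw [neg_neg] at h
  exact h

theorem continuous_integrable_haarSO {F : SO N → ℝ} (hF : Continuous F) :
    Integrable F (haarSO N) := by
  obtain ⟨C, hC⟩ := isCompact_univ.exists_bound_of_continuousOn hF.continuousOn
  exact Integrable.of_bound hF.measurable.aestronglyMeasurable C
    (Filter.Eventually.of_forall fun x => hC x (Set.mem_univ x))

/-- By left invariance `t ↦ ∫ F (rot a b t * M)` is constant; the integral is its derivative at `0`.
Compactness of `[-1, 1] × SO(N)` supplies the bound for differentiating under the integral. -/
theorem integral_fderiv_antisym (F : Matrix (Fin N) (Fin N) ℝ → ℝ) (hF : ContDiff ℝ 1 F)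
    (a b : Fin N) : ∫ M : SO N, fderiv ℝ F M.1 (antisym a b * M.1) ∂haarSO N = 0 := by
  set R' : ℝ → Matrix (Fin N) (Fin N) ℝ := fun t =>
    Real.cos t • antisym a b + Real.sin t • (antisym a b * antisym a b) with hR'
  have hR'c : Continuous R' := by fun_prop
  have hRc : Continuous (rot a b) := by unfold rot; fun_prop
  have hfd : Continuous (fderiv ℝ F) := hF.continuous_fderiv one_ne_zero
  have hjoint : Continuous fun q : ℝ × SO N =>
      fderiv ℝ F (rot a b q.1 * q.2.1) (R' q.1 * q.2.1) := by
    have h1 : Continuous fun q : ℝ × SO N => rot a b q.1 * q.2.1 :=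
      (hRc.comp continuous_fst).mul (continuous_subtype_val.comp continuous_snd)
    have h2 : Continuous fun q : ℝ × SO N => R' q.1 * q.2.1 :=
      (hR'c.comp continuous_fst).mul (continuous_subtype_val.comp continuous_snd)
    exact (hfd.comp h1).clm_apply h2
  obtain ⟨C, hC⟩ := ((isCompact_Icc (a := (-1 : ℝ)) (b := 1)).prod
    (isCompact_univ (X := SO N))).exists_bound_of_continuousOn hjoint.continuousOn
  have hmeas : ∀ t, Continuous fun M : SO N => F (rot a b t * M.1) := fun t =>
    hF.continuous.comp (continuous_const.mul continuous_subtype_val)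
  have h := hasDerivAt_integral_of_dominated_loc_of_deriv_le (μ := haarSO N) (x₀ := (0 : ℝ))
    (s := Set.Icc (-1) 1) (F := fun t (M : SO N) => F (rot a b t * M.1))
    (F' := fun t (M : SO N) => fderiv ℝ F (rot a b t * M.1) (R' t * M.1)) (bound := fun _ => C)
    (Icc_mem_nhds (by norm_num) (by norm_num))
    (Filter.Eventually.of_forall fun t => (hmeas t).measurable.aestronglyMeasurable)
    (continuous_integrable_haarSO (hmeas 0))
    ((hjoint.comp (Continuous.prodMk_right (0 : ℝ))).measurable.aestronglyMeasurable)
    (Filter.Eventually.of_forall fun M t ht => hC (t, M) ⟨ht, Set.mem_univ M⟩)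
    (integrable_const C)
    (Filter.Eventually.of_forall fun M t _ => by
      have h1 : HasDerivAt (fun t => rot a b t * M.1) (R' t * M.1) t :=
        (hasDerivAt_rot a b t).mul_const M.1
      exact ((hF.differentiable one_ne_zero _).hasFDerivAt).comp_hasDerivAt t h1)
  have h2 := h.2
  simp only [integral_rot] at h2
  have h3 := h2.unique (hasDerivAt_const (0 : ℝ) _)
  simpa [hR'] using h3

theorem contDiff_trace_pow_mul (k : ℕ) (Y : Matrix (Fin N) (Fin N) ℝ) :
    ContDiff ℝ 1 fun A : Matrix (Fin N) (Fin N) ℝ => (A ^ k * Y).trace := by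
  have h : ContDiff ℝ 1 fun A : Matrix (Fin N) (Fin N) ℝ => A ^ k * Y :=
    (contDiff_id.pow k).mul contDiff_const
  exact (LinearMap.toContinuousLinearMap (Matrix.traceLinearMap (Fin N) ℝ ℝ)).contDiff.comp h

theorem contDiff_evTr (P : MvPolynomial ℕ ℝ) :
    ContDiff ℝ 1 fun A : Matrix (Fin N) (Fin N) ℝ => evTr A P := by
  induction P using MvPolynomial.induction_on with
  | C a => simpa [evTr] using contDiff_const
  | add P Q hP hQ => simpa using hP.add hQ
  | mul_X P m hP =>
    have := contDiff_trace_pow_mul (N := N) m 1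
    simp only [mul_one] at this
    simpa [evTr] using hP.mul this

theorem hasDerivAt_pow_line (M Y : Matrix (Fin N) (Fin N) ℝ) (k : ℕ) :
    HasDerivAt (fun t : ℝ => (M + t • Y) ^ k)
      (∑ i ∈ Finset.range k, M ^ i * Y * M ^ (k - 1 - i)) 0 := by
  induction k with
  | zero => exact hasDerivAt_const (0 : ℝ) (1 : Matrix (Fin N) (Fin N) ℝ)
  | succ k ih =>
    have h1 : HasDerivAt (fun t : ℝ => M + t • Y) Y 0 := by
      have h0 := ((hasDerivAt_id (0 : ℝ)).smul_const Y).const_add M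
      rw [one_smul] at h0
      exact h0
    have h := ih.mul h1
    simp only [zero_smul, add_zero] at h
    simp only [pow_succ (M + _ • Y)]
    refine h.congr_deriv ?_
    rw [Finset.sum_range_succ, Finset.sum_mul]
    congr 1
    · refine Finset.sum_congr rfl fun i hi => ?_
      have : k + 1 - 1 - i = (k - 1 - i) + 1 := by have := Finset.mem_range.1 hi; omega
      rw [this, pow_succ, ← mul_assoc]
    · simp

theorem hasDerivAt_line {F : Matrix (Fin N) (Fin N) ℝ → ℝ} (hF : ContDiff ℝ 1 F)
    (M Y : Matrix (Fin N) (Fin N) ℝ) :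
    HasDerivAt (fun t : ℝ => F (M + t • Y)) (fderiv ℝ F M Y) 0 := by
  have h1 : HasDerivAt (fun t : ℝ => M + t • Y) Y 0 := by
    have h0 := ((hasDerivAt_id (0 : ℝ)).smul_const Y).const_add M
    rw [one_smul] at h0
    exact h0
  have h2 := ((hF.differentiable one_ne_zero (M + (0 : ℝ) • Y)).hasFDerivAt).comp_hasDerivAt
    (0 : ℝ) h1
  simp only [zero_smul, add_zero] at h2
  exact h2

theorem fderiv_eq_of_hasDerivAt_line {F : Matrix (Fin N) (Fin N) ℝ → ℝ} (hF : ContDiff ℝ 1 F)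
    {M Y : Matrix (Fin N) (Fin N) ℝ} {d : ℝ}
    (h : HasDerivAt (fun t : ℝ => F (M + t • Y)) d 0) : fderiv ℝ F M Y = d :=
  (hasDerivAt_line hF M Y).unique h

theorem fderiv_mul_apply {F G : Matrix (Fin N) (Fin N) ℝ → ℝ} (hF : ContDiff ℝ 1 F)
    (hG : ContDiff ℝ 1 G) (M Y : Matrix (Fin N) (Fin N) ℝ) :
    fderiv ℝ (fun A => F A * G A) M Y = F M * fderiv ℝ G M Y + G M * fderiv ℝ F M Y := by
  refine fderiv_eq_of_hasDerivAt_line (hF.mul hG) ?_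
  refine ((hasDerivAt_line hF M Y).mul (hasDerivAt_line hG M Y)).congr_deriv ?_
  simp only [zero_smul, add_zero]
  ring

theorem fderiv_add_apply {F G : Matrix (Fin N) (Fin N) ℝ → ℝ} (hF : ContDiff ℝ 1 F)
    (hG : ContDiff ℝ 1 G) (M Y : Matrix (Fin N) (Fin N) ℝ) :
    fderiv ℝ (fun A => F A + G A) M Y = fderiv ℝ F M Y + fderiv ℝ G M Y :=
  fderiv_eq_of_hasDerivAt_line (hF.add hG)
    ((hasDerivAt_line hF M Y).add (hasDerivAt_line hG M Y))

theorem fderiv_trace_pow_mul (k : ℕ) (M Y Z : Matrix (Fin N) (Fin N) ℝ) :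
    fderiv ℝ (fun A : Matrix (Fin N) (Fin N) ℝ => (A ^ k * Z).trace) M Y =
      ∑ i ∈ Finset.range k, (M ^ i * Y * M ^ (k - 1 - i) * Z).trace := by
  refine fderiv_eq_of_hasDerivAt_line (contDiff_trace_pow_mul k Z) ?_
  have h := (hasDerivAt_pow_line M Y k).mul_const Z
  have h2 := (LinearMap.toContinuousLinearMap
    (Matrix.traceLinearMap (Fin N) ℝ ℝ)).hasFDerivAt.comp_hasDerivAt (0 : ℝ) h
  refine h2.congr_deriv ?_
  rw [Finset.sum_mul]
  exact map_sum (Matrix.traceLinearMap (Fin N) ℝ ℝ) _ _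

/-- By cyclicity of the trace the `k` terms of the product rule agree. -/
theorem fderiv_trace_pow (k : ℕ) (M Y : Matrix (Fin N) (Fin N) ℝ) :
    fderiv ℝ (fun A : Matrix (Fin N) (Fin N) ℝ => (A ^ k).trace) M (Y * M) =
      k * (M ^ k * Y).trace := by
  have h := fderiv_trace_pow_mul k M (Y * M) 1
  simp only [mul_one] at h
  rw [h, Finset.sum_congr rfl (g := fun _ => (M ^ k * Y).trace)]
  · simp
  · intro i hi
    have : k = 1 + (k - 1 - i) + i := by have := Finset.mem_range.1 hi; omega
    rw [mul_assoc, Matrix.trace_mul_comm, mul_assoc, mul_assoc, ← pow_add, Matrix.trace_mul_comm, mul_assoc, ← mul_assoc,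
      ← pow_succ']
    congr 3
    omega

/-- The trace of the (possibly negative) power `M ^ k` of an orthogonal matrix. -/
theorem trace_pow_mul_transpose (M : SO N) (a b : ℕ) :
    (M.1 ^ a * (M.1 ^ b).transpose).trace = (M.1 ^ ((a : ℤ) - b).natAbs).trace := by
  have h : ∀ a b : ℕ, b ≤ a → M.1 ^ a * (M.1 ^ b).transpose = M.1 ^ (a - b) := by
    intro a b hab
    have h1 : M.1 ^ b * (M.1 ^ b).transpose = 1 := SO.mul_transpose (M ^ b)
    obtain ⟨d, rfl⟩ := Nat.exists_eq_add_of_le' hab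
    rw [pow_add, mul_assoc, h1, mul_one, Nat.add_sub_cancel]
  rcases le_total b a with hab | hab
  · rw [h a b hab]
    congr 2
    omega
  · rw [← Matrix.trace_transpose, Matrix.transpose_mul, Matrix.transpose_transpose, h b a hab]
    congr 2
    omega

/-- On generators this is `sum_trace_antisym` with `B = M ^ m`, whose transpose is the inverse
power; hence the index `|k - m|`. -/
theorem evTr_loopDer (k : ℕ) (P : MvPolynomial ℕ ℝ) (M : SO N) :
    ∑ a, ∑ b, (M.1 ^ k * antisym a b).trace *
        fderiv ℝ (fun A : Matrix (Fin N) (Fin N) ℝ => evTr A P) M.1 (antisym a b * M.1) =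
      -2 * evTr M.1 (loopDer k P) := by
  induction P using MvPolynomial.induction_on with
  | C r =>
    simp [evTr, ← MvPolynomial.algebraMap_eq, Derivation.map_algebraMap]
  | add P Q hP hQ =>
    have h : ∀ Y, fderiv ℝ (fun A : Matrix (Fin N) (Fin N) ℝ => evTr A (P + Q)) M.1 Y =
        fderiv ℝ (fun A : Matrix (Fin N) (Fin N) ℝ => evTr A P) M.1 Y +
        fderiv ℝ (fun A : Matrix (Fin N) (Fin N) ℝ => evTr A Q) M.1 Y := by
      intro Y
      simp only [map_add]
      exact fderiv_add_apply (contDiff_evTr P) (contDiff_evTr Q) _ _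
    simp only [h]
    simp only [mul_add, Finset.sum_add_distrib, hP, hQ, map_add]
  | mul_X P m hP =>
    have h : ∀ Y, fderiv ℝ (fun A : Matrix (Fin N) (Fin N) ℝ => evTr A (P * MvPolynomial.X m))
          M.1 (Y * M.1) =
        evTr M.1 P * (m * (M.1 ^ m * Y).trace) + (M.1 ^ m).trace *
        fderiv ℝ (fun A : Matrix (Fin N) (Fin N) ℝ => evTr A P) M.1 (Y * M.1) := by
      intro Y
      have h1 := contDiff_trace_pow_mul (N := N) m 1
      simp only [mul_one] at h1
      have h2 : (fun A : Matrix (Fin N) (Fin N) ℝ => evTr A (P * MvPolynomial.X m)) =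
          fun A => evTr A P * (A ^ m).trace := by
        funext A; simp [evTr]
      rw [h2, fderiv_mul_apply (contDiff_evTr P) h1, ← fderiv_trace_pow]
    have h3 := sum_trace_antisym (M.1 ^ k) (M.1 ^ m)
    rw [trace_pow_mul_transpose, ← pow_add] at h3
    have h4 : ∀ a b, (M.1 ^ k * antisym a b).trace *
        (evTr M.1 P * (m * (M.1 ^ m * antisym a b).trace) + (M.1 ^ m).trace *
        fderiv ℝ (fun A : Matrix (Fin N) (Fin N) ℝ => evTr A P) M.1 (antisym a b * M.1)) =
        (evTr M.1 P * m) * ((M.1 ^ k * antisym a b).trace * (M.1 ^ m * antisym a b).trace) +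
        (M.1 ^ m).trace * ((M.1 ^ k * antisym a b).trace *
        fderiv ℝ (fun A : Matrix (Fin N) (Fin N) ℝ => evTr A P) M.1 (antisym a b * M.1)) := by
      intro a b; ring
    simp only [h, h4, Finset.sum_add_distrib, ← Finset.mul_sum, hP, h3]
    simp only [Derivation.leibniz, smul_eq_mul, map_add, map_mul, loopDer,
      MvPolynomial.mkDerivation_X, map_smul, map_sub]
    simp only [evTr, MvPolynomial.aeval_X]
    ring

/-- The product rule inserts a second `antisym a b` at each of the `k` places of the word, and
`sum_trace_antisym_antisym` cuts the word into powers `i` and `k - i`. -/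
theorem evTr_loopQuad (k : ℕ) (M : SO N) :
    ∑ a, ∑ b, fderiv ℝ (fun A : Matrix (Fin N) (Fin N) ℝ => (A ^ k * antisym a b).trace) M.1
        (antisym a b * M.1) = -2 * evTr M.1 (loopQuad k) := by
  have h : ∀ i ∈ Finset.range k, ∑ a, ∑ b,
      (M.1 ^ i * (antisym a b * M.1) * M.1 ^ (k - 1 - i) * antisym a b).trace =
      2 * ((M.1 ^ ((i : ℤ) - (k - i : ℕ)).natAbs).trace -
        (M.1 ^ i).trace * (M.1 ^ (k - i)).trace) := by
    intro i hi
    have hki : k - i = 1 + (k - 1 - i) := by have := Finset.mem_range.1 hi; omega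
    have h1 : ∀ a b, M.1 ^ i * (antisym a b * M.1) * M.1 ^ (k - 1 - i) * antisym a b =
        M.1 ^ i * antisym a b * M.1 ^ (k - i) * antisym a b := by
      intro a b
      rw [hki, pow_add, pow_one]
      simp only [mul_assoc]
    simp only [h1]
    rw [sum_trace_antisym_antisym, trace_pow_mul_transpose]
  simp only [fderiv_trace_pow_mul]
  -- The sum over `i` is reversed, `i = k - 1 - m`, so that the two powers become `k - (m + 1)` and
  -- `m + 1` as in `loopQuad`.
  rw [Finset.sum_congr rfl fun a _ => Finset.sum_comm, Finset.sum_comm, Finset.sum_congr rfl h,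
    loopQuad, map_sum, Finset.mul_sum, ← Finset.sum_range_reflect]
  refine Finset.sum_congr rfl fun m hm => ?_
  have hm' := Finset.mem_range.1 hm
  have e1 : k - (k - 1 - m) = m + 1 := by omega
  have e2 : k - 1 - m = k - (m + 1) := by omega
  have e3 : (((k - (m + 1) : ℕ) : ℤ) - ((m + 1 : ℕ) : ℤ)).natAbs =
      (2 * (m + 1 : ℤ) - k).natAbs := by omega
  rw [e1, e2, e3]
  simp only [evTr, map_sub, map_mul, MvPolynomial.aeval_X]
  ring

/-- The loop equation for Haar measure: `integral_fderiv_antisym` for the functions `tr (A ^ k X)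
P(A)` with `X = antisym a b`, summed over all `a, b`. -/
theorem integral_loopOp (k : ℕ) (P : MvPolynomial ℕ ℝ) :
    ∫ M : SO N, evTr M.1 (loopOp k P) ∂haarSO N = 0 := by
  have hc : ∀ a b : Fin N, ContDiff ℝ 1 fun A : Matrix (Fin N) (Fin N) ℝ =>
      (A ^ k * antisym a b).trace * evTr A P := fun a b =>
    (contDiff_trace_pow_mul k _).mul (contDiff_evTr P)
  have hd : ∀ (M : SO N) (a b : Fin N), fderiv ℝ (fun A : Matrix (Fin N) (Fin N) ℝ =>
      (A ^ k * antisym a b).trace * evTr A P) M.1 (antisym a b * M.1) =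
      (M.1 ^ k * antisym a b).trace *
        fderiv ℝ (fun A : Matrix (Fin N) (Fin N) ℝ => evTr A P) M.1 (antisym a b * M.1) +
      evTr M.1 P * fderiv ℝ (fun A : Matrix (Fin N) (Fin N) ℝ =>
        (A ^ k * antisym a b).trace) M.1 (antisym a b * M.1) := by
    intro M a b
    exact fderiv_mul_apply (contDiff_trace_pow_mul k _) (contDiff_evTr P) _ _
  have hint : ∀ a b : Fin N, Integrable (fun M : SO N =>
      fderiv ℝ (fun A : Matrix (Fin N) (Fin N) ℝ =>
        (A ^ k * antisym a b).trace * evTr A P) M.1 (antisym a b * M.1)) (haarSO N) := by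
    intro a b
    refine continuous_integrable_haarSO ?_
    exact (((hc a b).continuous_fderiv one_ne_zero).comp continuous_subtype_val).clm_apply
      (continuous_const.mul continuous_subtype_val)
  have h0 : ∫ M : SO N, ∑ a, ∑ b, fderiv ℝ (fun A : Matrix (Fin N) (Fin N) ℝ =>
      (A ^ k * antisym a b).trace * evTr A P) M.1 (antisym a b * M.1) ∂haarSO N = 0 := by
    rw [integral_finsetSum _ fun a _ => integrable_finsetSum _ fun b _ => hint a b]
    refine Finset.sum_eq_zero fun a _ => ?_
    rw [integral_finsetSum _ fun b _ => hint a b]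
    exact Finset.sum_eq_zero fun b _ => integral_fderiv_antisym _ (hc a b) a b
  have h1 : ∀ M : SO N, ∑ a, ∑ b, fderiv ℝ (fun A : Matrix (Fin N) (Fin N) ℝ =>
      (A ^ k * antisym a b).trace * evTr A P) M.1 (antisym a b * M.1) =
      -2 * evTr M.1 (loopOp k P) := by
    intro M
    simp only [hd, Finset.sum_add_distrib, ← Finset.mul_sum, evTr_loopDer, evTr_loopQuad, loopOp,
      map_add, map_mul]
    ring
  simp only [h1, integral_const_mul] at h0
  simpa using h0

end Haar

end SOCumulants

end

noncomputable section

namespace SOCumulants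

/-! ### Jacobi's formula and traces of powers -/

section Jacobi

variable {S A ι : Type*} [CommRing S] [CommRing A] [Algebra S A]

theorem derivation_prod [DecidableEq ι] (D : Derivation S A A) (t : Finset ι) (f : ι → A) :
    D (∏ i ∈ t, f i) = ∑ i ∈ t, D (f i) * ∏ j ∈ t.erase i, f j := by
  induction t using Finset.induction_on with
  | empty => simp
  | insert a t ha ih =>
    rw [Finset.prod_insert ha, D.leibniz, ih, Finset.sum_insert ha, Finset.erase_insert ha,
      smul_eq_mul, smul_eq_mul, Finset.mul_sum, add_comm, mul_comm]
    congr 1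
    refine Finset.sum_congr rfl fun i hi => ?_
    have hne : a ≠ i := fun h => ha (h ▸ hi)
    rw [Finset.erase_insert_of_ne hne, Finset.prod_insert (fun h => ha (Finset.mem_of_mem_erase h))]
    ring

variable [Fintype ι] [DecidableEq ι]

/-- The Leibniz rule on the permutation expansion differentiates one column at a time, and Cramer's
rule evaluates the determinants with a replaced column. -/
theorem derivation_det (D : Derivation S A A) (B : Matrix ι ι A) :
    D B.det = (B.adjugate * B.map D).trace := by
  have h1 : D B.det = ∑ i, (B.updateCol i fun j => D (B j i)).det := by
    rw [Matrix.det_apply, map_sum]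
    simp_rw [Matrix.det_apply, Units.smul_def, map_zsmul, derivation_prod]
    rw [Finset.sum_comm]
    refine Finset.sum_congr rfl fun σ _ => ?_
    rw [Finset.smul_sum]
    refine Finset.sum_congr rfl fun i _ => ?_
    congr 1
    rw [← Finset.mul_prod_erase _ _ (Finset.mem_univ i)]
    congr 1
    · simp
    · refine Finset.prod_congr rfl fun j hj => ?_
      rw [Matrix.updateCol_ne (Finset.ne_of_mem_erase hj)]
  rw [h1, Matrix.trace]
  refine Finset.sum_congr rfl fun i _ => ?_
  rw [← Matrix.cramer_apply, Matrix.cramer_eq_adjugate_mulVec]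
  rfl

theorem derivation_det_of_inv (D : Derivation S A A) {B C : Matrix ι ι A} (h : B * C = 1) :
    D B.det = B.det * (C * B.map D).trace := by
  have h2 : B.adjugate = B.det • C := by
    calc B.adjugate = B.adjugate * (B * C) := by rw [h, mul_one]
      _ = B.det • C := by rw [← mul_assoc, Matrix.adjugate_mul, Matrix.smul_mul, one_mul]
  rw [derivation_det, h2, Matrix.smul_mul, Matrix.trace_smul, smul_eq_mul]

end Jacobi

section TracePow

-- Newton's identities as a logarithmic derivative: `det (1 - X M)` is differentiated by Jacobi's
-- formula, with inverse matrix `∑ M ^ d X ^ d`, and also as a product over the roots.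
open PowerSeries in
theorem trace_pow_eq_sum_roots {ι : Type*} [Fintype ι] [DecidableEq ι] (M : Matrix ι ι ℂ) (k : ℕ) :
    (M ^ k).trace = (M.charpoly.roots.map fun x => x ^ k).sum := by
  rcases Nat.eq_zero_or_pos k with rfl | hk
  · have h := (IsAlgClosed.splits M.charpoly).natDegree_eq_card_roots
    rw [Matrix.charpoly_natDegree_eq_dim] at h
    simp [← h]
  set B : Matrix ι ι ℂ⟦X⟧ := 1 - (X : ℂ⟦X⟧) • M.map (C (R := ℂ)) with hB
  set G : Matrix ι ι ℂ⟦X⟧ := Matrix.of fun i j => PowerSeries.mk fun d => (M ^ d) i j with hG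
  have hBG : B * G = 1 := by
    ext i j d
    rw [hB, sub_mul, one_mul, Matrix.smul_mul, Matrix.sub_apply, Matrix.smul_apply, smul_eq_mul,
      map_sub]
    have h2 : (M.map (C (R := ℂ)) * G) i j = PowerSeries.mk fun d => (M ^ (d + 1)) i j := by
      ext d
      rw [Matrix.mul_apply, map_sum]
      simp [hG, PowerSeries.coeff_C_mul, pow_succ', Matrix.mul_apply]
    rw [h2]
    cases d with
    | zero => 
      simp [hG, Matrix.one_apply]
    | succ d =>
      rw [PowerSeries.coeff_succ_X_mul]
      simp only [hG, Matrix.of_apply, coeff_mk, sub_self, Matrix.one_apply]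
      split_ifs <;> simp [PowerSeries.coeff_one]
  have hdet : B.det = (M.charpoly.roots.map fun x => (1 - X * C x : ℂ⟦X⟧)).prod := by
    have h1 : B.det = ((M.charpolyRev : Polynomial ℂ) : ℂ⟦X⟧) := by
      rw [Matrix.charpolyRev, ← Polynomial.coeToPowerSeries.ringHom_apply, RingHom.map_det]
      congr 1
      ext i j : 1
      simp only [hB, Matrix.sub_apply, Matrix.smul_apply, Matrix.map_apply, smul_eq_mul,
        RingHom.mapMatrix_apply, map_sub, map_mul, Polynomial.coeToPowerSeries.ringHom_apply,
        Polynomial.coe_X, Polynomial.coe_C, Matrix.one_apply]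
      split_ifs <;> simp
    have h2 : M.charpoly = (M.charpoly.roots.map fun x => Polynomial.X - Polynomial.C x).prod :=
      ((IsAlgClosed.splits M.charpoly).eq_prod_roots_of_monic M.charpoly_monic)
    have h3 : ∀ s : Multiset ℂ, (s.map fun x => Polynomial.X - Polynomial.C x).prod.reverse =
        (s.map fun x => (1 - Polynomial.X * Polynomial.C x : Polynomial ℂ)).prod := by
      intro s
      induction s using Multiset.induction_on with
      | empty => simpa using Polynomial.reverse_C (1 : ℂ)
      | cons a s ih =>
        rw [Multiset.map_cons, Multiset.prod_cons, Polynomial.reverse_mul_of_domain, ih,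
          Multiset.map_cons, Multiset.prod_cons]
        congr 1
        have h4 := Polynomial.reverse_add_C (Polynomial.X : Polynomial ℂ) (-a)
        have h5 : (Polynomial.X : Polynomial ℂ).reverse = 1 := by
          rw [← one_mul Polynomial.X, Polynomial.reverse_mul_X]
          simpa using Polynomial.reverse_C (1 : ℂ)
        rw [h5, Polynomial.natDegree_X, pow_one, Polynomial.C_neg, ← sub_eq_add_neg] at h4
        rw [h4]
        simp [sub_eq_add_neg, Polynomial.X_mul_C]
    rw [h1, ← Matrix.reverse_charpoly, h2, h3, ← Polynomial.coeToPowerSeries.ringHom_apply,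
      map_multiset_prod, Multiset.map_map, ← h2]
    congr 1
    refine Multiset.map_congr rfl fun x _ => ?_
    simp
    exact mul_comm _ _
  have hD1 : d⁄dX ℂ B.det = B.det * -PowerSeries.mk (fun d => (M ^ (d + 1)).trace) := by
    rw [derivation_det_of_inv _ hBG]
    congr 1
    have h1 : B.map (d⁄dX ℂ) = -M.map (C (R := ℂ)) := by
      ext i j : 1
      simp only [hB, Matrix.map_apply, Matrix.sub_apply, Matrix.smul_apply, smul_eq_mul,
        Matrix.neg_apply, map_sub, Derivation.leibniz]
      rw [PowerSeries.derivative_X, PowerSeries.derivative_C, Matrix.one_apply]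
      split_ifs <;> simp
    rw [h1, mul_neg, Matrix.trace_neg]
    congr 1
    ext d
    rw [Matrix.trace, map_sum, coeff_mk, Matrix.trace]
    refine Finset.sum_congr rfl fun i _ => ?_
    rw [Matrix.diag_apply, Matrix.mul_apply, map_sum, Matrix.diag_apply, pow_succ,
      Matrix.mul_apply]
    refine Finset.sum_congr rfl fun j _ => ?_
    simp [hG, PowerSeries.coeff_mul_C]
  have hD2 : ∀ s : Multiset ℂ, d⁄dX ℂ (s.map fun x => (1 - X * C x : ℂ⟦X⟧)).prod =
      (s.map fun x => (1 - X * C x : ℂ⟦X⟧)).prod *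
        -PowerSeries.mk (fun d => (s.map fun x => x ^ (d + 1)).sum) := by
    intro s
    induction s using Multiset.induction_on with
    | empty => 
      simp
      rfl
    | cons a s ih =>
      have h1 : (1 - X * C a : ℂ⟦X⟧) * PowerSeries.mk (fun d => a ^ (d + 1)) = C a := by
        ext d
        rw [sub_mul, one_mul, map_sub, mul_assoc]
        cases d with
        | zero => simp
        | succ d =>
          rw [PowerSeries.coeff_succ_X_mul, PowerSeries.coeff_C_mul, coeff_mk, coeff_mk,
            PowerSeries.coeff_C]
          simp; ring
      have h2 : d⁄dX ℂ (1 - X * C a : ℂ⟦X⟧) = -C a := by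
        rw [map_sub, Derivation.leibniz, PowerSeries.derivative_X, PowerSeries.derivative_C]
        simp
      have h3 : (PowerSeries.mk (fun d => ((a ::ₘ s).map fun x => x ^ (d + 1)).sum) : ℂ⟦X⟧) =
          PowerSeries.mk (fun d => a ^ (d + 1)) +
            PowerSeries.mk (fun d => (s.map fun x => x ^ (d + 1)).sum) := by
        ext d; simp
      rw [h3, Multiset.map_cons, Multiset.prod_cons, Derivation.leibniz, ih, h2]
      simp only [smul_eq_mul]
      linear_combination (s.map fun x => (1 - X * C x : ℂ⟦X⟧)).prod * h1
  have hne : B.det ≠ 0 := fun h => by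
    have := congrArg Matrix.det hBG
    rw [Matrix.det_mul, h, zero_mul, Matrix.det_one] at this
    exact zero_ne_one this
  have h5 := hD2 M.charpoly.roots
  rw [← hdet, hD1] at h5
  have h6 := neg_injective (mul_left_cancel₀ hne h5)
  have h7 := congrArg (coeff (k - 1)) h6
  rw [coeff_mk, coeff_mk, Nat.sub_add_cancel hk] at h7
  exact h7

end TracePow

/-! ### Power sums at the eigenvalue angles. -/

/-- Evaluation of Laurent polynomials at `z_j = exp (i θ_j)`. -/
def evAngle {n : ℕ} (θ : Fin n → ℝ) : Laurent n →ₐ[ℝ] ℂ :=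
  AddMonoidAlgebra.lift ℝ ℂ (Fin n → ℤ)
    { toFun := fun m => Complex.exp (∑ j, (m.toAdd j : ℂ) * θ j * Complex.I)
      map_one' := by simp
      map_mul' := fun a b => by
        rw [← Complex.exp_add, ← Finset.sum_add_distrib]
        congr 1
        refine Finset.sum_congr rfl fun j _ => ?_
        simp only [toAdd_mul, Pi.add_apply, Int.cast_add]
        ring }

theorem evAngle_z {n : ℕ} (θ : Fin n → ℝ) (j : Fin n) (k : ℤ) :
    evAngle θ (Laurent.z j k) = Complex.exp (k * θ j * Complex.I) := by
  rw [evAngle, Laurent.z, AddMonoidAlgebra.lift_single, one_smul]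
  simp only [MonoidHom.coe_mk, OneHom.coe_mk, toAdd_ofAdd]
  congr 1
  rw [Finset.sum_eq_single j]
  · simp
  · intro i _ hi
    simp [Pi.single_eq_of_ne hi]
  · simp

theorem evAngle_c {n : ℕ} (θ : Fin n → ℝ) (j : Fin n) (k : ℤ) :
    evAngle θ (Laurent.c j k) = 2 * Real.cos (k * θ j) := by
  rw [Laurent.c, map_add, evAngle_z, evAngle_z, Complex.ofReal_cos, Complex.two_cos]
  push_cast
  congr 2
  ring

theorem evAngle_p {n : ℕ} (M : SO (2 * n)) (k : ℕ) :
    evAngle (eigenangle M) (Laurent.p n k) = ((M.1 ^ k).trace : ℝ) := by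
  have h1 : (((M.1 ^ k).trace : ℝ) : ℂ) = ((M.1.map Complex.ofReal) ^ k).trace := by
    have h := Matrix.map_pow (f := Complex.ofRealHom) M.1 k
    have h' : (M.1.map Complex.ofReal) ^ k = (M.1 ^ k).map Complex.ofRealHom := h.symm
    rw [h']
    simp [Matrix.trace]
  rw [h1, trace_pow_eq_sum_roots, (isEigenangles_eigenangle M).2, Laurent.p, map_sum]
  have h2 : ∀ s : Multiset ℂ, (s.map fun x => x ^ k).sum =
      (Multiset.sumAddMonoidHom.comp (Multiset.mapAddMonoidHom fun x : ℂ => x ^ k)) s := fun _ => rfl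
  rw [h2, map_sum]
  refine Finset.sum_congr rfl fun j _ => ?_
  rw [← h2]
  simp only [Laurent.c, map_add, evAngle_z, Multiset.insert_eq_cons, Multiset.map_cons,
    Multiset.sum_cons, Multiset.map_singleton, Multiset.sum_singleton, ← Complex.exp_nat_mul]
  congr 2 <;> push_cast <;> ring

end SOCumulants

end

noncomputable section

namespace SOCumulants

/-! ### Weights of abstract power sums -/

/-- The weight `∑ i, i * s i` of the monomial with exponents `s`. -/
def wt (s : ℕ →₀ ℕ) : ℕ := s.sum fun i e => e * i

theorem wt_add (s t : ℕ →₀ ℕ) : wt (s + t) = wt s + wt t :=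
  Finsupp.sum_add_index' (fun _ => zero_mul _) fun _ _ _ => add_mul _ _ _

theorem wt_single (i e : ℕ) : wt (Finsupp.single i e) = e * i := by simp [wt]

/-- Polynomials all of whose monomials have weight at most `d`. -/
def WtLE (d : ℕ) : Submodule ℝ (MvPolynomial ℕ ℝ) where
  carrier := {P | ∀ s ∈ P.support, wt s ≤ d}
  add_mem' {P Q} hP hQ s hs := by
    classical
    rcases Finset.mem_union.1 (MvPolynomial.support_add hs) with h | h
    · exact hP s h
    · exact hQ s h
  zero_mem' s hs := by simp at hs
  smul_mem' c P hP s hs := hP s (MvPolynomial.support_smul hs)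

theorem WtLE.mono {d e : ℕ} (h : d ≤ e) {P : MvPolynomial ℕ ℝ} (hP : P ∈ WtLE d) : P ∈ WtLE e :=
  fun s hs => (hP s hs).trans h

theorem WtLE.monomial {d : ℕ} {s : ℕ →₀ ℕ} (h : wt s ≤ d) (a : ℝ) :
    MvPolynomial.monomial s a ∈ WtLE d := by
  classical
  intro t ht
  rw [MvPolynomial.support_monomial] at ht
  split_ifs at ht
  · simp at ht
  · rw [Finset.mem_singleton.1 ht]; exact h

theorem WtLE.X (i : ℕ) : (MvPolynomial.X i : MvPolynomial ℕ ℝ) ∈ WtLE i :=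
  WtLE.monomial (by simp [wt_single]) 1

theorem WtLE.mul {d e : ℕ} {P Q : MvPolynomial ℕ ℝ} (hP : P ∈ WtLE d) (hQ : Q ∈ WtLE e) :
    P * Q ∈ WtLE (d + e) := by
  classical
  intro s hs
  obtain ⟨a, ha, b, hb, rfl⟩ := Finset.mem_add.1 (MvPolynomial.support_mul P Q hs)
  rw [wt_add]
  exact add_le_add (hP a ha) (hQ b hb)

theorem WtLE.exists_mem (P : MvPolynomial ℕ ℝ) : ∃ d, P ∈ WtLE d :=
  ⟨P.support.sup wt, fun _ hs => Finset.le_sup (f := wt) hs⟩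

theorem wt_sub_single {s : ℕ →₀ ℕ} {i : ℕ} (h : s i ≠ 0) :
    wt (s - Finsupp.single i 1) + i = wt s := by
  have h1 : s = (s - Finsupp.single i 1) + Finsupp.single i 1 := by
    ext j
    rcases eq_or_ne i j with rfl | hj
    · simp; omega
    · simp [Finsupp.single_eq_of_ne' hj]
  conv_rhs => rw [h1, wt_add, wt_single, one_mul]

theorem WtLE.loopDer {d : ℕ} (k : ℕ) {P : MvPolynomial ℕ ℝ} (hP : P ∈ WtLE d) :
    loopDer k P ∈ WtLE (d + k) := by
  rw [← P.support_sum_monomial_coeff, map_sum]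
  refine Submodule.sum_mem _ fun s hs => ?_
  rw [SOCumulants.loopDer, MvPolynomial.mkDerivation_monomial]
  refine Submodule.smul_mem _ _ (Submodule.sum_mem _ fun i hi => ?_)
  simp only [smul_eq_mul]
  have h0 := wt_sub_single (Finsupp.mem_support_iff.1 hi)
  have h1 := hP s hs
  refine WtLE.mono (show wt (s - Finsupp.single i 1) + (k + i) ≤ d + k by omega) ?_
  refine WtLE.mul (WtLE.monomial le_rfl _) (Submodule.smul_mem _ _ (Submodule.sub_mem _ ?_ ?_))
  · exact WtLE.X _
  · exact WtLE.mono (by omega) (WtLE.X _)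

theorem WtLE.loopQuad (k : ℕ) : loopQuad k ∈ WtLE k := by
  refine Submodule.sum_mem _ fun m hm => Submodule.sub_mem _ ?_ ?_
  · have := Finset.mem_range.1 hm
    exact WtLE.mono (by omega) (WtLE.mul (WtLE.X (m + 1)) (WtLE.X (k - (m + 1))))
  · have := Finset.mem_range.1 hm
    exact WtLE.mono (by omega) (WtLE.X _)

theorem WtLE.loopOp {d : ℕ} (k : ℕ) {P : MvPolynomial ℕ ℝ} (hP : P ∈ WtLE d) :
    loopOp k P ∈ WtLE (d + k) := by
  refine Submodule.add_mem _ ?_ (WtLE.loopDer k hP)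
  rw [add_comm d k]
  exact WtLE.mul (WtLE.loopQuad k) hP

theorem loopOp_add (k : ℕ) (P Q : MvPolynomial ℕ ℝ) :
    loopOp k (P + Q) = loopOp k P + loopOp k Q := by
  simp only [loopOp, map_add, mul_add]
  ring

theorem loopOp_zero (k : ℕ) : loopOp k 0 = 0 := by simp [loopOp]

theorem loopOp_sum {ι : Type*} (k : ℕ) (t : Finset ι) (P : ι → MvPolynomial ℕ ℝ) :
    loopOp k (∑ i ∈ t, P i) = ∑ i ∈ t, loopOp k (P i) := by
  classical
  induction t using Finset.induction_on with
  | empty => simp [loopOp_zero]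
  | insert a t ha ih => rw [Finset.sum_insert ha, Finset.sum_insert ha, loopOp_add, ih]

/-- Differentiation in `X_k` lowers the weight by `k` and `loopOp k` raises it by at most `k`. This
is why the Laplacian acts on finite dimensional spaces. -/
theorem WtLE.loopOp_pderiv {d : ℕ} (k : ℕ) {P : MvPolynomial ℕ ℝ} (hP : P ∈ WtLE d) :
    SOCumulants.loopOp k (MvPolynomial.pderiv k P) ∈ WtLE d := by
  rw [← P.support_sum_monomial_coeff, map_sum, loopOp_sum]
  refine Submodule.sum_mem _ fun s hs => ?_
  rw [MvPolynomial.pderiv_monomial]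
  by_cases h : s k = 0
  · simp [h, loopOp_zero]
  · have h0 := wt_sub_single h
    have h1 := hP s hs
    exact WtLE.mono (by omega) (WtLE.loopOp k (WtLE.monomial le_rfl _))

namespace Laurent

variable {n : ℕ}

/-! ### Inversion symmetry and positivity -/

/-- The substitution `z ↦ z⁻¹`. -/
def inv (n : ℕ) : Laurent n →ₐ[ℝ] Laurent n :=
  AddMonoidAlgebra.mapDomainAlgHom ℝ ℝ (negAddMonoidHom (α := Fin n → ℤ))

theorem inv_single (m : Fin n → ℤ) (a : ℝ) :
    inv n (AddMonoidAlgebra.single m a) = AddMonoidAlgebra.single (-m) a := by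
  simp [inv]

theorem inv_z (j : Fin n) (k : ℤ) : inv n (z j k) = z j (-k) := by
  rw [z, inv_single, z, Pi.single_neg]

theorem inv_c (j : Fin n) (k : ℤ) : inv n (c j k) = c j k := by
  rw [c, map_add, inv_z, inv_z, neg_neg, add_comm]

theorem inv_p (k : ℤ) : inv n (p n k) = p n k := by simp [p, inv_c]

theorem inv_evP (P : MvPolynomial ℕ ℝ) : inv n (evP n P) = evP n P := by
  have h : (inv n).comp (evP n) = evP n := by
    ext i
    simp [inv_p]
  exact DFunLike.congr_fun h P

theorem inv_vand : inv n (vand n) = vand n := by simp [vand, map_prod, inv_c]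

theorem inv_euler (j : Fin n) (F : Laurent n) : inv n (euler j F) = -euler j (inv n F) := by
  induction F using AddMonoidAlgebra.induction_linear with
  | zero => simp
  | add f g hf hg => simp only [map_add, hf, hg, neg_add]
  | single m a =>
    change inv n (eulerLin j _) = -eulerLin j _
    rw [eulerLin_single, inv_single, inv_single, eulerLin_single]
    simp

/-- Parseval's identity: for real coefficients, inversion plays the role of complex conjugation on
the torus. -/
theorem ct_mul_inv (F : Laurent n) : ct (F * inv n F) = F.coeff.sum fun _ a => a ^ 2 := by
  classical
  have h : ∀ G : Laurent n, ct (G * inv n F) = G.coeff.sum fun m a => a * F.coeff m := by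
    intro G
    induction G using AddMonoidAlgebra.induction_linear with
    | zero => simp
    | add f g hf hg =>
      rw [add_mul, map_add, hf, hg, AddMonoidAlgebra.coeff_add,
        Finsupp.sum_add_index' (by simp) (fun _ _ _ => add_mul _ _ _)]
    | single m a =>
      rw [AddMonoidAlgebra.coeff_single, Finsupp.sum_single_index (by simp)]
      induction F using AddMonoidAlgebra.induction_linear with
      | zero => simp
      | add f g hf hg => simp only [map_add, mul_add, hf, hg, AddMonoidAlgebra.coeff_add,
          Finsupp.add_apply]
      | single m' b =>
        rw [inv_single, AddMonoidAlgebra.single_mul_single, ct_apply,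
          AddMonoidAlgebra.coeff_single, AddMonoidAlgebra.coeff_single, Finsupp.single_apply,
          Finsupp.single_apply]
        by_cases hm : m' = m
        · simp [hm]
        · rw [if_neg, if_neg hm, mul_zero]
          intro h0
          exact hm (by rw [← sub_eq_add_neg, sub_eq_zero] at h0; exact h0.symm)
  rw [h F]
  exact Finsupp.sum_congr fun _ _ => (sq _).symm

theorem ct_mul_inv_nonneg (F : Laurent n) : 0 ≤ ct (F * inv n F) := by
  rw [ct_mul_inv]
  exact Finset.sum_nonneg fun _ _ => sq_nonneg _

theorem eq_zero_of_ct_mul_inv {F : Laurent n} (h : ct (F * inv n F) = 0) : F = 0 := by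
  rw [ct_mul_inv, Finsupp.sum, Finset.sum_eq_zero_iff_of_nonneg fun _ _ => sq_nonneg _] at h
  apply AddMonoidAlgebra.ext
  ext m
  by_contra hm
  exact hm (by simpa using h m (Finsupp.mem_support_iff.2 hm))

theorem vand_ne_zero : vand n ≠ 0 := by
  refine Finset.prod_ne_zero_iff.2 fun i _ => Finset.prod_ne_zero_iff.2 fun j hj h => ?_
  have hij : i < j := Finset.mem_Ioi.1 hj
  have h1 := congrArg (fun F : Laurent n => F.coeff (Pi.single j 1)) h
  have e1 : (Pi.single j (-1) : Fin n → ℤ) ≠ Pi.single j 1 := fun h => by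
    have := congrFun h j
    simp at this
  have e2 : ∀ k : ℤ, (Pi.single i k : Fin n → ℤ) ≠ Pi.single j 1 := fun k h => by
    have := congrFun h j
    simp [Pi.single_eq_of_ne hij.ne'] at this
  -- The monomial `z_j` occurs in the factor with coefficient one.
  simp [c, z, Finsupp.single_apply, e1, e2] at h1

theorem ct_vand_sq_pos : 0 < ct (vand n ^ 2) := by
  have h : vand n ^ 2 = vand n * inv n (vand n) := by rw [inv_vand, sq]
  rw [h]
  exact lt_of_le_of_ne (ct_mul_inv_nonneg _) fun h0 => vand_ne_zero (eq_zero_of_ct_mul_inv h0.symm)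

/-! ### The radial Laplacian -/

/-- The second order operator `q ↦ ∑ j, ∂_j (Δ² ∂_j q)`. -/
def lapl (n : ℕ) : Laurent n →ₗ[ℝ] Laurent n :=
  ∑ j, eulerLin j ∘ₗ LinearMap.mulLeft ℝ (vand n ^ 2) ∘ₗ eulerLin j

theorem lapl_apply (q : Laurent n) : lapl n q = ∑ j, euler j (vand n ^ 2 * euler j q) := by
  rw [lapl, LinearMap.sum_apply]
  rfl

theorem ct_lapl (q : Laurent n) : ct (lapl n q) = 0 := by
  rw [lapl_apply, map_sum]
  exact Finset.sum_eq_zero fun j _ => ct_euler j _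

/-- Integration by parts: the constant coefficient of `q · lapl q` is the sum over `j` of the
squared norms of `Δ ∂_j q`. The sign comes from `inv` anticommuting with `euler`. -/
theorem euler_eq_zero_of_lapl {q : Laurent n} (hq : inv n q = q) (h : lapl n q = 0) (j : Fin n) :
    euler j q = 0 := by
  have h1 : ∀ j, ct (q * euler j (vand n ^ 2 * euler j q)) =
      ct (vand n * euler j q * inv n (vand n * euler j q)) := by
    intro j
    have h2 := ct_euler j (q * (vand n ^ 2 * euler j q))
    rw [Derivation.leibniz, map_add ct, smul_eq_mul, smul_eq_mul] at h2
    rw [map_mul (inv n), inv_vand, inv_euler, hq]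
    have h3 : vand n * euler j q * (vand n * -euler j q) = -(vand n ^ 2 * euler j q * euler j q) := by
      ring
    rw [h3, map_neg]
    linarith
  have h2 : ∑ j, ct (vand n * euler j q * inv n (vand n * euler j q)) = 0 := by
    rw [← Finset.sum_congr rfl fun j _ => h1 j, ← map_sum, ← Finset.mul_sum, ← lapl_apply, h]
    simp
  rw [Finset.sum_eq_zero_iff_of_nonneg fun j _ => ct_mul_inv_nonneg _] at h2
  have h3 := eq_zero_of_ct_mul_inv (h2 j (Finset.mem_univ j))
  exact (mul_eq_zero.1 h3).resolve_left vand_ne_zero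

theorem eq_algebraMap_of_euler {q : Laurent n} (h : ∀ j, euler j q = 0) :
    q = algebraMap ℝ (Laurent n) (ct q) := by
  have h1 : ∀ m, m ≠ 0 → q.coeff m = 0 := by
    intro m hm
    obtain ⟨j, hj⟩ := Function.ne_iff.1 hm
    have := congrArg (fun F : Laurent n => F.coeff m) (h j)
    simp only [euler_coeff, AddMonoidAlgebra.coeff_zero, Finsupp.coe_zero, Pi.zero_apply,
      mul_eq_zero, Int.cast_eq_zero] at this
    exact this.resolve_left hj
  apply AddMonoidAlgebra.ext
  ext m
  rw [Algebra.algebraMap_eq_smul_one, AddMonoidAlgebra.coeff_smul, AddMonoidAlgebra.one_def,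
    AddMonoidAlgebra.coeff_single, Finsupp.smul_apply, Finsupp.single_apply]
  by_cases hm : m = 0
  · subst hm
    simp [ct_apply]
  · rw [h1 m hm, if_neg (Ne.symm hm), smul_zero]

/-! ### A finite dimensional space of symmetric Laurent polynomials -/

/-- The values of abstract power sum polynomials of weight at most `d`. -/
def powerSpan (n d : ℕ) : Submodule ℝ (Laurent n) := (WtLE d).map (evP n).toLinearMap

/-- Laurent polynomials with all exponents bounded by `d`. -/
def box (n d : ℕ) : Submodule ℝ (Laurent n) :=
  AddMonoidAlgebra.supported ℝ ℝ {m : Fin n → ℤ | ∀ j, |m j| ≤ d}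

theorem mem_box {d : ℕ} {F : Laurent n} :
    F ∈ box n d ↔ ∀ m ∈ F.coeff.support, ∀ j, |m j| ≤ (d : ℤ) := Iff.rfl

theorem box_mul {d e : ℕ} {F G : Laurent n} (hF : F ∈ box n d) (hG : G ∈ box n e) :
    F * G ∈ box n (d + e) := by
  classical
  rw [mem_box] at *
  intro m hm j
  obtain ⟨a, ha, b, hb, rfl⟩ := Finset.mem_add.1 (AddMonoidAlgebra.support_coeff_mul_subset F G hm)
  have := abs_add_le (a j) (b j)
  have h1 := hF a ha j
  have h2 := hG b hb j
  rw [Pi.add_apply]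
  push_cast
  linarith

theorem single_mem_box {d : ℕ} {m : Fin n → ℤ} (h : ∀ j, |m j| ≤ (d : ℤ)) (a : ℝ) :
    AddMonoidAlgebra.single m a ∈ box n d := by
  rw [mem_box]
  intro m' hm'
  rw [AddMonoidAlgebra.coeff_single] at hm'
  have := Finsupp.support_single_subset hm'
  rw [Finset.mem_singleton.1 this]
  exact h

theorem p_mem_box (k : ℕ) : p n k ∈ box n k := by
  have h : ∀ (j : Fin n) (a : ℤ), |a| = k → z j a ∈ box n k := by
    intro j a ha
    refine single_mem_box (fun i => ?_) 1
    rcases eq_or_ne i j with rfl | hi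
    · simp [ha]
    · simp [Pi.single_eq_of_ne hi]
  exact Submodule.sum_mem _ fun j _ => Submodule.add_mem _ (h j _ (by simp)) (h j _ (by simp))

/-- The weight bounds the modulus of every exponent; its use is the finite dimension of `powerSpan`.
-/
theorem powerSpan_le_box (d : ℕ) : powerSpan n d ≤ box n d := by
  have hmono : ∀ s : ℕ →₀ ℕ, evP n (MvPolynomial.monomial s 1) ∈ box n (wt s) := by
    intro s
    induction s using Finsupp.induction_linear with
    | zero =>
      have : evP n (MvPolynomial.monomial 0 1) = 1 := by
        rw [← MvPolynomial.C_apply, map_one, map_one]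
      rw [this, AddMonoidAlgebra.one_def]
      exact single_mem_box (by simp) 1
    | add s t hs ht =>
      rw [← one_mul (1 : ℝ), ← MvPolynomial.monomial_mul, map_mul, wt_add]
      exact box_mul hs ht
    | single i e =>
      induction e with
      | zero =>
        have : evP n (MvPolynomial.monomial (Finsupp.single i 0) 1) = 1 := by
          rw [Finsupp.single_zero, ← MvPolynomial.C_apply, map_one, map_one]
        rw [this, AddMonoidAlgebra.one_def]
        exact single_mem_box (by simp) 1
      | succ e ih =>
        rw [Finsupp.single_add, ← one_mul (1 : ℝ), ← MvPolynomial.monomial_mul, map_mul, wt_add]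
        refine box_mul ih ?_
        rw [wt_single, one_mul]
        change evP n (MvPolynomial.X i) ∈ _
        rw [evP_X]
        exact p_mem_box i
  rintro _ ⟨P, hP, rfl⟩
  rw [AlgHom.toLinearMap_apply, ← P.support_sum_monomial_coeff, map_sum]
  refine Submodule.sum_mem _ fun s hs => ?_
  rw [← mul_one (P.coeff s), ← smul_eq_mul, ← MvPolynomial.smul_monomial, map_smul]
  refine Submodule.smul_mem _ _ (mem_box.2 fun m hm j => ?_)
  exact (mem_box.1 (hmono s) m hm j).trans (by exact_mod_cast hP s hs)

instance (d : ℕ) : FiniteDimensional ℝ (powerSpan n d) := by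
  have hfin : Set.Finite {m : Fin n → ℤ | ∀ j, |m j| ≤ (d : ℤ)} := by
    refine (Set.Finite.pi' fun _ : Fin n => Set.finite_Icc (-(d : ℤ)) d).subset fun m hm j => ?_
    exact abs_le.1 (hm j)
  have : FiniteDimensional ℝ (box n d) := by
    have h : box n d = Submodule.span ℝ
        ((fun m => AddMonoidAlgebra.single m (1 : ℝ)) '' {m : Fin n → ℤ | ∀ j, |m j| ≤ (d : ℤ)}) := by
      apply le_antisymm
      · intro F hF
        rw [← AddMonoidAlgebra.sum_coeff_single F]
        refine Submodule.sum_mem _ fun m hm => ?_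
        rw [← mul_one (F.coeff m), ← smul_eq_mul, ← AddMonoidAlgebra.smul_single]
        exact Submodule.smul_mem _ _ (Submodule.subset_span ⟨m, mem_box.1 hF m hm, rfl⟩)
      · rw [Submodule.span_le]
        rintro _ ⟨m, hm, rfl⟩
        exact single_mem_box hm 1
    rw [h]
    exact FiniteDimensional.span_of_finite ℝ (hfin.image _)
  exact Submodule.finiteDimensional_of_le (powerSpan_le_box d)

end Laurent

/-! ### Weyl integration from the loop equations. -/

open Laurent

/-- The expectation of a Laurent polynomial in the eigenvalues. -/
def haarExp {n : ℕ} (q : Laurent n) : ℝ :=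
  ∫ M : SO (2 * n), (evAngle (eigenangle M) q).re ∂haarSO (2 * n)

theorem evAngle_evP {n : ℕ} (M : SO (2 * n)) (P : MvPolynomial ℕ ℝ) :
    evAngle (eigenangle M) (evP n P) = (evTr M.1 P : ℂ) := by
  have h : (evAngle (eigenangle M)).comp (evP n) =
      (Complex.ofRealAm).comp (evTr M.1) := by
    ext i
    · simp [evTr, evAngle_p]
  exact DFunLike.congr_fun h P

theorem haarExp_evP {n : ℕ} (P : MvPolynomial ℕ ℝ) :
    haarExp (evP n P) = ∫ M : SO (2 * n), evTr M.1 P ∂haarSO (2 * n) := by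
  simp [haarExp, evAngle_evP]

theorem continuous_evTr {N : ℕ} (P : MvPolynomial ℕ ℝ) : Continuous fun M : SO N => evTr M.1 P := by
  induction P using MvPolynomial.induction_on with
  | C a => simpa [evTr] using continuous_const
  | add P Q hP hQ =>
    simp only [map_add]
    exact hP.add hQ
  | mul_X P m hP =>
    have h : Continuous fun M : SO N => (M.1 ^ m).trace :=
      (continuous_subtype_val.pow m).matrix_trace
    simp only [map_mul]
    refine hP.mul ?_
    simpa [evTr] using h

theorem integrable_evTr {N : ℕ} (P : MvPolynomial ℕ ℝ) :
    Integrable (fun M : SO N => evTr M.1 P) (haarSO N) :=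
  continuous_integrable_haarSO (continuous_evTr P)

/-- By the chain rule the Laplacian of `P` is `Δ²` times `∑ m · loopOp m (∂P / ∂X_m)`, a combination
of expressions of Haar mean zero. -/
theorem exists_lapl_eq {n d : ℕ} {q : Laurent n} (hq : q ∈ powerSpan n d) :
    ∃ r ∈ powerSpan n d, lapl n q = vand n ^ 2 * r ∧ haarExp r = 0 := by
  obtain ⟨P, hP, rfl⟩ := hq
  rw [AlgHom.toLinearMap_apply]
  choose N₀ hN₀ using fun j : Fin n => euler_evP j P
  set N := Finset.univ.sup N₀
  set Q : MvPolynomial ℕ ℝ :=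
    ∑ m ∈ Finset.range N, (m : ℝ) • loopOp m (MvPolynomial.pderiv m P) with hQ
  refine ⟨evP n Q, ⟨Q, Submodule.sum_mem _ fun m _ => Submodule.smul_mem _ _
    (WtLE.loopOp_pderiv m hP), rfl⟩, ?_, ?_⟩
  · rw [lapl_apply]
    have h : ∀ j, euler j (vand n ^ 2 * euler j (evP n P)) = ∑ m ∈ Finset.range N, (m : ℝ) •
        euler j (vand n ^ 2 * (s j m * evP n (MvPolynomial.pderiv m P))) := by
      intro j
      rw [hN₀ j N (Finset.le_sup (Finset.mem_univ j)), Finset.mul_sum, map_sum]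
      refine Finset.sum_congr rfl fun m _ => ?_
      rw [mul_smul_comm, Derivation.map_smul]
    rw [Finset.sum_congr rfl fun j _ => h j, Finset.sum_comm, hQ, map_sum, Finset.mul_sum]
    refine Finset.sum_congr rfl fun m _ => ?_
    rw [← Finset.smul_sum, sum_euler_loop, map_smul, mul_smul_comm]
  · rw [haarExp_evP, hQ]
    simp only [map_sum, map_smul, smul_eq_mul]
    rw [integral_finsetSum _ fun m _ => (integrable_evTr _).const_mul _]
    refine Finset.sum_eq_zero fun m _ => ?_
    rw [integral_const_mul, integral_loopOp, mul_zero]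

/-- Weyl integration for power sums: the Haar expectation of a polynomial in the traces
of powers is the normalized constant coefficient against the squared Vandermonde factor. -/
theorem integral_evTr {n : ℕ} (P : MvPolynomial ℕ ℝ) :
    (∫ M : SO (2 * n), evTr M.1 P ∂haarSO (2 * n)) * ct (vand n ^ 2) = ct (vand n ^ 2 * evP n P) := by
  obtain ⟨d, hd⟩ := WtLE.exists_mem P
  set φ : Laurent n →ₗ[ℝ] ℝ := ct ∘ₗ LinearMap.mulLeft ℝ (vand n ^ 2) with hφ
  have hφ' : ∀ q, φ q = ct (vand n ^ 2 * q) := fun q => rfl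
  -- `V` consists of the elements of mean zero for `Δ²`; the Laplacian divided by `Δ²` maps it to
  -- itself.
  set V : Submodule ℝ (Laurent n) := powerSpan n d ⊓ LinearMap.ker φ with hV
  have : FiniteDimensional ℝ V := Submodule.finiteDimensional_of_le inf_le_left
  have hex : ∀ q : V, ∃ r : V, lapl n q = vand n ^ 2 * r ∧ haarExp (r : Laurent n) = 0 := by
    intro q
    obtain ⟨r, hr, h1, h2⟩ := exists_lapl_eq q.2.1
    refine ⟨⟨r, hr, ?_⟩, h1, h2⟩
    change φ r = 0
    rw [hφ', ← h1, ct_lapl]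
  choose D hD hD0 using hex
  have hne : vand n ^ 2 ≠ 0 := pow_ne_zero 2 vand_ne_zero
  let L : V →ₗ[ℝ] V :=
    { toFun := D
      map_add' := fun a b => Subtype.ext (mul_left_cancel₀ hne (by
        rw [← hD, Submodule.coe_add, Submodule.coe_add, map_add, hD, hD, mul_add]))
      map_smul' := fun a b => Subtype.ext (mul_left_cancel₀ hne (by
        rw [← hD, Submodule.coe_smul, RingHom.id_apply, Submodule.coe_smul, map_smul, hD,
          mul_smul_comm])) }
  have hinj : Function.Injective L := by
    rw [← LinearMap.ker_eq_bot, LinearMap.ker_eq_bot']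
    intro q hq
    have h1 : lapl n q = 0 := by
      rw [hD, show D q = 0 from hq]
      simp
    obtain ⟨Q, -, hQ⟩ := q.2.1
    have h2 : inv n (q : Laurent n) = q := by
      rw [← hQ]
      exact inv_evP Q
    have h3 := eq_algebraMap_of_euler (euler_eq_zero_of_lapl h2 h1)
    have h4 : φ (q : Laurent n) = 0 := q.2.2
    rw [h3, hφ', Algebra.algebraMap_eq_smul_one, mul_smul_comm, mul_one, map_smul, smul_eq_mul] at h4
    have h5 := (mul_eq_zero.1 h4).resolve_right ct_vand_sq_pos.ne'
    apply Subtype.ext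
    rw [h3, h5, map_zero]
    rfl
  -- In finite dimension every element of `V` is thus in the image, where the Haar mean vanishes.
  -- This is applied to `P` minus its mean `a`.
  have hsurj := LinearMap.injective_iff_surjective.1 hinj
  set a : ℝ := φ (evP n P) / ct (vand n ^ 2) with ha
  have hmem : evP n (P - MvPolynomial.C a) ∈ V := by
    constructor
    · refine ⟨_, Submodule.sub_mem _ hd ?_, rfl⟩
      rw [MvPolynomial.C_apply]
      exact WtLE.monomial (by simp [wt]) a
    · change φ _ = 0
      rw [map_sub, map_sub, ← MvPolynomial.algebraMap_eq, AlgHom.commutes,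
        hφ' (algebraMap _ _ _), Algebra.algebraMap_eq_smul_one, mul_smul_comm, mul_one, map_smul,
        smul_eq_mul, ha, div_mul_cancel₀ _ ct_vand_sq_pos.ne', sub_self]
  obtain ⟨u, hu⟩ := hsurj ⟨_, hmem⟩
  have h6 := hD0 u
  rw [show D u = ⟨_, hmem⟩ from hu, haarExp_evP] at h6
  simp only [map_sub] at h6
  rw [integral_sub (integrable_evTr _) (integrable_evTr _)] at h6
  have h7 : ∀ M : SO (2 * n), evTr M.1 (MvPolynomial.C a) = a := fun M => by simp [evTr]
  simp only [h7, integral_const, probReal_univ, one_smul] at h6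
  rw [sub_eq_zero.1 h6, ha, div_mul_cancel₀ _ ct_vand_sq_pos.ne', hφ']

end SOCumulants

end

noncomputable section

namespace SOCumulants

/-! ### Andréief's identity -/

/-- Both determinants are expanded over permutations `σ, τ`, and `Φ` factors over the separate
variables. After reindexing `τ` by `σ`, each of the `n!` values of `σ` contributes the same
determinant. -/
theorem andreief {L B A : Type*} [CommRing L] [CommRing B] [CommRing A] {n : ℕ}
    (ι : Fin n → L →+* B) (φ : L → A) (Φ : B →+ A)
    (hΦ : ∀ h : Fin n → L, Φ (∏ j, ι j (h j)) = ∏ j, φ (h j)) (e : Fin n → L) (g : L) :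
    Φ ((Matrix.of fun i j => ι i (e j)).det ^ 2 * ∏ j, ι j g) =
      (n.factorial : A) * (Matrix.of fun a b => φ (e a * e b * g)).det := by
  have h1 : (Matrix.of fun i j => ι i (e j)).det =
      ∑ σ : Equiv.Perm (Fin n), Equiv.Perm.sign σ • ∏ i, ι i (e (σ i)) := by
    rw [← Matrix.det_transpose, Matrix.det_apply]
    rfl
  have h2 : (Matrix.of fun i j => ι i (e j)).det ^ 2 * ∏ j, ι j g =
      ∑ σ : Equiv.Perm (Fin n), ∑ τ : Equiv.Perm (Fin n),
        (Equiv.Perm.sign σ * Equiv.Perm.sign τ) • ∏ i, ι i (e (σ i) * e (τ i) * g) := by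
    rw [h1, sq, Finset.sum_mul_sum, Finset.sum_mul]
    refine Finset.sum_congr rfl fun σ _ => ?_
    rw [Finset.sum_mul]
    refine Finset.sum_congr rfl fun τ _ => ?_
    rw [smul_mul_smul_comm, smul_mul_assoc, ← Finset.prod_mul_distrib, ← Finset.prod_mul_distrib]
    congr 1
    refine Finset.prod_congr rfl fun i _ => ?_
    rw [map_mul, map_mul]
  have hu : ∀ (u : ℤˣ) (b : B), Φ (u • b) = u • Φ b := fun u b => by
    rw [Units.smul_def, map_zsmul, Units.smul_def]
  rw [h2, map_sum]
  have h3 : ∀ σ : Equiv.Perm (Fin n), Φ (∑ τ : Equiv.Perm (Fin n),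
      (Equiv.Perm.sign σ * Equiv.Perm.sign τ) • ∏ i, ι i (e (σ i) * e (τ i) * g)) =
      (Matrix.of fun a b => φ (e a * e b * g)).det := by
    intro σ
    rw [map_sum, ← Matrix.det_transpose, Matrix.det_apply,
      ← Equiv.sum_comp (Equiv.mulRight σ) fun τ : Equiv.Perm (Fin n) =>
        Φ ((Equiv.Perm.sign σ * Equiv.Perm.sign τ) • ∏ i, ι i (e (σ i) * e (τ i) * g))]
    refine Finset.sum_congr rfl fun τ _ => ?_
    rw [hu, hΦ, Equiv.coe_mulRight, Equiv.Perm.sign_mul, mul_comm (Equiv.Perm.sign τ),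
      ← mul_assoc, Int.units_mul_self, one_mul]
    congr 1
    rw [← Equiv.prod_comp σ fun i => (Matrix.of fun a b => φ (e a * e b * g)).transpose (τ i) i]
    rfl
  rw [Finset.sum_congr rfl fun σ _ => h3 σ, Finset.sum_const, Finset.card_univ,
    Fintype.card_perm, Fintype.card_fin, nsmul_eq_mul]

/-! ### Chebyshev polynomials and the Vandermonde factor -/

section Cheb

variable (R : Type*) [CommRing R]

open Polynomial in
/-- The monic polynomials expressing `z ^ k + z ^ (-k)` through `z + z⁻¹`. -/
def chebC : ℕ → R[X]
  | 0 => 2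
  | 1 => X
  | k + 2 => X * chebC (k + 1) - chebC k

/-- Monicity is claimed from index `1` on, since `chebC 0 = 2`; for this reason `basisFun 0` is `1`
and not `2`. -/
theorem chebC_monic [Nontrivial R] (k : ℕ) :
    (chebC R k).natDegree ≤ k ∧ (chebC R (k + 1)).natDegree = k + 1 ∧ (chebC R (k + 1)).Monic := by
  induction k with
  | zero =>
    refine ⟨?_, by simp [chebC], Polynomial.monic_X⟩
    rw [chebC, ← Polynomial.C_ofNat, Polynomial.natDegree_C]
  | succ k ih =>
    obtain ⟨h1, h2, h3⟩ := ih
    have h4 : (Polynomial.X * chebC R (k + 1)).Monic := Polynomial.monic_X.mul h3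
    have h5 : (Polynomial.X * chebC R (k + 1)).natDegree = k + 2 := by
      rw [Polynomial.monic_X.natDegree_mul h3, h2, Polynomial.natDegree_X]; ring
    have h6 : (chebC R k).degree < (Polynomial.X * chebC R (k + 1)).degree := by
      refine Polynomial.degree_lt_degree ?_
      omega
    refine ⟨h2.le, ?_, ?_⟩
    · rw [chebC, Polynomial.natDegree_sub_eq_left_of_natDegree_lt (by omega), h5]
    · rw [chebC]
      exact h4.sub_of_left h6

end Cheb

namespace Laurent

variable {n : ℕ}

theorem chebC_eval (j : Fin n) (k : ℕ) :
    (chebC (Laurent n) k).eval (c j 1) = c j k ∧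
      (chebC (Laurent n) (k + 1)).eval (c j 1) = c j (k + 1) := by
  induction k with
  | zero =>
    constructor
    · simp [chebC, c_zero]
    · simp [chebC]
  | succ k ih =>
    refine ⟨by rw [ih.2]; push_cast; rfl, ?_⟩
    rw [chebC, Polynomial.eval_sub, Polynomial.eval_mul, Polynomial.eval_X, ih.1, ih.2, c_mul_c]
    rw [show (1 : ℤ) - (k + 1) = -k by ring, c_neg]
    push_cast
    rw [show (1 : ℤ) + (k + 1) = k + 1 + 1 by ring]
    ring

/-! ### Separation of variables and the moment determinant. -/

/-- One variable Laurent polynomials. -/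
abbrev _root_.SOCumulants.Laurent₁ : Type := AddMonoidAlgebra ℝ ℤ

/-- `F(z) ↦ F(z_j)`. -/
def ofVar (j : Fin n) : Laurent₁ →ₐ[ℝ] Laurent n :=
  AddMonoidAlgebra.mapDomainAlgHom ℝ ℝ (AddMonoidHom.single (fun _ : Fin n => ℤ) j)

theorem ofVar_single (j : Fin n) (k : ℤ) (a : ℝ) :
    ofVar j (AddMonoidAlgebra.single k a) = AddMonoidAlgebra.single (Pi.single j k) a := by
  exact AddMonoidAlgebra.mapDomain_single

/-- The constant coefficient in one variable. -/
def ct₁ (F : Laurent₁) : ℝ := F.coeff 0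

/-- Fubini's theorem for constant coefficients. -/
theorem ct_prod_ofVar (h : Fin n → Laurent₁) : ct (∏ j, ofVar j (h j)) = ∏ j, ct₁ (h j) := by
  classical
  have h1 : ∀ j, ofVar j (h j) = ∑ k ∈ (h j).coeff.support,
      AddMonoidAlgebra.single (Pi.single j k) ((h j).coeff k) := by
    intro j
    conv_lhs => rw [← AddMonoidAlgebra.sum_coeff_single (h j), Finsupp.sum, map_sum]
    exact Finset.sum_congr rfl fun k _ => ofVar_single j k _
  have h2 : ∀ κ : Fin n → ℤ, ∏ j, (AddMonoidAlgebra.single (Pi.single j (κ j))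
      ((h j).coeff (κ j)) : Laurent n) = AddMonoidAlgebra.single κ (∏ j, (h j).coeff (κ j)) := by
    intro κ
    have h3 : ∀ t : Finset (Fin n), ∏ j ∈ t, (AddMonoidAlgebra.single (Pi.single j (κ j))
        ((h j).coeff (κ j)) : Laurent n) =
        AddMonoidAlgebra.single (∑ j ∈ t, Pi.single j (κ j)) (∏ j ∈ t, (h j).coeff (κ j)) := by
      intro t
      induction t using Finset.induction_on with
      | empty => simp [AddMonoidAlgebra.one_def]
      | insert a t ha ih =>
        rw [Finset.prod_insert ha, Finset.prod_insert ha, Finset.sum_insert ha, ih,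
          AddMonoidAlgebra.single_mul_single]
    rw [h3, Finset.univ_sum_single]
  simp only [h1]
  rw [Finset.prod_univ_sum, map_sum, Finset.sum_congr rfl fun κ _ => by rw [h2]]
  simp only [ct_apply, AddMonoidAlgebra.coeff_single, Finsupp.single_apply]
  rw [Finset.sum_ite_eq']
  split_ifs with h0
  · rfl
  · rw [Fintype.mem_piFinset] at h0
    push Not at h0
    obtain ⟨j, hj⟩ := h0
    exact (Finset.prod_eq_zero (Finset.mem_univ j) (by simpa [ct₁] using hj)).symm

/-- The factors of the Vandermonde determinant as one variable Laurent polynomials. -/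
def basisFun (b : ℕ) : Laurent₁ :=
  if b = 0 then 1 else AddMonoidAlgebra.single (b : ℤ) 1 + AddMonoidAlgebra.single (-b : ℤ) 1

/-- Monic polynomials of degrees `0, …, n - 1` in `c_i(1)` have the same determinant as the powers.
-/
theorem vand_eq_det : vand n = (Matrix.of fun i j : Fin n => ofVar i (basisFun j)).det := by
  set P : Fin n → Polynomial (Laurent n) :=
    fun b => if (b : ℕ) = 0 then 1 else chebC (Laurent n) b with hP
  have h1 : ∀ b : Fin n, (P b).natDegree = b ∧ (P b).Monic := by
    intro b
    simp only [hP]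
    split_ifs with hb
    · simp [hb, Polynomial.monic_one]
    · obtain ⟨k, hk⟩ := Nat.exists_eq_succ_of_ne_zero hb
      rw [hk]
      exact (chebC_monic (Laurent n) k).2
  have h2 := Matrix.det_eval_matrixOfPolynomials_eq_det_vandermonde (fun i : Fin n => c i 1) P
    (fun b => (h1 b).1) fun b => (h1 b).2
  rw [Matrix.det_vandermonde] at h2
  rw [vand, h2]
  congr 2
  ext i b : 2
  simp only [hP, basisFun]
  split_ifs
  · simp
  · rw [(chebC_eval i b).1, map_add, ofVar_single, ofVar_single]
    rfl

open PowerSeries in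
/-- The coefficientwise constant term of a power series over the Laurent polynomials. -/
def ctS (n : ℕ) : (Laurent n)⟦X⟧ →+ ℝ⟦X⟧ where
  toFun F := PowerSeries.mk fun d => ct (PowerSeries.coeff d F)
  map_zero' := by ext; simp
  map_add' F G := by ext; simp

open PowerSeries in
/-- The coefficientwise constant term of a power series over `Laurent₁`. -/
def ctS₁ (F : Laurent₁⟦X⟧) : ℝ⟦X⟧ := PowerSeries.mk fun d => ct₁ (PowerSeries.coeff d F)

theorem coeff_ctS (F : PowerSeries (Laurent n)) (d : ℕ) :
    PowerSeries.coeff d (ctS n F) = ct (PowerSeries.coeff d F) := by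
  change PowerSeries.coeff d (PowerSeries.mk fun d => ct (PowerSeries.coeff d F)) = _
  rw [PowerSeries.coeff_mk]

open PowerSeries in
theorem ctS_prod (h : Fin n → Laurent₁⟦X⟧) :
    ctS n (∏ j, PowerSeries.map (ofVar j).toRingHom (h j)) = ∏ j, ctS₁ (h j) := by
  ext d
  rw [PowerSeries.coeff_prod, coeff_ctS, PowerSeries.coeff_prod, map_sum]
  refine Finset.sum_congr rfl fun l _ => ?_
  simp only [PowerSeries.coeff_map, ctS₁, PowerSeries.coeff_mk]
  exact ct_prod_ofVar _

open PowerSeries in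
theorem prod_rescale_exp {A ι : Type*} [CommRing A] [Algebra ℚ A] (t : Finset ι) (a : ι → A) :
    ∏ i ∈ t, rescale (a i) (exp A) = rescale (∑ i ∈ t, a i) (exp A) := by
  classical
  induction t using Finset.induction_on with
  | empty =>
    rw [Finset.prod_empty, Finset.sum_empty, rescale_zero_apply, constantCoeff_exp, map_one]
  | insert i t hi ih => rw [Finset.prod_insert hi, Finset.sum_insert hi, ih, exp_mul_exp_eq_exp_add]

theorem coeff_zero_mul (F : Laurent₁) (k : ℤ) :
    ct₁ (AddMonoidAlgebra.single k 1 * F) = F.coeff (-k) := by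
  induction F using AddMonoidAlgebra.induction_linear with
  | zero => simp [ct₁]
  | add f g hf hg =>
    rw [mul_add, AddMonoidAlgebra.coeff_add, Finsupp.add_apply, ← hf, ← hg]
    rfl
  | single m a =>
    rw [AddMonoidAlgebra.single_mul_single, ct₁, AddMonoidAlgebra.coeff_single,
      AddMonoidAlgebra.coeff_single, Finsupp.single_apply, Finsupp.single_apply, one_mul]
    congr 1
    apply propext
    omega

/-- The matrix of multiplication by an even Laurent polynomial in the cosine basis. -/
def cosMat (n : ℕ) (F : Laurent₁) : Matrix (Fin n) (Fin n) ℝ :=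
  Matrix.of fun a b => if (b : ℕ) = 0 then F.coeff a else F.coeff (a - b) + F.coeff (a + b)

theorem ct₁_add (F G : Laurent₁) : ct₁ (F + G) = ct₁ F + ct₁ G := rfl

/-- The row factor `1` or `2` is the squared norm of the basis element; pulling it out normalizes
`cosMat n 1` to the identity. -/
theorem ct₁_basisFun (F : Laurent₁) (hF : ∀ k, F.coeff (-k) = F.coeff k) (a b : Fin n) :
    ct₁ (basisFun a * basisFun b * F) = (if (a : ℕ) = 0 then 1 else 2) * cosMat n F a b := by
  have hs : ∀ k l : ℤ, (AddMonoidAlgebra.single k 1 * AddMonoidAlgebra.single l 1 : Laurent₁) =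
      AddMonoidAlgebra.single (k + l) 1 := fun k l => by
    rw [AddMonoidAlgebra.single_mul_single, one_mul]
  have e1 : F.coeff (-(a : ℤ) - b) = F.coeff (a + b) := by rw [← hF]; congr 1; ring
  have e2 : F.coeff ((b : ℤ) - a) = F.coeff (a - b) := by rw [← hF]; congr 1; ring
  have h1 : ∀ k : ℤ, F.coeff (-k) = F.coeff k := hF
  simp only [basisFun, cosMat, Matrix.of_apply]
  split_ifs with ha hb hb
  · simp [ct₁, ha]
  · simp only [one_mul, add_mul, ct₁_add, coeff_zero_mul, h1, ha, Nat.cast_zero, zero_sub, zero_add]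
  · simp only [mul_one, add_mul, ct₁_add, coeff_zero_mul, h1]
    ring
  · simp only [mul_add, add_mul, ct₁_add, hs, coeff_zero_mul]
    rw [neg_add_rev, neg_add_rev, neg_add_rev, neg_add_rev, neg_neg, neg_neg,
      show -(b : ℤ) + -a = -(a + b) by ring, h1, show -(b : ℤ) + a = a - b by ring,
      show (b : ℤ) + -a = -(a - b) by ring, h1, add_comm (b : ℤ) a]
    ring

open PowerSeries in
/-- Even Laurent polynomials stay even under powers. -/
theorem coeff_neg_pow (F : Laurent₁) (hF : ∀ k, F.coeff (-k) = F.coeff k) (d : ℕ) (k : ℤ) :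
    (F ^ d).coeff (-k) = (F ^ d).coeff k := by
  set ν : Laurent₁ →ₐ[ℝ] Laurent₁ := AddMonoidAlgebra.mapDomainAlgHom ℝ ℝ (negAddMonoidHom (α := ℤ))
  have h1 : ∀ (G : Laurent₁) (k : ℤ), (ν G).coeff k = G.coeff (-k) := by
    intro G k
    induction G using AddMonoidAlgebra.induction_linear with
    | zero => simp
    | add f g hf hg => rw [map_add, AddMonoidAlgebra.coeff_add, AddMonoidAlgebra.coeff_add,
        Finsupp.add_apply, Finsupp.add_apply, hf, hg]
    | single m a =>
      have h2 : ν (AddMonoidAlgebra.single m a) = AddMonoidAlgebra.single (-m) a :=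
        AddMonoidAlgebra.mapDomain_single
      rw [h2, AddMonoidAlgebra.coeff_single, AddMonoidAlgebra.coeff_single, Finsupp.single_apply,
        Finsupp.single_apply]
      congr 1
      apply propext
      omega
  have h2 : ν F = F := by
    apply AddMonoidAlgebra.ext
    ext k
    rw [h1, hF]
  rw [← h1, map_pow, h2]

theorem coeff_rescale_exp {R : Type*} [CommRing R] [Algebra ℚ R] [Algebra ℝ R] (G : R) (d : ℕ) :
    PowerSeries.coeff d (PowerSeries.rescale G (PowerSeries.exp R)) =
      (1 / d.factorial : ℝ) • G ^ d := by
  have h : algebraMap ℚ R = (algebraMap ℝ R).comp (algebraMap ℚ ℝ) := Subsingleton.elim _ _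
  rw [PowerSeries.coeff_rescale, PowerSeries.coeff_exp, h, Algebra.smul_def, mul_comm]
  simp

theorem map_ofVar_rescale_exp (j : Fin n) (F : Laurent₁) :
    PowerSeries.map (ofVar j).toRingHom
      (PowerSeries.rescale F (PowerSeries.exp Laurent₁)) =
      PowerSeries.rescale (ofVar j F) (PowerSeries.exp (Laurent n)) := by
  ext1 d
  rw [PowerSeries.coeff_map, coeff_rescale_exp, coeff_rescale_exp]
  change ofVar j _ = _
  rw [map_smul, map_pow]

theorem ctS_moment (F : Laurent₁) :
    ctS n (PowerSeries.C (vand n) ^ 2 * ∏ j, PowerSeries.map (ofVar j).toRingHom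
      (PowerSeries.rescale F (PowerSeries.exp Laurent₁))) =
    PowerSeries.mk fun d => ct (vand n ^ 2 * (∑ j, ofVar j F) ^ d) / d.factorial := by
  simp only [map_ofVar_rescale_exp]
  rw [prod_rescale_exp, ← map_pow (PowerSeries.C (R := Laurent n))]
  ext d
  rw [coeff_ctS, PowerSeries.coeff_mk, PowerSeries.coeff_C_mul, coeff_rescale_exp,
    mul_smul_comm, map_smul, smul_eq_mul]
  ring

theorem det_map_ofVar :
    (Matrix.of fun i j : Fin n => PowerSeries.map (ofVar i).toRingHom
      (PowerSeries.C (basisFun j))).det = PowerSeries.C (vand n) := by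
  rw [vand_eq_det, RingHom.map_det]
  congr 1
  ext1 i j
  exact PowerSeries.map_C (ofVar i).toRingHom (basisFun j)

theorem ctS₁_basisFun (F : Laurent₁) (hF : ∀ k, F.coeff (-k) = F.coeff k) (a b : Fin n) :
    ctS₁ (PowerSeries.C (basisFun a) * PowerSeries.C (basisFun b) *
      PowerSeries.rescale F (PowerSeries.exp Laurent₁)) =
    PowerSeries.C (if (a : ℕ) = 0 then 1 else 2 : ℝ) *
      PowerSeries.mk fun d => cosMat n (F ^ d) a b / d.factorial := by
  ext d
  rw [ctS₁, PowerSeries.coeff_mk, ← map_mul, PowerSeries.coeff_C_mul, PowerSeries.coeff_C_mul,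
    PowerSeries.coeff_mk, coeff_rescale_exp, mul_smul_comm]
  have h : ∀ (r : ℝ) (G : Laurent₁), ct₁ (r • G) = r * ct₁ G := fun r G => rfl
  rw [h, ct₁_basisFun _ (coeff_neg_pow F hF d)]
  ring

theorem cosMat_one : cosMat n 1 = 1 := by
  have h : ∀ k : ℤ, (1 : Laurent₁).coeff k = if k = 0 then 1 else 0 := by
    intro k
    rw [AddMonoidAlgebra.one_def, AddMonoidAlgebra.coeff_single, Finsupp.single_apply]
    simp only [eq_comm]
  ext a b
  simp only [cosMat, Matrix.of_apply, h, Matrix.one_apply, Fin.ext_iff]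
  split_ifs <;> first | omega | simp

/-- The generating series of the moments of a linear statistic is a determinant. -/
theorem moment_series_eq_det (F : Laurent₁) (hF : ∀ k, F.coeff (-k) = F.coeff k) :
    (PowerSeries.mk fun d => ct (vand n ^ 2 * (∑ j, ofVar j F) ^ d) / d.factorial) =
      PowerSeries.C (ct (vand n ^ 2)) * (Matrix.of fun a b : Fin n =>
        PowerSeries.mk fun d => cosMat n (F ^ d) a b / d.factorial).det := by
  have hand := andreief (fun j : Fin n => PowerSeries.map (ofVar j).toRingHom) ctS₁ (ctS n)
    ctS_prod (fun b : Fin n => PowerSeries.C (basisFun b))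
    (PowerSeries.rescale F (PowerSeries.exp Laurent₁))
  rw [det_map_ofVar, ctS_moment] at hand
  simp only [ctS₁_basisFun F hF] at hand
  have h2 := Matrix.det_mul_column
    (fun a : Fin n => (PowerSeries.C (if (a : ℕ) = 0 then 1 else 2 : ℝ) : PowerSeries ℝ))
    (Matrix.of fun a b : Fin n => PowerSeries.mk fun d => cosMat n (F ^ d) a b / d.factorial)
  simp only [Matrix.of_apply] at h2
  rw [h2, ← map_prod] at hand
  -- Comparison of constant terms identifies `n!` times the product of the row factors with `ct
  -- (vand n ^ 2)`.
  have h3 := congrArg PowerSeries.constantCoeff hand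
  have h4 : PowerSeries.constantCoeff (Matrix.of fun a b : Fin n =>
      PowerSeries.mk fun d => cosMat n (F ^ d) a b / d.factorial).det = 1 := by
    rw [RingHom.map_det]
    have h5 : (PowerSeries.constantCoeff (R := ℝ)).mapMatrix (Matrix.of fun a b : Fin n =>
      PowerSeries.mk fun d => cosMat n (F ^ d) a b / d.factorial) = 1 := by
      ext a b
      rw [← cosMat_one]
      simp [RingHom.mapMatrix_apply, ← PowerSeries.coeff_zero_eq_constantCoeff_apply]
    rw [h5, Matrix.det_one]
  rw [map_mul, map_mul, h4, PowerSeries.constantCoeff_C,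
    ← PowerSeries.coeff_zero_eq_constantCoeff_apply, PowerSeries.coeff_mk, map_natCast] at h3
  simp only [pow_zero, mul_one, Nat.factorial_zero, Nat.cast_one, div_one] at h3
  rw [hand, h3, map_mul, map_natCast, mul_assoc]

end Laurent

end SOCumulants

end

noncomputable section

namespace SOCumulants

/-! ### Formal cumulants of a determinantal moment series -/

section Compositions

/-- The block lists of the compositions of `l` of length `m`. -/
def blockLists (l m : ℕ) : Finset (List ℕ) :=
  ((Finset.univ : Finset (Composition l)).filter fun c => c.length = m).image Composition.blocks

theorem mem_blockLists {l m : ℕ} {L : List ℕ} :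
    L ∈ blockLists l m ↔ (∀ x ∈ L, 0 < x) ∧ L.sum = l ∧ L.length = m := by
  simp only [blockLists, Finset.mem_image, Finset.mem_filter, Finset.mem_univ, true_and]
  constructor
  · rintro ⟨c, hc, rfl⟩
    exact ⟨fun x hx => c.blocks_pos hx, c.blocks_sum, hc⟩
  · rintro ⟨h1, h2, h3⟩
    exact ⟨⟨L, fun hx => h1 _ hx, h2⟩, h3, rfl⟩

theorem sum_blockLists {E : Type*} [AddCommMonoid E] (l m : ℕ) (f : List ℕ → E) :
    ∑ L ∈ blockLists l m, f L =
      ∑ c : Composition l, if c.length = m then f c.blocks else 0 := by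
  rw [blockLists, Finset.sum_image fun a _ b _ h => Composition.ext h, Finset.sum_filter]

/-- Splitting off the first block matches the Cauchy product in `A * A ^ m`. -/
theorem sum_blockLists_succ {E : Type*} [AddCommMonoid E] (l m : ℕ) (f : List ℕ → E) :
    ∑ L ∈ blockLists l (m + 1), f L =
      ∑ p ∈ (Finset.HasAntidiagonal.antidiagonal l).filter (fun p => 0 < p.1), ∑ L ∈ blockLists p.2 m,
        f (p.1 :: L) := by
  rw [Finset.sum_sigma']
  refine Finset.sum_bij' (fun L _ => ⟨(L.headI, L.tail.sum), L.tail⟩) (fun x _ => x.1.1 :: x.2)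
    ?_ ?_ ?_ ?_ ?_
  · intro L hL
    obtain ⟨h1, h2, h3⟩ := mem_blockLists.1 hL
    obtain ⟨a, L', rfl⟩ := List.exists_cons_of_length_eq_add_one h3
    simp only [Finset.mem_sigma, Finset.mem_filter, Finset.HasAntidiagonal.mem_antidiagonal, mem_blockLists]
    simp only [List.headI, List.tail_cons]
    refine ⟨⟨by simpa using h2, h1 a (by simp)⟩, fun x hx => h1 x (by simp [hx]), trivial,
      by simpa using h3⟩
  · rintro ⟨⟨i, j⟩, L⟩ hx
    simp only [Finset.mem_sigma, Finset.mem_filter, Finset.HasAntidiagonal.mem_antidiagonal, mem_blockLists] at hx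
    obtain ⟨⟨h1, h2⟩, h3, h4, h5⟩ := hx
    refine mem_blockLists.2 ⟨?_, ?_, ?_⟩
    · intro x hx
      rcases List.mem_cons.1 hx with rfl | hx
      · exact h2
      · exact h3 x hx
    · simp [h4, h1]
    · simp [h5]
  · intro L hL
    obtain ⟨h1, h2, h3⟩ := mem_blockLists.1 hL
    obtain ⟨a, L', rfl⟩ := List.exists_cons_of_length_eq_add_one h3
    rfl
  · rintro ⟨⟨i, j⟩, L⟩ hx
    simp only [Finset.mem_sigma, mem_blockLists] at hx
    simp only [List.headI, List.tail_cons, hx.2.2.1]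
  · intro L hL
    obtain ⟨h1, h2, h3⟩ := mem_blockLists.1 hL
    obtain ⟨a, L', rfl⟩ := List.exists_cons_of_length_eq_add_one h3
    rfl

end Compositions

section MatrixSeries

open PowerSeries

variable {ι : Type*} [Fintype ι] [DecidableEq ι]

/-- The coefficient matrix of a matrix of power series. -/
def coeffMat (d : ℕ) (A : Matrix ι ι ℝ⟦X⟧) : Matrix ι ι ℝ := A.map (coeff d)

theorem coeffMat_mul (d : ℕ) (A B : Matrix ι ι ℝ⟦X⟧) :
    coeffMat d (A * B) = ∑ p ∈ Finset.HasAntidiagonal.antidiagonal d, coeffMat p.1 A * coeffMat p.2 B := by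
  ext i j
  simp only [coeffMat, Matrix.map_apply, Matrix.mul_apply, map_sum, Matrix.sum_apply,
    PowerSeries.coeff_mul]
  rw [Finset.sum_comm]

/-- As `A` has no constant term, only positive degrees contribute, so the index set consists of
compositions. -/
theorem coeffMat_pow (A : Matrix ι ι ℝ⟦X⟧) (hA : coeffMat 0 A = 0) (l m : ℕ) :
    coeffMat l (A ^ m) = ∑ L ∈ blockLists l m, (L.map fun j => coeffMat j A).prod := by
  induction m generalizing l with
  | zero =>
    have h : blockLists l 0 = if l = 0 then {[]} else ∅ := by
      ext L
      rw [mem_blockLists]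
      constructor
      · rintro ⟨-, h2, h3⟩
        rw [List.length_eq_zero_iff] at h3
        subst h3
        simp at h2
        simp [← h2]
      · intro hL
        split_ifs at hL with h0
        · rw [Finset.mem_singleton] at hL
          subst hL
          simp [h0]
        · simp at hL
    rw [h, pow_zero]
    split_ifs with h0
    · subst h0
      ext i j
      simp only [coeffMat, Matrix.map_apply, Finset.sum_singleton, List.map_nil, List.prod_nil,
        Matrix.one_apply]
      split_ifs <;> simp
    · ext i j
      simp only [coeffMat, Matrix.map_apply, Finset.sum_empty, Matrix.one_apply]
      split_ifs <;> simp [PowerSeries.coeff_one, h0]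
  | succ m ih =>
    rw [pow_succ', coeffMat_mul, sum_blockLists_succ, Finset.sum_filter]
    refine Finset.sum_congr rfl fun p _ => ?_
    split_ifs with h
    · simp only [List.map_cons, List.prod_cons]
      rw [ih, Finset.mul_sum]
    · rw [Nat.eq_zero_of_not_pos h, hA, zero_mul]

theorem coeffMat_pow_eq_zero (A : Matrix ι ι ℝ⟦X⟧) (hA : coeffMat 0 A = 0) {l m : ℕ} (h : l < m) :
    coeffMat l (A ^ m) = 0 := by
  rw [coeffMat_pow A hA, Finset.sum_eq_zero]
  intro L hL
  obtain ⟨h1, h2, h3⟩ := mem_blockLists.1 hL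
  have h4 : L.length ≤ L.sum := List.length_le_sum_of_one_le L fun x hx => h1 x hx
  omega

theorem map_derivative_mul (A B : Matrix ι ι ℝ⟦X⟧) :
    (A * B).map (d⁄dX ℝ) = A * B.map (d⁄dX ℝ) + A.map (d⁄dX ℝ) * B := by
  ext i j : 1
  simp only [Matrix.map_apply, Matrix.mul_apply, map_sum, Matrix.add_apply, Derivation.leibniz,
    smul_eq_mul, Finset.sum_add_distrib]
  congr 1
  exact Finset.sum_congr rfl fun k _ => mul_comm _ _

theorem derivative_trace_pow (A : Matrix ι ι ℝ⟦X⟧) (m : ℕ) :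
    d⁄dX ℝ (A ^ (m + 1)).trace = (m + 1 : ℝ⟦X⟧) * (A ^ m * A.map (d⁄dX ℝ)).trace := by
  have h1 : ∀ B : Matrix ι ι ℝ⟦X⟧, d⁄dX ℝ B.trace = (B.map (d⁄dX ℝ)).trace := fun B => by
    simp [Matrix.trace]
  -- `A` need not commute with its derivative. The extra factor `C` collects the powers of `A` that
  -- cyclicity moves to the front.
  have h2 : ∀ (m : ℕ) (C : Matrix ι ι ℝ⟦X⟧), Commute A C →
      (C * (A ^ m).map (d⁄dX ℝ)).trace = m * (C * A ^ (m - 1) * A.map (d⁄dX ℝ)).trace := by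
    intro m
    induction m with
    | zero =>
      intro C _
      have : ((1 : Matrix ι ι ℝ⟦X⟧).map (d⁄dX ℝ)) = 0 := by
        ext i j : 1
        simp only [Matrix.map_apply, Matrix.one_apply, Matrix.zero_apply]
        split_ifs <;> simp
      simp [this]
    | succ m ih =>
      intro C hC
      rw [pow_succ, map_derivative_mul, mul_add, Matrix.trace_add, ← mul_assoc, ← mul_assoc,
        Matrix.trace_mul_comm _ A, ← mul_assoc, ih (A * C) ((Commute.refl A).mul_right hC)]
      rcases Nat.eq_zero_or_pos m with rfl | hm
      · simp
      · have h3 : A * C * A ^ (m - 1) = C * A ^ m := by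
          rw [hC.eq, mul_assoc, ← pow_succ', Nat.sub_add_cancel hm]
        rw [h3, Nat.add_sub_cancel]
        push_cast
        ring
  have h3 := h2 (m + 1) 1 (Commute.one_right A)
  rw [one_mul, one_mul, Nat.add_sub_cancel] at h3
  rw [h1, h3]
  push_cast
  rfl

/-- The weight of a composition in the function `G`. -/
def compWeight {l : ℕ} (c : Composition l) : ℝ :=
  (-1 : ℝ) ^ c.length / c.length * (1 / ∏ i, ((c.blocksFun i).factorial : ℝ))

theorem prod_blocks_factorial {l : ℕ} (c : Composition l) :
    ∏ i, ((c.blocksFun i).factorial : ℝ) = (c.blocks.map fun j => (j.factorial : ℝ)).prod := by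
  rw [← c.ofFn_blocksFun, List.map_ofFn, List.prod_ofFn]
  rfl

/-- If the moment series `∑ m_d t^d / d!` is the determinant of `∑ T_d t^d / d!`, then the
cumulants are given by sums of traces over compositions. -/
theorem formal_cumulant (T : ℕ → Matrix ι ι ℝ) (hT : T 0 = 1) (m κ : ℕ → ℝ)
    (hdet : (PowerSeries.mk fun d => m d / d.factorial) =
      (Matrix.of fun a b => PowerSeries.mk fun d => T d a b / d.factorial).det)
    (hκ : ∀ l, m (l + 1) =
      ∑ p ∈ Finset.HasAntidiagonal.antidiagonal l, (l.choose p.1 : ℝ) * (m p.1 * κ (p.2 + 1))) {l : ℕ}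
    (hl : 1 ≤ l) :
    κ l = -(l.factorial : ℝ) * ∑ c : Composition l, compWeight c * (c.blocks.map T).prod.trace := by
  set B : Matrix ι ι ℝ⟦X⟧ := Matrix.of fun a b => PowerSeries.mk fun d => T d a b / d.factorial
    with hB
  set A : Matrix ι ι ℝ⟦X⟧ := B - 1 with hA
  have hBA : B = 1 + A := by rw [hA]; abel
  have hcB : constantCoeff B.det = 1 := by
    rw [RingHom.map_det]
    have : (constantCoeff (R := ℝ)).mapMatrix B = 1 := by
      ext a b
      rw [← hT]
      simp [hB, RingHom.mapMatrix_apply, ← PowerSeries.coeff_zero_eq_constantCoeff_apply]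
    rw [this, Matrix.det_one]
  have hunit : IsUnit B.det := by
    rw [PowerSeries.isUnit_iff_constantCoeff, hcB]
    exact isUnit_one
  have hne : B.det ≠ 0 := hunit.ne_zero
  have hinv : B * B⁻¹ = 1 := Matrix.mul_nonsing_inv B hunit
  have hinv' : B⁻¹ * B = 1 := Matrix.nonsing_inv_mul B hunit
  have hdA : B.map (d⁄dX ℝ) = A.map (d⁄dX ℝ) := by
    ext i j : 1
    simp only [hA, Matrix.map_apply, Matrix.sub_apply, map_sub, Matrix.one_apply]
    split_ifs <;> simp
  set K : ℝ⟦X⟧ := PowerSeries.mk fun d => κ (d + 1) / d.factorial with hK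
  -- The recursion `hκ`, read coefficientwise: `K` is the logarithmic derivative of the moment
  -- series.
  have hK1 : d⁄dX ℝ B.det = B.det * K := by
    rw [← hdet]
    ext d
    rw [PowerSeries.coeff_derivative, PowerSeries.coeff_mk, PowerSeries.coeff_mul, hκ,
      Finset.sum_div, Finset.sum_mul]
    refine Finset.sum_congr rfl fun p hp => ?_
    have hp' := Finset.HasAntidiagonal.mem_antidiagonal.1 hp
    rw [hK, PowerSeries.coeff_mk, PowerSeries.coeff_mk, ← hp', Nat.cast_add_choose]
    rw [Nat.factorial_succ]
    push_cast
    have h1 := Nat.factorial_ne_zero p.1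
    have h2 := Nat.factorial_ne_zero p.2
    have h3 := Nat.factorial_ne_zero (p.1 + p.2)
    field_simp
  have hK2 : K = (B⁻¹ * A.map (d⁄dX ℝ)).trace := by
    have := derivation_det_of_inv (d⁄dX ℝ) hinv
    rw [hK1, hdA] at this
    exact mul_left_cancel₀ hne this
  -- A finite Neumann series with remainder; for `N = l + 1` the remainder has no coefficients in
  -- degrees up to `l`.
  have hgeom : ∀ N : ℕ, B⁻¹ = ∑ k ∈ Finset.range N, (-1 : Matrix ι ι ℝ⟦X⟧) ^ k * A ^ k +
      (-1) ^ N * (B⁻¹ * A ^ N) := by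
    intro N
    induction N with
    | zero => simp
    | succ N ih =>
      rw [Finset.sum_range_succ]
      have h1 : B⁻¹ = 1 - B⁻¹ * A := by
        have h2 := hinv'
        rw [hBA, mul_add, mul_one, ← hBA] at h2
        exact eq_sub_of_add_eq h2
      conv_lhs => rw [ih]
      conv_lhs => rw [h1]
      rw [pow_succ, pow_succ' A]
      noncomm_ring
  have hA0 : coeffMat 0 A = 0 := by
    ext a b
    simp only [coeffMat, hA, hB, Matrix.map_apply, Matrix.sub_apply, Matrix.of_apply, map_sub,
      PowerSeries.coeff_mk, hT, Matrix.one_apply, Matrix.zero_apply]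
    split_ifs <;> simp
  have hAd : ∀ d, 0 < d → coeffMat d A = (1 / d.factorial : ℝ) • T d := by
    intro d hd
    ext a b
    simp only [coeffMat, hA, hB, Matrix.map_apply, Matrix.sub_apply, Matrix.of_apply, map_sub,
      PowerSeries.coeff_mk, Matrix.one_apply, Matrix.smul_apply, smul_eq_mul]
    split_ifs <;> simp [PowerSeries.coeff_one, hd.ne'] <;> ring
  obtain ⟨l, rfl⟩ := Nat.exists_eq_add_of_le' hl
  have hcoeff : ∀ F : Matrix ι ι ℝ⟦X⟧, ∀ d, coeff d F.trace = (coeffMat d F).trace := fun F d => by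
    simp [Matrix.trace, coeffMat]
  have hmain : coeff l K = ∑ k ∈ Finset.range (l + 1), (-1 : ℝ) ^ k *
      ((l + 1) / (k + 1) * (coeffMat (l + 1) (A ^ (k + 1))).trace) := by
    rw [hK2, hgeom (l + 1), add_mul, Matrix.trace_add, map_add]
    have h0 : coeff l ((-1) ^ (l + 1) * (B⁻¹ * A ^ (l + 1)) * A.map (d⁄dX ℝ)).trace = 0 := by
      have : (-1 : Matrix ι ι ℝ⟦X⟧) ^ (l + 1) * (B⁻¹ * A ^ (l + 1)) * A.map (d⁄dX ℝ) =
          (-1) ^ (l + 1) * B⁻¹ * (A ^ (l + 1) * A.map (d⁄dX ℝ)) := by noncomm_ring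
      rw [this, hcoeff, coeffMat_mul, Finset.sum_eq_zero, Matrix.trace_zero]
      intro p hp
      have hp' := Finset.HasAntidiagonal.mem_antidiagonal.1 hp
      rw [coeffMat_mul p.2, Finset.sum_eq_zero, mul_zero]
      intro q hq
      have hq' := Finset.HasAntidiagonal.mem_antidiagonal.1 hq
      rw [coeffMat_pow_eq_zero A hA0 (by omega), zero_mul]
    rw [h0, add_zero, Finset.sum_mul, Matrix.trace_sum, map_sum]
    refine Finset.sum_congr rfl fun k _ => ?_
    have h1 := derivative_trace_pow A k
    have h2 := congrArg (coeff l) h1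
    rw [PowerSeries.coeff_derivative, hcoeff] at h2
    have h3 : (k + 1 : ℝ⟦X⟧) = C (k + 1 : ℝ) := by simp
    rw [h3, PowerSeries.coeff_C_mul] at h2
    have h4 : ((-1 : Matrix ι ι ℝ⟦X⟧) ^ k * A ^ k * A.map (d⁄dX ℝ)).trace =
        C ((-1 : ℝ) ^ k) * (A ^ k * A.map (d⁄dX ℝ)).trace := by
      rcases Nat.even_or_odd k with hk | hk
      · simp only [hk.neg_one_pow, one_mul, map_one]
      · simp only [hk.neg_one_pow, neg_mul, one_mul, Matrix.trace_neg, map_neg, map_one]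
    rw [h4, PowerSeries.coeff_C_mul]
    congr 1
    have hk : (k + 1 : ℝ) ≠ 0 := by positivity
    field_simp
    linarith
  have hprod : ∀ L : List ℕ, (∀ x ∈ L, 0 < x) → (L.map fun j => coeffMat j A).prod =
      (1 / (L.map fun j => (j.factorial : ℝ)).prod) • (L.map T).prod := by
    intro L
    induction L with
    | nil => simp
    | cons a L ih =>
      intro h
      rw [List.map_cons, List.prod_cons, List.map_cons, List.prod_cons, List.map_cons,
        List.prod_cons, ih fun x hx => h x (by simp [hx]), hAd a (h a (by simp)), smul_mul_smul_comm]
      congr 1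
      field_simp
  have hcomp : ∀ k, (coeffMat (l + 1) (A ^ (k + 1))).trace = ∑ c : Composition (l + 1),
      if c.length = k + 1 then (1 / ∏ i, ((c.blocksFun i).factorial : ℝ)) *
        (c.blocks.map T).prod.trace else 0 := by
    intro k
    rw [coeffMat_pow A hA0, sum_blockLists, Matrix.trace_sum]
    refine Finset.sum_congr rfl fun c _ => ?_
    split_ifs
    · rw [hprod _ fun x hx => c.blocks_pos hx, Matrix.trace_smul, smul_eq_mul,
        prod_blocks_factorial]
    · simp
  rw [hK, PowerSeries.coeff_mk] at hmain
  simp only [hcomp] at hmain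
  have hl0 := Nat.factorial_ne_zero l
  have h5 : κ (l + 1) = l.factorial * (κ (l + 1) / l.factorial) := by field_simp
  rw [h5, hmain, Nat.factorial_succ, Finset.mul_sum, Finset.mul_sum]
  simp only [Finset.mul_sum]
  rw [Finset.sum_comm]
  refine Finset.sum_congr rfl fun c _ => ?_
  have hc1 : 0 < c.length := c.length_pos_of_pos (Nat.succ_pos l)
  have hc2 : c.length ≤ l + 1 := c.length_le
  rw [Finset.sum_eq_single (c.length - 1)]
  · rw [if_pos (Nat.sub_add_cancel hc1).symm, compWeight]
    have h6 : (((c.length - 1 : ℕ) : ℝ) + 1) = c.length := by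
      rw [← Nat.cast_succ, Nat.succ_eq_add_one, Nat.sub_add_cancel hc1]
    -- The logarithm carries `(-1) ^ (m - 1) / m` and `compWeight` carries `(-1) ^ m / m`; hence the
    -- minus sign in the conclusion.
    have h7 : (-1 : ℝ) ^ c.length = -(-1) ^ (c.length - 1) := by
      conv_lhs => rw [← Nat.sub_add_cancel hc1, pow_succ]
      ring
    rw [h6, h7]
    push_cast
    ring
  · intro b _ hb
    rw [if_neg (by omega)]
    simp
  · intro h
    exact absurd (Finset.mem_range.2 (by omega)) h

/-- This is `formal_cumulant` for the deterministic variable `1`, with `1 × 1` identity matrices: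
its cumulants beyond the first are zero. -/
theorem sum_compWeight {l : ℕ} (hl : 2 ≤ l) : ∑ c : Composition l, compWeight c = 0 := by
  have h := formal_cumulant (ι := Fin 1) (fun _ => 1) rfl (fun _ => 1)
    (fun k => if k = 1 then 1 else 0) (by simp) (fun k => by
      rw [Finset.sum_eq_single (k, 0)]
      · simp
      · rintro ⟨a, b⟩ hp hne
        have := Finset.HasAntidiagonal.mem_antidiagonal.1 hp
        have hb : b ≠ 0 := fun hb => hne (by simp at this; ext <;> simp <;> omega)
        simp [hb]
      · intro h; exact absurd (Finset.HasAntidiagonal.mem_antidiagonal.2 (by simp)) h) (l := l) (by omega)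
  rw [if_neg (by omega)] at h
  have h2 : ∀ c : Composition l,
      (c.blocks.map fun _ : ℕ => (1 : Matrix (Fin 1) (Fin 1) ℝ)).prod.trace = 1 := by
    intro c
    simp
  simp only [h2, mul_one] at h
  have hf : -(l.factorial : ℝ) ≠ 0 := neg_ne_zero.2 (by exact_mod_cast Nat.factorial_ne_zero l)
  exact (mul_eq_zero.1 h.symm).resolve_left hf

end MatrixSeries

end SOCumulants

end

noncomputable section

namespace SOCumulants

/-! ### Traces of products of cosine matrices -/

section Toeplitz

open Matrix Laurent

/-- The integers of absolute value less than `n`. -/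
abbrev Window (n : ℕ) : Type := {x : ℤ // x ∈ Finset.Ioo (-(n : ℤ)) n}

/-- The Toeplitz matrix of a Laurent polynomial on the window `|a| < n`. -/
def toep (n : ℕ) (F : Laurent₁) : Matrix (Window n) (Window n) ℝ :=
  Matrix.of fun a b => F.coeff ((a : ℤ) - b)

/-- Even extension of a vector from `0 ≤ a < n` to `|x| < n`. -/
def foldMat (n : ℕ) : Matrix (Window n) (Fin n) ℝ :=
  Matrix.of fun x b => if |(x : ℤ)| = (b : ℕ) then 1 else 0

/-- Averaging of a vector on `|x| < n` over `± a`. -/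
def unfoldMat (n : ℕ) : Matrix (Fin n) (Window n) ℝ :=
  Matrix.of fun a x => ((if (x : ℤ) = (a : ℕ) then 1 else 0) +
    (if (x : ℤ) = -((a : ℕ) : ℤ) then 1 else 0)) / 2

theorem Window.sum_ite {n : ℕ} (f : ℤ → ℝ) (d : ℤ) (hd : d ∈ Finset.Ioo (-(n : ℤ)) n) :
    ∑ y : Window n, f y * (if (y : ℤ) = d then 1 else 0) = f d := by
  rw [Finset.sum_eq_single ⟨d, hd⟩]
  · simp
  · intro b _ hb
    rw [if_neg fun h => hb (Subtype.ext h), mul_zero]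
  · simp

theorem Window.sum_abs_ite {n : ℕ} (f : ℤ → ℝ) (b : Fin n) :
    ∑ y : Window n, f y * (if |(y : ℤ)| = (b : ℕ) then 1 else 0) =
      if (b : ℕ) = 0 then f 0 else f (b : ℕ) + f (-((b : ℕ) : ℤ)) := by
  have hb := b.2
  split_ifs with h
  · rw [← Window.sum_ite (n := n) f 0 (by simp; omega)]
    refine Finset.sum_congr rfl fun y _ => ?_
    rw [h]
    simp
  · rw [← Window.sum_ite (n := n) f (b : ℕ) (by simp; omega),
      ← Window.sum_ite (n := n) f (-((b : ℕ) : ℤ)) (by simp; omega), ← Finset.sum_add_distrib]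
    refine Finset.sum_congr rfl fun y _ => ?_
    rw [← mul_add]
    congr 1
    rcases abs_cases (y : ℤ) with ⟨h1, h2⟩ | ⟨h1, h2⟩ <;> rw [h1] <;> split_ifs <;> first | omega | simp

/-- The index `|x|`. -/
def Window.abs {n : ℕ} (x : Window n) : Fin n :=
  ⟨(x : ℤ).natAbs, by have := Finset.mem_Ioo.1 x.2; omega⟩

theorem Window.sum_foldMat_mul {n : ℕ} (x : Window n) (g : Fin n → ℝ) :
    ∑ a, foldMat n x a * g a = g x.abs := by
  rw [Finset.sum_eq_single x.abs]
  · simp [foldMat, Window.abs]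
  · intro b _ hb
    have : ¬ |(x : ℤ)| = (b : ℕ) := by
      intro h
      apply hb
      have hx : (x.abs : ℕ) = (x : ℤ).natAbs := rfl
      ext
      rw [Int.abs_eq_natAbs] at h
      rw [hx]
      omega
    simp [foldMat, this]
  · simp

/-- A symmetric Toeplitz matrix on the window preserves even vectors, and `cosMat` is its
restriction to them. -/
theorem toep_mul_foldMat {n : ℕ} (F : Laurent₁) (hF : ∀ k, F.coeff (-k) = F.coeff k) :
    toep n F * foldMat n = foldMat n * cosMat n F := by
  ext x b
  rw [Matrix.mul_apply, Matrix.mul_apply, Window.sum_foldMat_mul x fun a => cosMat n F a b]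
  have h := Window.sum_abs_ite (n := n) (fun y => F.coeff ((x : ℤ) - y)) b
  refine Eq.trans h ?_
  have hx : (((x.abs : Fin n) : ℕ) : ℤ) = |(x : ℤ)| := by simp [Window.abs]
  simp only [cosMat, Matrix.of_apply, hx]
  rcases abs_cases (x : ℤ) with ⟨h1, h2⟩ | ⟨h1, h2⟩ <;> rw [h1]
  · simp
  · rw [show -(x : ℤ) - (b : ℕ) = -(x - -((b : ℕ) : ℤ)) by ring,
      show -(x : ℤ) + (b : ℕ) = -(x - ((b : ℕ) : ℤ)) by ring, hF, hF, hF, sub_zero, add_comm]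

theorem unfoldMat_mul_foldMat (n : ℕ) : unfoldMat n * foldMat n = 1 := by
  ext a b
  rw [Matrix.mul_apply]
  have h := Window.sum_abs_ite (n := n) (fun y => ((if y = (a : ℕ) then 1 else 0) +
    (if y = -((a : ℕ) : ℤ) then 1 else 0)) / 2) b
  refine Eq.trans h ?_
  rw [Matrix.one_apply]
  simp only [Fin.ext_iff]
  split_ifs <;> first | omega | norm_num

theorem foldMat_mul_unfoldMat {n : ℕ} (x y : Window n) : (foldMat n * unfoldMat n) x y =
    ((if x = y then 1 else 0) + (if (x : ℤ) = -y then 1 else 0)) / 2 := by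
  rw [Matrix.mul_apply, Window.sum_foldMat_mul x fun a => unfoldMat n a y]
  have hx : (((x.abs : Fin n) : ℕ) : ℤ) = |(x : ℤ)| := by simp [Window.abs]
  simp only [unfoldMat, Matrix.of_apply, hx, Subtype.ext_iff]
  rcases abs_cases (x : ℤ) with ⟨h1, h2⟩ | ⟨h1, h2⟩ <;> rw [h1] <;> split_ifs <;> first | omega | simp

/-- The reflected index. -/
def Window.neg {n : ℕ} (x : Window n) : Window n :=
  ⟨-x, by have := Finset.mem_Ioo.1 x.2; rw [Finset.mem_Ioo]; omega⟩

/-- The product of cosine matrices is the compression of the Toeplitz product to even vectors. Its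
trace is that of the Toeplitz product times the projection `(1 + reflection) / 2`. -/
theorem trace_prod_cosMat {n : ℕ} (L : List Laurent₁)
    (hL : ∀ F ∈ L, ∀ k, F.coeff (-k) = F.coeff k) :
    (L.map (cosMat n)).prod.trace = (∑ x, (L.map (toep n)).prod x x +
      ∑ x : Window n, (L.map (toep n)).prod x x.neg) / 2 := by
  have h1 : (L.map (toep n)).prod * foldMat n = foldMat n * (L.map (cosMat n)).prod := by
    induction L with
    | nil => simp
    | cons F L ih =>
      rw [List.map_cons, List.prod_cons, List.map_cons, List.prod_cons, Matrix.mul_assoc,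
        ih fun G hG => hL G (by simp [hG]), ← Matrix.mul_assoc, ← Matrix.mul_assoc,
        toep_mul_foldMat F (hL F (by simp))]
  set W := (L.map (toep n)).prod
  have h2 : (L.map (cosMat n)).prod = unfoldMat n * (W * foldMat n) := by
    rw [h1, ← Matrix.mul_assoc, unfoldMat_mul_foldMat, Matrix.one_mul]
  rw [h2, Matrix.trace_mul_comm, Matrix.mul_assoc, Matrix.trace, ← Finset.sum_add_distrib,
    Finset.sum_div]
  refine Finset.sum_congr rfl fun x _ => ?_
  rw [Matrix.diag_apply, Matrix.mul_apply]
  simp only [foldMat_mul_unfoldMat]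
  rw [← Finset.sum_congr rfl fun y _ => (mul_div_assoc _ _ _), ← Finset.sum_div]
  congr 1
  simp only [mul_add, Finset.sum_add_distrib]
  congr 1
  · simp
  · rw [Finset.sum_eq_single x.neg]
    · simp [Window.neg]
    · intro b _ hb
      rw [if_neg, mul_zero]
      intro h
      exact hb (Subtype.ext h)
    · simp

end Toeplitz

/-! ### Toeplitz products as sums over lattice paths. -/

section Paths

/-- The sum of the first `i` steps. -/
def stepSum (k : ℕ → ℤ) (i : ℕ) : ℤ := ∑ t ∈ Finset.range i, k t

/-- The path started at `x` with steps `-k 0, -k 1, …` is in the window `(-n, n)` at the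
ends of all blocks of `L`. -/
def Stays (n : ℕ) (L : List ℕ) (k : ℕ → ℤ) (x : ℤ) : Prop :=
  ∀ j < L.length, |x - stepSum k (L.take (j + 1)).sum| < n

theorem stays_cons (n b : ℕ) (L : List ℕ) (k : ℕ → ℤ) (x : ℤ) :
    Stays n (b :: L) k x ↔ |x - stepSum k b| < n ∧
      Stays n L (fun i => k (b + i)) (x - stepSum k b) := by
  have h : ∀ i, stepSum k (b + i) = stepSum k b + stepSum (fun i => k (b + i)) i := fun i => by
    rw [stepSum, Finset.sum_range_add]; rfl
  constructor
  · intro H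
    refine ⟨by simpa using H 0 (by simp), fun j hj => ?_⟩
    have := H (j + 1) (by simpa using hj)
    rw [List.take_succ_cons, List.sum_cons, h, ← sub_sub] at this
    exact this
  · rintro ⟨H1, H2⟩ j hj
    rcases j with _ | j
    · simpa using H1
    · rw [List.take_succ_cons, List.sum_cons, h, ← sub_sub]
      exact H2 j (by simpa using hj)

/-- Extension of a vector of steps by zero. -/
def extSteps {K : Finset ℤ} {l : ℕ} (k : Fin l → K) (t : ℕ) : ℤ :=
  if h : t < l then k ⟨t, h⟩ else 0

theorem stepSum_extSteps_append_left {K : Finset ℤ} {a b : ℕ} (u : Fin a → K) (v : Fin b → K) :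
    stepSum (extSteps (Fin.append u v)) a = ∑ i, (u i : ℤ) := by
  rw [stepSum, ← Fin.sum_univ_eq_sum_range]
  refine Finset.sum_congr rfl fun i _ => ?_
  have hi := i.2
  rw [extSteps, dif_pos (by omega)]
  congr 1
  exact Fin.append_left u v i

theorem extSteps_append_add {K : Finset ℤ} {a b : ℕ} (u : Fin a → K) (v : Fin b → K) :
    (fun i => extSteps (Fin.append u v) (a + i)) = extSteps v := by
  funext i
  by_cases h : i < b
  · rw [extSteps, extSteps, dif_pos h, dif_pos (by omega)]
    congr 1
    exact Fin.append_right u v ⟨i, h⟩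
  · rw [extSteps, extSteps, dif_neg h, dif_neg (by omega)]

/-- The Laurent polynomial with coefficients `c` on `K`. -/
def laurentOf (K : Finset ℤ) (c : ℤ → ℝ) : Laurent₁ :=
  ∑ x : K, AddMonoidAlgebra.single (x : ℤ) (c x)

theorem laurentOf_pow (K : Finset ℤ) (c : ℤ → ℝ) (b : ℕ) :
    laurentOf K c ^ b = ∑ k : Fin b → K,
      AddMonoidAlgebra.single (∑ i, (k i : ℤ)) (∏ i, c (k i)) := by
  rw [laurentOf, Fintype.sum_pow]
  refine Fintype.sum_congr _ _ fun k => ?_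
  induction b with
  | zero => rw [Fin.prod_univ_zero, Fin.prod_univ_zero, Fin.sum_univ_zero, AddMonoidAlgebra.one_def]
  | succ b ih =>
    rw [Fin.prod_univ_succ, ih fun i => k i.succ, AddMonoidAlgebra.single_mul_single,
      Fin.sum_univ_succ, Fin.prod_univ_succ]

theorem coeff_laurentOf_pow (K : Finset ℤ) (c : ℤ → ℝ) (b : ℕ) (d : ℤ) :
    (laurentOf K c ^ b).coeff d = ∑ k : Fin b → K,
      (∏ i, c (k i)) * (if ∑ i, (k i : ℤ) = d then 1 else 0) := by
  rw [laurentOf_pow, AddMonoidAlgebra.coeff_sum, Finset.sum_apply']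
  refine Finset.sum_congr rfl fun k _ => ?_
  rw [AddMonoidAlgebra.coeff_single, Finsupp.single_apply]
  simp

-- The summation indices of the matrix product are the positions at the block ends, so only these,
-- and not the positions inside a block, are confined to the window.
open Classical in
theorem prod_toep_apply (n : ℕ) (K : Finset ℤ) (c : ℤ → ℝ) (L : List ℕ) (l : ℕ) (hl : L.sum = l)
    (x y : Window n) :
    ((L.map fun j => laurentOf K c ^ j).map (toep n)).prod x y = ∑ k : Fin l → K,
      (∏ i, c (k i)) * (if Stays n L (extSteps k) x ∧ (x : ℤ) - ∑ i, (k i : ℤ) = y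
        then 1 else 0) := by
  induction L generalizing l x with
  | nil =>
    simp only [List.sum_nil] at hl
    subst hl
    have hst : Stays n [] (extSteps (default : Fin 0 → K)) x := fun j hj => absurd hj (by simp)
    rw [List.map_nil, List.map_nil, List.prod_nil, Fintype.sum_unique, Fin.prod_univ_zero,
      Fin.sum_univ_zero, sub_zero, one_mul, Matrix.one_apply]
    simp only [hst, true_and, Subtype.ext_iff]
  | cons b L ih =>
    simp only [List.sum_cons] at hl
    subst hl
    rw [List.map_cons, List.map_cons, List.prod_cons, Matrix.mul_apply,
      ← (Fin.appendEquiv b L.sum).sum_comp, Fintype.sum_prod_type]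
    simp only [toep, Matrix.of_apply, coeff_laurentOf_pow, Finset.sum_mul]
    rw [Finset.sum_comm]
    refine Finset.sum_congr rfl fun u _ => ?_
    have hs : ∀ v : Fin L.sum → K, ((Fin.appendEquiv b L.sum) (u, v)) = Fin.append u v :=
      fun v => rfl
    simp only [hs, stays_cons, stepSum_extSteps_append_left, extSteps_append_add,
      Fin.prod_univ_add, Fin.append_left, Fin.append_right, Fin.sum_univ_add]
    by_cases hw : (x : ℤ) - ∑ i, (u i : ℤ) ∈ Finset.Ioo (-(n : ℤ)) n
    · rw [Finset.sum_eq_single ⟨_, hw⟩]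
      · have := ih L.sum rfl ⟨_, hw⟩
        simp only at this
        rw [this, Finset.mul_sum]
        refine Finset.sum_congr rfl fun v _ => ?_
        have hw' := abs_lt.2 (Finset.mem_Ioo.1 hw)
        simp only [hw', true_and, sub_sub, sub_sub_cancel, if_true]
        ring
      · intro z _ hz
        rw [if_neg, mul_zero, zero_mul]
        intro h
        apply hz
        ext
        simp only [h]
        ring
      · simp
    · rw [Finset.sum_eq_zero, Finset.sum_eq_zero]
      · intro v _
        rw [if_neg, mul_zero]
        rintro ⟨⟨h, -⟩, -⟩
        exact hw (Finset.mem_Ioo.2 (abs_lt.1 h))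
      · intro z _
        rw [if_neg, mul_zero, zero_mul]
        intro h
        apply hw
        rw [h]
        simp

end Paths

end SOCumulants

end

noncomputable section

namespace SOCumulants

/-! ### Counting the paths and comparison with `G` -/

section Counting

/-- The sum of the first `i` entries of a vector. -/
def partSum {l : ℕ} (k : Fin l → ℤ) (i : ℕ) : ℤ := ∑ t with t.val < i, k t

theorem partSum_zero {l : ℕ} (k : Fin l → ℤ) : partSum k 0 = 0 := by simp [partSum]

theorem partSum_self {l : ℕ} (k : Fin l → ℤ) : partSum k l = ∑ i, k i := by
  rw [partSum, Finset.filter_true_of_mem fun i _ => i.2]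

theorem stepSum_extSteps {K : Finset ℤ} {l : ℕ} (k : Fin l → K) {i : ℕ} (hi : i ≤ l) :
    stepSum (extSteps k) i = partSum (fun t => (k t : ℤ)) i := by
  rw [stepSum, partSum, Finset.sum_filter]
  have h1 : ∀ t : Fin l, (if t.val < i then (k t : ℤ) else 0) =
      (fun t : ℕ => if t < i then extSteps k t else 0) t := fun t => by
    simp [extSteps]
  rw [Finset.sum_congr rfl fun t _ => h1 t,
    Fin.sum_univ_eq_sum_range (fun t : ℕ => if t < i then extSteps k t else 0) l,
    ← Finset.sum_filter]
  congr 1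
  ext t
  simp only [Finset.mem_range, Finset.mem_filter]
  omega

theorem stays_iff {K : Finset ℤ} {l : ℕ} (n : ℕ) (c : Composition l) (k : Fin l → K) (x : ℤ) :
    Stays n c.blocks (extSteps k) x ↔
      ∀ j < c.length, |x - partSum (fun t => (k t : ℤ)) (c.sizeUpTo (j + 1))| < n := by
  refine forall₂_congr fun j _ => ?_
  rw [← stepSum_extSteps k (c.sizeUpTo_le (j + 1))]
  rfl

/-- The entry `0` of the maximum is the partial sum with index `j = 0`, so the maximum is attained
among integer partial sums with `j < c.length`. -/
theorem exists_maxPartialSum {l : ℕ} (hl : 0 < l) (c : Composition l) (k : Fin l → ℤ) :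
    ∃ p : ℤ, maxPartialSum c (fun i => (k i : ℝ)) = p ∧
      (∀ j < c.length, partSum k (c.sizeUpTo j) ≤ p) ∧
      ∃ j < c.length, partSum k (c.sizeUpTo j) = p := by
  have hc : 0 < c.length := c.length_pos_of_pos hl
  have hcast : ∀ i : ℕ, ∑ t : Fin l with t.val < i, (k t : ℝ) = (partSum k i : ℝ) := fun i => by
    rw [partSum]; push_cast; rfl
  have h0 : partSum k (c.sizeUpTo 0) = 0 := by rw [c.sizeUpTo_zero, partSum_zero]
  set s := (insert 0 ((Finset.Ico 1 c.length).image
    fun j => ∑ i : Fin l with i.val < c.sizeUpTo j, (k i : ℝ))) with hs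
  have hmax : maxPartialSum c (fun i => (k i : ℝ)) = s.max' (Finset.insert_nonempty _ _) := rfl
  have hmem := s.max'_mem (Finset.insert_nonempty _ _)
  have hex : ∃ j < c.length, maxPartialSum c (fun i => (k i : ℝ)) =
      (partSum k (c.sizeUpTo j) : ℝ) := by
    rw [hmax]
    rcases Finset.mem_insert.1 hmem with h | h
    · exact ⟨0, hc, by rw [h, h0, Int.cast_zero]⟩
    · obtain ⟨j, hj, h⟩ := Finset.mem_image.1 h
      exact ⟨j, (Finset.mem_Ico.1 hj).2, by rw [← h, hcast]⟩
  obtain ⟨j, hj, h⟩ := hex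
  refine ⟨partSum k (c.sizeUpTo j), h, fun i hi => ?_, j, hj, rfl⟩
  rw [← Int.cast_le (R := ℝ), ← h, hmax]
  refine Finset.le_max' _ _ ?_
  rcases Nat.eq_zero_or_pos i with rfl | hi0
  · rw [h0, Int.cast_zero]
    exact Finset.mem_insert_self _ _
  · exact Finset.mem_insert_of_mem (Finset.mem_image.2 ⟨i, Finset.mem_Ico.2 ⟨hi0, hi⟩, hcast _⟩)

theorem partSum_le {l : ℕ} (k : Fin l → ℤ) (i : ℕ) : partSum k i ≤ ∑ t, max (k t) 0 := by
  rw [partSum, Finset.sum_filter]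
  refine Finset.sum_le_sum fun t _ => ?_
  split_ifs
  · exact le_max_left _ _
  · exact le_max_right _ _

theorem partSum_neg {l : ℕ} (k : Fin l → ℤ) (i : ℕ) : partSum (fun t => -k t) i = -partSum k i := by
  simp [partSum]

/-- A closed path ends where it starts, so the positions to control are those with `0 ≤ j <
c.length`. Their extremes are `x - p` and `x + q`. -/
theorem card_stays {K : Finset ℤ} {l : ℕ} (hl : 0 < l) (n : ℕ) (c : Composition l)
    (k : Fin l → K) (hk : ∑ i, (k i : ℤ) = 0) {p q : ℤ}
    (hp1 : ∀ j < c.length, partSum (fun t => (k t : ℤ)) (c.sizeUpTo j) ≤ p)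
    (hp2 : ∃ j < c.length, partSum (fun t => (k t : ℤ)) (c.sizeUpTo j) = p)
    (hq1 : ∀ j < c.length, -partSum (fun t => (k t : ℤ)) (c.sizeUpTo j) ≤ q)
    (hq2 : ∃ j < c.length, -partSum (fun t => (k t : ℤ)) (c.sizeUpTo j) = q) (x : ℤ) :
    (x ∈ Finset.Ioo (-(n : ℤ)) n ∧ Stays n c.blocks (extSteps k) x) ↔
      x ∈ Finset.Ioo (-(n : ℤ) + p) (n - q) := by
  have hc : 0 < c.length := c.length_pos_of_pos hl
  have h0 : partSum (fun t => (k t : ℤ)) (c.sizeUpTo 0) = 0 := by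
    rw [c.sizeUpTo_zero, partSum_zero]
  have hm : partSum (fun t => (k t : ℤ)) (c.sizeUpTo c.length) = 0 := by
    rw [c.sizeUpTo_length, partSum_self, hk]
  rw [stays_iff, Finset.mem_Ioo, Finset.mem_Ioo]
  constructor
  · rintro ⟨hx, h⟩
    have h' : ∀ j < c.length, |x - partSum (fun t => (k t : ℤ)) (c.sizeUpTo j)| < n := by
      intro j hj
      rcases Nat.eq_zero_or_pos j with rfl | hj0
      · rw [h0, sub_zero, abs_lt]; exact hx
      · have := h (j - 1) (by omega)
        rwa [Nat.sub_add_cancel hj0] at this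
    obtain ⟨j, hj, hjp⟩ := hp2
    obtain ⟨i, hi, hiq⟩ := hq2
    have h1 := abs_lt.1 (h' j hj)
    have h2 := abs_lt.1 (h' i hi)
    constructor <;> omega
  · intro hx
    have hp0 := hp1 0 hc
    have hq0 := hq1 0 hc
    rw [h0] at hp0 hq0
    refine ⟨⟨by omega, by omega⟩, fun j hj => ?_⟩
    rcases Nat.lt_or_ge (j + 1) c.length with h | h
    · have h1 := hp1 _ h
      have h2 := hq1 _ h
      rw [abs_lt]
      constructor <;> omega
    · have : j + 1 = c.length := by omega
      rw [this, hm, abs_lt]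
      constructor <;> omega

-- The number of starting points is `2n - 1 - (p + q)` truncated at zero, and `p + q ≤ ∑ |k i|`. If
-- `∑ |k i| ≤ n`, there is no truncation because `n ≤ 2n - 1`.
open Classical in
theorem abs_count_loops_sub_le {K : Finset ℤ} {l : ℕ} (hl : 0 < l) {n : ℕ} (hn : 1 ≤ n)
    (c : Composition l) (k : Fin l → K) (hk : ∑ i, (k i : ℤ) = 0) :
    |∑ x : Window n, (if Stays n c.blocks (extSteps k) x then (1 : ℝ) else 0) -
      (2 * n - 1 - (maxPartialSum c (fun i => ((k i : ℤ) : ℝ)) +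
        maxPartialSum c (fun i => -((k i : ℤ) : ℝ))))| ≤
      if (n : ℤ) < ∑ i, |(k i : ℤ)| then ((∑ i, |(k i : ℤ)| : ℤ) : ℝ) else 0 := by
  obtain ⟨p, hp, hp1, hp2⟩ := exists_maxPartialSum hl c (fun i => (k i : ℤ))
  obtain ⟨q, hq, hq1, hq2⟩ := exists_maxPartialSum hl c (fun i => -(k i : ℤ))
  simp only [Int.cast_neg] at hq
  simp only [partSum_neg] at hq1 hq2
  have hcount : ∑ x : Window n, (if Stays n c.blocks (extSteps k) x then (1 : ℝ) else 0) =
      ((n - q - (-(n : ℤ) + p) - 1).toNat : ℝ) := by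
    rw [Finset.sum_coe_sort (Finset.Ioo (-(n : ℤ)) n)
      (fun x => if Stays n c.blocks (extSteps k) x then (1 : ℝ) else 0), ← Finset.sum_filter,
      Finset.sum_const, nsmul_eq_mul, mul_one, ← Int.card_Ioo]
    congr 2
    ext x
    rw [Finset.mem_filter]
    exact card_stays hl n c k hk hp1 hp2 hq1 hq2 x
  have hpq : p + q ≤ ∑ i, |(k i : ℤ)| := by
    obtain ⟨j, -, hj⟩ := hp2
    obtain ⟨i, -, hi⟩ := hq2
    have h1 := partSum_le (fun i => (k i : ℤ)) (c.sizeUpTo j)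
    have h2 := partSum_le (fun i => -(k i : ℤ)) (c.sizeUpTo i)
    rw [partSum_neg] at h2
    have h3 : ∑ i, |(k i : ℤ)| = ∑ t, max (k t : ℤ) 0 + ∑ t, max (-(k t : ℤ)) 0 := by
      rw [← Finset.sum_add_distrib]
      refine Finset.sum_congr rfl fun t _ => ?_
      rcases abs_cases (k t : ℤ) with ⟨h, h'⟩ | ⟨h, h'⟩ <;> omega
    omega
  rw [hcount, hp, hq]
  have h4 : ((n : ℝ) : ℝ) = ((n : ℤ) : ℝ) := by simp
  have h5 : (((n - q - (-(n : ℤ) + p) - 1).toNat : ℕ) : ℝ) =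
      (((n - q - (-(n : ℤ) + p) - 1).toNat : ℤ) : ℝ) := by simp
  rw [h4, h5]
  have hn' : (1 : ℤ) ≤ n := by exact_mod_cast hn
  clear h4 h5 hcount
  generalize (n : ℤ) = N at hn' ⊢
  split_ifs with h
  · norm_cast
    rw [abs_le]
    constructor <;> omega
  · norm_cast
    rw [abs_le]
    constructor <;> omega

theorem abs_two_mul_partSum_sub_le {l : ℕ} (k : Fin l → ℤ) (i : ℕ) :
    |∑ t, k t - 2 * partSum k i| ≤ ∑ t, |k t| := by
  rw [partSum, Finset.sum_filter, Finset.mul_sum, ← Finset.sum_sub_distrib]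
  refine (Finset.abs_sum_le_sum_abs _ _).trans (Finset.sum_le_sum fun t _ => ?_)
  split_ifs
  · rw [show k t - 2 * k t = -k t by ring, abs_neg]
  · simp

-- The start can only be half the sum `S` of the steps. If `∑ |k i| ≤ n` and `S` is even, every
-- position has modulus at most `n / 2` by `abs_two_mul_partSum_sub_le`, so the path does stay in
-- the window.
open Classical in
theorem abs_count_antiloops_sub_le {K : Finset ℤ} {l : ℕ} {n : ℕ} (hn : 1 ≤ n)
    (c : Composition l) (k : Fin l → K) :
    |∑ x : Window n, (if Stays n c.blocks (extSteps k) x ∧ (x : ℤ) - ∑ i, (k i : ℤ) = -x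
        then (1 : ℝ) else 0) - (if Even (∑ i, (k i : ℤ)) then 1 else 0)| ≤
      if (n : ℤ) < ∑ i, |(k i : ℤ)| then 1 else 0 := by
  have hn' : (1 : ℤ) ≤ n := by exact_mod_cast hn
  set S := ∑ i, (k i : ℤ) with hS
  rw [Finset.sum_coe_sort (Finset.Ioo (-(n : ℤ)) n)
      (fun x => if Stays n c.blocks (extSteps k) x ∧ x - S = -x then (1 : ℝ) else 0)]
  by_cases hE : Even S
  · obtain ⟨y, hy⟩ := hE
    have h1 : ∑ x ∈ Finset.Ioo (-(n : ℤ)) n,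
        (if Stays n c.blocks (extSteps k) x ∧ x - S = -x then (1 : ℝ) else 0) =
        if y ∈ Finset.Ioo (-(n : ℤ)) n ∧ Stays n c.blocks (extSteps k) y then 1 else 0 := by
      by_cases hyI : y ∈ Finset.Ioo (-(n : ℤ)) n
      · rw [Finset.sum_eq_single_of_mem y hyI]
        · have : y - S = -y := by omega
          simp only [this, hyI, and_true, true_and]
        · intro b _ hb
          rw [if_neg]
          rintro ⟨-, h⟩
          omega
      · rw [Finset.sum_eq_zero, if_neg fun h => hyI h.1]
        intro x hx
        rw [if_neg]
        rintro ⟨-, h⟩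
        have : x = y := by omega
        exact hyI (this ▸ hx)
    rw [h1, if_pos (show Even S from ⟨y, hy⟩)]
    split_ifs with h2 h3 h3
    · simp
    · simp
    · simp
    · exfalso
      apply h2
      have h4 := fun i => abs_two_mul_partSum_sub_le (fun t => (k t : ℤ)) i
      constructor
      · have := h4 0
        rw [partSum_zero, ← hS, hy, abs_le] at this
        rw [Finset.mem_Ioo]
        constructor <;> omega
      · rw [stays_iff]
        intro j _
        have := h4 (c.sizeUpTo (j + 1))
        rw [← hS, hy, abs_le] at this
        rw [abs_lt]
        constructor <;> omega
  · rw [if_neg hE, Finset.sum_eq_zero]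
    · split_ifs <;> simp
    · intro x _
      rw [if_neg]
      rintro ⟨-, h⟩
      exact hE ⟨x, by omega⟩

end Counting

section Comparison

open Laurent

open Classical in
theorem trace_blocks (n : ℕ) (K : Finset ℤ) (c : ℤ → ℝ)
    (hF : ∀ (j : ℕ) (k : ℤ), (laurentOf K c ^ j).coeff (-k) = (laurentOf K c ^ j).coeff k)
    {l : ℕ} (C : Composition l) :
    (C.blocks.map fun j => cosMat n (laurentOf K c ^ j)).prod.trace =
      (∑ k : Fin l → K, (∏ i, c (k i)) *
        ((if ∑ i, (k i : ℤ) = 0 then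
          ∑ x : Window n, (if Stays n C.blocks (extSteps k) x then (1 : ℝ) else 0) else 0) +
        ∑ x : Window n, (if Stays n C.blocks (extSteps k) x ∧ (x : ℤ) - ∑ i, (k i : ℤ) = -x
          then (1 : ℝ) else 0))) / 2 := by
  have h := trace_prod_cosMat (n := n) (C.blocks.map fun j => laurentOf K c ^ j) (by
    intro F hFm k
    obtain ⟨j, -, rfl⟩ := List.mem_map.1 hFm
    exact hF j k)
  rw [List.map_map] at h
  refine Eq.trans h ?_
  simp only [prod_toep_apply n K c C.blocks l C.blocks_sum]
  congr 1
  rw [Finset.sum_comm, Finset.sum_comm (s := (Finset.univ : Finset (Window n))),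
    ← Finset.sum_add_distrib]
  refine Finset.sum_congr rfl fun k _ => ?_
  rw [← Finset.mul_sum, ← Finset.mul_sum, ← mul_add]
  congr 2
  split_ifs with h0
  · simp [h0]
  · refine Finset.sum_eq_zero fun x _ => if_neg ?_
    rintro ⟨-, hx⟩
    exact h0 (by omega)

theorem sum_comp_perm {K : Finset ℤ} {l : ℕ} (σ : Equiv.Perm (Fin l)) (g : (Fin l → K) → ℝ) :
    ∑ k : Fin l → K, g (fun i => k (σ i)) = ∑ k : Fin l → K, g k :=
  Fintype.sum_equiv (Equiv.arrowCongr σ.symm (Equiv.refl K)) _ _ fun k => by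
    congr 1

/-- The summation over `k` is symmetric, so the sum over permutations in `G` only contributes `l!`.
The scalar `s` is there for the two signs `±1`. -/
theorem sum_mul_G {K : Finset ℤ} (c : ℤ → ℝ) {l : ℕ} (s : ℝ) :
    ∑ k : Fin l → K, (∏ i, c (k i)) * (if ∑ i, (k i : ℤ) = 0 then
        G (fun i => s * ((k i : ℤ) : ℝ)) else 0) =
      l.factorial * ∑ k : Fin l → K, (∏ i, c (k i)) * (if ∑ i, (k i : ℤ) = 0 then
        ∑ C : Composition l, compWeight C * maxPartialSum C (fun i => s * ((k i : ℤ) : ℝ))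
          else 0) := by
  set g : (Fin l → K) → ℝ := fun k => (∏ i, c (k i)) * (if ∑ i, (k i : ℤ) = 0 then
        ∑ C : Composition l, compWeight C * maxPartialSum C (fun i => s * ((k i : ℤ) : ℝ))
          else 0) with hg
  have h1 : ∀ k : Fin l → K, (∏ i, c (k i)) * (if ∑ i, (k i : ℤ) = 0 then
        G (fun i => s * ((k i : ℤ) : ℝ)) else 0) = ∑ σ : Equiv.Perm (Fin l),
          g (fun i => k (σ i)) := by
    intro k
    have h2 : ∀ σ : Equiv.Perm (Fin l), ∏ i, c (k (σ i)) = ∏ i, c (k i) := fun σ =>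
      Equiv.prod_comp σ fun i => c (k i)
    have h3 : ∀ σ : Equiv.Perm (Fin l), ∑ i, (k (σ i) : ℤ) = ∑ i, (k i : ℤ) := fun σ =>
      Equiv.sum_comp σ fun i => (k i : ℤ)
    simp only [hg, h2, h3]
    rw [← Finset.mul_sum]
    congr 1
    split_ifs
    · rfl
    · simp
  simp only [h1]
  rw [Finset.sum_comm]
  simp only [sum_comp_perm]
  rw [Finset.sum_const, Finset.card_univ, Fintype.card_perm, Fintype.card_fin, nsmul_eq_mul]

/-- The error weight of a vector `k`. -/
def errWeight (n : ℕ) {l : ℕ} (k : Fin l → ℤ) : ℝ :=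
  if (n : ℤ) < ∑ i, |k i| then
    (if ∑ i, k i = 0 then ((∑ i, |k i| : ℤ) : ℝ) else 0) + 1 else 0

theorem abs_trace_cumulant_sub_le {n : ℕ} (hn : 1 ≤ n) (K : Finset ℤ) (c : ℤ → ℝ)
    (hF : ∀ (j : ℕ) (k : ℤ), (laurentOf K c ^ j).coeff (-k) = (laurentOf K c ^ j).coeff k)
    {l : ℕ} (hl : 2 ≤ l) :
    |-(l.factorial : ℝ) * ∑ C : Composition l, compWeight C *
        (C.blocks.map fun j => cosMat n (laurentOf K c ^ j)).prod.trace -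
      ∑ k : Fin l → K, (∏ i, c (k i)) * (if ∑ i, (k i : ℤ) = 0 then
        1 / 2 * (G (fun i => ((k i : ℤ) : ℝ)) + G (fun i => -((k i : ℤ) : ℝ))) else 0)| ≤
      (l.factorial : ℝ) / 2 * (∑ C : Composition l, |compWeight C|) *
        ∑ k : Fin l → K, (∏ i, |c (k i)|) * errWeight n (fun i => (k i : ℤ)) := by
  classical
  set D : Composition l → (Fin l → K) → ℝ := fun C k =>
    ((if ∑ i, (k i : ℤ) = 0 then
          ∑ x : Window n, (if Stays n C.blocks (extSteps k) x then (1 : ℝ) else 0) else 0) +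
        ∑ x : Window n, (if Stays n C.blocks (extSteps k) x ∧ (x : ℤ) - ∑ i, (k i : ℤ) = -x
          then (1 : ℝ) else 0)) with hD
  -- `Z` does not depend on the composition and is removed by `sum_compWeight`; `Y` produces the
  -- main term.
  set Z : (Fin l → K) → ℝ := fun k => (if ∑ i, (k i : ℤ) = 0 then 2 * (n : ℝ) - 1 else 0) +
    (if Even (∑ i, (k i : ℤ)) then 1 else 0) with hZ
  set Y : Composition l → (Fin l → K) → ℝ := fun C k => if ∑ i, (k i : ℤ) = 0 then
      maxPartialSum C (fun i => ((k i : ℤ) : ℝ)) + maxPartialSum C (fun i => -((k i : ℤ) : ℝ))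
      else 0 with hY
  have hbound : ∀ C k, |D C k - (Z k - Y C k)| ≤ errWeight n (fun i => (k i : ℤ)) := by
    intro C k
    have h2 := abs_count_antiloops_sub_le hn C k
    by_cases h0 : ∑ i, (k i : ℤ) = 0
    · have h1 := abs_count_loops_sub_le (by omega) hn C k h0
      have h3 := abs_add_le _ _ |>.trans (add_le_add h1 h2)
      simp only [hD, hZ, hY, errWeight, if_pos h0] at h3 ⊢
      refine le_trans (le_of_eq ?_) (h3.trans (le_of_eq ?_))
      · congr 1
        ring
      · split_ifs <;> simp
    · simp only [hD, hZ, hY, errWeight, if_neg h0] at h2 ⊢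
      simpa using h2
  have hmain : ∑ k : Fin l → K, (∏ i, c (k i)) * (if ∑ i, (k i : ℤ) = 0 then
        1 / 2 * (G (fun i => ((k i : ℤ) : ℝ)) + G (fun i => -((k i : ℤ) : ℝ))) else 0) =
      -(l.factorial : ℝ) / 2 * ∑ C : Composition l, compWeight C *
        ∑ k : Fin l → K, (∏ i, c (k i)) * (Z k - Y C k) := by
    have e1 := sum_mul_G (K := K) c (l := l) 1
    have e2 := sum_mul_G (K := K) c (l := l) (-1)
    simp only [one_mul, neg_mul] at e1 e2
    have e3 : ∑ k : Fin l → K, (∏ i, c (k i)) * (if ∑ i, (k i : ℤ) = 0 then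
        1 / 2 * (G (fun i => ((k i : ℤ) : ℝ)) + G (fun i => -((k i : ℤ) : ℝ))) else 0) =
        1 / 2 * (∑ k : Fin l → K, (∏ i, c (k i)) * (if ∑ i, (k i : ℤ) = 0 then
        G (fun i => ((k i : ℤ) : ℝ)) else 0) + ∑ k : Fin l → K, (∏ i, c (k i)) *
          (if ∑ i, (k i : ℤ) = 0 then G (fun i => -((k i : ℤ) : ℝ)) else 0)) := by
      rw [← Finset.sum_add_distrib, Finset.mul_sum]
      refine Finset.sum_congr rfl fun k _ => ?_
      split_ifs <;> ring
    have e4 : ∑ C : Composition l, compWeight C * ∑ k : Fin l → K, (∏ i, c (k i)) * (Z k - Y C k) =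
        -∑ C : Composition l, compWeight C * ∑ k : Fin l → K, (∏ i, c (k i)) * Y C k := by
      simp only [mul_sub, Finset.sum_sub_distrib]
      rw [← Finset.sum_mul, sum_compWeight hl, zero_mul, zero_sub]
    have e5 : ∑ C : Composition l, compWeight C * ∑ k : Fin l → K, (∏ i, c (k i)) * Y C k =
        ∑ k : Fin l → K, (∏ i, c (k i)) * (if ∑ i, (k i : ℤ) = 0 then
        ∑ C : Composition l, compWeight C * maxPartialSum C (fun i => ((k i : ℤ) : ℝ)) else 0) +
        ∑ k : Fin l → K, (∏ i, c (k i)) * (if ∑ i, (k i : ℤ) = 0 then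
        ∑ C : Composition l, compWeight C * maxPartialSum C (fun i => -((k i : ℤ) : ℝ)) else 0) := by
      simp only [Finset.mul_sum]
      rw [Finset.sum_comm, ← Finset.sum_add_distrib]
      refine Finset.sum_congr rfl fun k _ => ?_
      simp only [hY]
      split_ifs
      · rw [← mul_add, ← Finset.sum_add_distrib, Finset.mul_sum]
        exact Finset.sum_congr rfl fun C _ => by ring
      · simp
    rw [e3, e1, e2, e4, e5]
    ring
  have htr : ∀ C : Composition l,
      (C.blocks.map fun j => cosMat n (laurentOf K c ^ j)).prod.trace =
        (∑ k : Fin l → K, (∏ i, c (k i)) * D C k) / 2 := fun C => trace_blocks n K c hF C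
  have hdiff : -(l.factorial : ℝ) * ∑ C : Composition l, compWeight C *
        (C.blocks.map fun j => cosMat n (laurentOf K c ^ j)).prod.trace -
      ∑ k : Fin l → K, (∏ i, c (k i)) * (if ∑ i, (k i : ℤ) = 0 then
        1 / 2 * (G (fun i => ((k i : ℤ) : ℝ)) + G (fun i => -((k i : ℤ) : ℝ))) else 0) =
      -((l.factorial : ℝ) / 2) * ∑ C : Composition l, compWeight C *
        ∑ k : Fin l → K, (∏ i, c (k i)) * (D C k - (Z k - Y C k)) := by
    rw [hmain]
    simp only [htr, Finset.mul_sum, Finset.sum_div, ← Finset.sum_sub_distrib]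
    refine Finset.sum_congr rfl fun C _ => Finset.sum_congr rfl fun k _ => ?_
    ring
  rw [hdiff, abs_mul, abs_neg, abs_of_nonneg (by positivity : (0 : ℝ) ≤ l.factorial / 2), mul_assoc]
  refine mul_le_mul_of_nonneg_left ?_ (by positivity)
  rw [Finset.sum_mul]
  refine (Finset.abs_sum_le_sum_abs _ _).trans (Finset.sum_le_sum fun C _ => ?_)
  rw [abs_mul]
  refine mul_le_mul_of_nonneg_left ?_ (abs_nonneg _)
  refine (Finset.abs_sum_le_sum_abs _ _).trans (Finset.sum_le_sum fun k _ => ?_)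
  rw [abs_mul, Finset.abs_prod]
  exact mul_le_mul_of_nonneg_left (hbound C k) (Finset.prod_nonneg fun i _ => abs_nonneg _)

end Comparison

end SOCumulants

end

noncomputable section

namespace SOCumulants

/-! ### Cumulants of bounded random variables -/

section Cumulants

open ProbabilityTheory Filter Topology

variable {Ω : Type*} [MeasurableSpace Ω] {μ : Measure Ω} [IsProbabilityMeasure μ]

/-- Leibniz' rule at `0` for `mgf' = mgf · cgf'`, valid since the moment generating function of a
bounded variable is analytic everywhere. -/
theorem moment_recursion {X : Ω → ℝ} (hX : AEMeasurable X μ) {B : ℝ} (hB : ∀ ω, |X ω| ≤ B) (l : ℕ) :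
    ∫ ω, X ω ^ (l + 1) ∂μ = ∑ p ∈ Finset.HasAntidiagonal.antidiagonal l,
      (l.choose p.1 : ℝ) * ((∫ ω, X ω ^ p.1 ∂μ) * cumulant X μ (p.2 + 1)) := by
  have hint : ∀ t : ℝ, Integrable (fun ω => Real.exp (t * X ω)) μ := fun t =>
    integrable_exp_mul_of_mem_Icc hX (Eventually.of_forall fun ω => abs_le.1 (hB ω))
  have huniv : integrableExpSet X μ = Set.univ := Set.eq_univ_of_forall hint
  have hmem : ∀ t : ℝ, t ∈ interior (integrableExpSet X μ) := fun t => by simp [huniv]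
  have hmgf : ∀ d, iteratedDeriv d (mgf X μ) 0 = ∫ ω, X ω ^ d ∂μ := fun d => by
    rw [iteratedDeriv_mgf_zero (hmem 0)]
    rfl
  have hder : deriv (mgf X μ) = mgf X μ * deriv (cgf X μ) := by
    funext t
    have hpos : mgf X μ t ≠ 0 := (mgf_pos (hint t)).ne'
    rw [Pi.mul_apply, deriv_mgf (hmem t), deriv_cgf (hmem t), ← mul_div_assoc, mul_div_cancel_left₀ _ hpos]
  rw [← hmgf, iteratedDeriv_succ', hder, iteratedDeriv_mul
    (analyticAt_mgf (hmem 0)).contDiffAt (analyticAt_cgf (hmem 0)).deriv.contDiffAt,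
    Finset.Nat.sum_antidiagonal_eq_sum_range_succ_mk]
  refine Finset.sum_congr rfl fun i _ => ?_
  rw [hmgf, cumulant, iteratedDeriv_succ', mul_assoc]

/-- Convergence of moments implies convergence of the solutions of the moment-cumulant
recursion. -/
theorem tendsto_of_recursion {m κ : ℕ → ℕ → ℝ} {m₀ κ₀ : ℕ → ℝ} (h1 : ∀ N, m N 0 = 1)
    (h1' : m₀ 0 = 1)
    (hκ : ∀ N l, m N (l + 1) = ∑ p ∈ Finset.HasAntidiagonal.antidiagonal l,
      (l.choose p.1 : ℝ) * (m N p.1 * κ N (p.2 + 1)))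
    (hκ₀ : ∀ l, m₀ (l + 1) = ∑ p ∈ Finset.HasAntidiagonal.antidiagonal l,
      (l.choose p.1 : ℝ) * (m₀ p.1 * κ₀ (p.2 + 1)))
    (hm : ∀ d, Tendsto (fun N => m N d) atTop (𝓝 (m₀ d))) (l : ℕ) :
    Tendsto (fun N => κ N (l + 1)) atTop (𝓝 (κ₀ (l + 1))) := by
  induction l using Nat.strong_induction_on with
  | _ l ih =>
    have key : ∀ (m κ : ℕ → ℝ), m 0 = 1 → (m (l + 1) = ∑ p ∈ Finset.HasAntidiagonal.antidiagonal l,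
        (l.choose p.1 : ℝ) * (m p.1 * κ (p.2 + 1))) → κ (l + 1) = m (l + 1) -
        ∑ p ∈ (Finset.HasAntidiagonal.antidiagonal l).erase (0, l),
          (l.choose p.1 : ℝ) * (m p.1 * κ (p.2 + 1)) := by
      intro m κ h1 h
      rw [h, ← Finset.add_sum_erase _ _
        (Finset.HasAntidiagonal.mem_antidiagonal.2 (by simp) : (0, l) ∈ _)]
      simp [h1]
    rw [key m₀ κ₀ h1' (hκ₀ l)]
    simp only [fun N => key (m N) (κ N) (h1 N) (hκ N l)]
    refine (hm _).sub (tendsto_finsetSum _ fun p hp => ?_)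
    obtain ⟨hne, hp⟩ := Finset.mem_erase.1 hp
    have hp' := Finset.HasAntidiagonal.mem_antidiagonal.1 hp
    have hlt : p.2 < l := by
      rcases Nat.lt_or_ge p.2 l with h | h
      · exact h
      · exact absurd (Prod.ext (by simp; omega) (by simp; omega)) hne
    exact ((hm _).mul (ih p.2 hlt)).const_mul _

theorem tendsto_cumulant {X : ℕ → Ω → ℝ} {Y : Ω → ℝ} (hX : ∀ N, AEMeasurable (X N) μ) {B : ℝ}
    (hB : ∀ N ω, |X N ω| ≤ B) (hlim : ∀ ω, Tendsto (fun N => X N ω) atTop (𝓝 (Y ω))) {l : ℕ}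
    (hl : 1 ≤ l) : Tendsto (fun N => cumulant (X N) μ l) atTop (𝓝 (cumulant Y μ l)) := by
  obtain ⟨l, rfl⟩ := Nat.exists_eq_add_of_le' hl
  have hY : AEMeasurable Y μ := aemeasurable_of_tendsto_metrizable_ae' hX (Eventually.of_forall hlim)
  have hYB : ∀ ω, |Y ω| ≤ B := fun ω => le_of_tendsto (hlim ω).abs (Eventually.of_forall fun N => hB N ω)
  refine tendsto_of_recursion (m := fun N d => ∫ ω, X N ω ^ d ∂μ) (m₀ := fun d => ∫ ω, Y ω ^ d ∂μ)
    (κ := fun N l => cumulant (X N) μ l) (κ₀ := fun l => cumulant Y μ l) (by simp) (by simp)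
    (fun N l => moment_recursion (hX N) (hB N) l) (fun l => moment_recursion hY hYB l)
    (fun d => ?_) l
  refine tendsto_integral_of_dominated_convergence (fun _ => B ^ d)
    (fun N => ((hX N).pow_const d).aestronglyMeasurable) (integrable_const _)
    (fun N => Eventually.of_forall fun ω => ?_) (Eventually.of_forall fun ω => (hlim ω).pow d)
  rw [norm_pow, Real.norm_eq_abs]
  exact pow_le_pow_left₀ (abs_nonneg _) (hB N ω) d

end Cumulants

/-! ### Cumulants of trigonometric polynomials -/

section TrigPoly

open Laurent

/-- The trigonometric polynomial with cosine coefficients `c` on `K`. -/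
def trigPoly (K : Finset ℤ) (c : ℤ → ℝ) (x : ℝ) : ℝ := ∑ k ∈ K, c k * Real.cos (k * x)

/-- The linear statistic of `trigPoly K c` as a polynomial in traces of powers. -/
def tracePoly (K : Finset ℤ) (c : ℤ → ℝ) : MvPolynomial ℕ ℝ :=
  ∑ k ∈ K, (c k / 2) • MvPolynomial.X k.natAbs

theorem linStat_trigPoly (n : ℕ) (K : Finset ℤ) (c : ℤ → ℝ) (M : SO (2 * n)) :
    linStat n (trigPoly K c) M = evTr M.1 (tracePoly K c) := by
  have h := evAngle_evP M (tracePoly K c)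
  rw [tracePoly, map_sum, map_sum] at h
  rw [← Complex.ofReal_inj, tracePoly, ← h, linStat]
  simp only [map_smul, evP_natAbs, p, map_sum, evAngle_c, trigPoly]
  push_cast
  rw [Finset.sum_comm]
  refine Finset.sum_congr rfl fun k _ => ?_
  rw [← Finset.mul_sum, ← Finset.mul_sum, Algebra.smul_def, Complex.coe_algebraMap]
  push_cast
  ring

theorem coeff_laurentOf {K : Finset ℤ} (c : ℤ → ℝ) (k : ℤ) :
    (laurentOf K c).coeff k = if k ∈ K then c k else 0 := by
  rw [laurentOf, Finset.sum_coe_sort K fun x => AddMonoidAlgebra.single (x : ℤ) (c x),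
    AddMonoidAlgebra.coeff_sum, Finset.sum_apply']
  simp only [AddMonoidAlgebra.coeff_single, Finsupp.single_apply]
  rw [Finset.sum_ite_eq']

theorem evP_tracePoly (n : ℕ) {K : Finset ℤ} {c : ℤ → ℝ} (hK : ∀ k, -k ∈ K ↔ k ∈ K)
    (hc : ∀ k, c (-k) = c k) : evP n (tracePoly K c) = ∑ j, ofVar j (laurentOf K c) := by
  -- Averaging over `k` and `-k` turns `z_j ^ k` into half of `c_j(k)`, which explains the
  -- coefficient `c k / 2` in `tracePoly`.
  have h1 : ∑ k ∈ K, ∑ j : Fin n, c k • z j (-k) = ∑ k ∈ K, ∑ j : Fin n, c k • z j k :=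
    Finset.sum_bij' (fun k _ => -k) (fun k _ => -k) (fun k hk => (hK k).2 hk)
      (fun k hk => (hK k).2 hk) (fun k _ => neg_neg k) (fun k _ => neg_neg k)
      (fun k _ => by rw [hc])
  have h2 : ∑ j, ofVar j (laurentOf K c) = ∑ k ∈ K, ∑ j : Fin n, c k • z j k := by
    rw [Finset.sum_comm]
    refine Finset.sum_congr rfl fun j _ => ?_
    rw [laurentOf, Finset.sum_coe_sort K fun x => AddMonoidAlgebra.single (x : ℤ) (c x), map_sum]
    refine Finset.sum_congr rfl fun k _ => ?_
    rw [ofVar_single, z, AddMonoidAlgebra.smul_single, smul_eq_mul, mul_one]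
  rw [h2, tracePoly, map_sum]
  have h3 : ∑ k ∈ K, ∑ j : Fin n, c k • z j k = (1 / 2 : ℝ) • (∑ k ∈ K, ∑ j : Fin n, c k • z j k +
      ∑ k ∈ K, ∑ j : Fin n, c k • z j (-k)) := by
    rw [h1, ← two_smul ℝ, smul_smul]
    norm_num
  rw [h3, ← Finset.sum_add_distrib, Finset.smul_sum]
  refine Finset.sum_congr rfl fun k _ => ?_
  rw [map_smul, evP_natAbs, p, ← Finset.sum_add_distrib, Finset.smul_sum, Finset.smul_sum]
  refine Finset.sum_congr rfl fun j _ => ?_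
  rw [Laurent.c, ← smul_add, smul_smul]
  congr 1
  ring

theorem cumulantSO_trigPoly {n : ℕ} {K : Finset ℤ} {c : ℤ → ℝ} (hK : ∀ k, -k ∈ K ↔ k ∈ K)
    (hc : ∀ k, c (-k) = c k) {l : ℕ} (hl : 1 ≤ l) :
    cumulantSO l n (trigPoly K c) = -(l.factorial : ℝ) * ∑ C : Composition l, compWeight C *
        (C.blocks.map fun j => cosMat n (laurentOf K c ^ j)).prod.trace := by
  have hX : linStat n (trigPoly K c) = fun M : SO (2 * n) => evTr M.1 (tracePoly K c) :=
    funext (linStat_trigPoly n K c)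
  have hcont : Continuous (linStat n (trigPoly K c)) := by
    rw [hX]
    exact continuous_evTr _
  obtain ⟨B, hB⟩ := isCompact_univ.exists_bound_of_continuousOn hcont.continuousOn
  have hF : ∀ k, (laurentOf K c).coeff (-k) = (laurentOf K c).coeff k := fun k => by
    simp only [coeff_laurentOf, hK, hc]
  have hV : ct (vand n ^ 2) ≠ 0 := ct_vand_sq_pos.ne'
  have hmom : ∀ d : ℕ, ct (vand n ^ 2 * (∑ j, ofVar j (laurentOf K c)) ^ d) =
      ct (vand n ^ 2) * ∫ M, linStat n (trigPoly K c) M ^ d ∂haarSO (2 * n) := by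
    intro d
    rw [← evP_tracePoly n hK hc, ← map_pow, ← integral_evTr, mul_comm]
    simp only [map_pow, hX]
  refine formal_cumulant (fun d => cosMat n (laurentOf K c ^ d)) (by simp only [pow_zero, cosMat_one])
    (fun d => ∫ M, linStat n (trigPoly K c) M ^ d ∂haarSO (2 * n))
    (fun l => cumulantSO l n (trigPoly K c)) ?_
    (fun l => moment_recursion hcont.aemeasurable (fun M => hB M (Set.mem_univ M)) l) hl
  have h := moment_series_eq_det (n := n) (laurentOf K c) hF
  have h2 : (PowerSeries.mk fun d => ct (vand n ^ 2 * (∑ j, ofVar j (laurentOf K c)) ^ d) /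
      (d.factorial : ℝ)) = PowerSeries.C (ct (vand n ^ 2)) * PowerSeries.mk fun d : ℕ =>
        (∫ M, linStat n (trigPoly K c) M ^ d ∂haarSO (2 * n)) / (d.factorial : ℝ) := by
    ext d
    rw [PowerSeries.coeff_C_mul, PowerSeries.coeff_mk, PowerSeries.coeff_mk, hmom, mul_div_assoc]
  rw [h2] at h
  exact mul_left_cancel₀ (by simpa using hV) h

theorem abs_cumulantSO_trigPoly_sub_le {n : ℕ} (hn : 1 ≤ n) {K : Finset ℤ} {c : ℤ → ℝ}
    (hK : ∀ k, -k ∈ K ↔ k ∈ K) (hc : ∀ k, c (-k) = c k) {l : ℕ} (hl : 2 ≤ l) :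
    |cumulantSO l n (trigPoly K c) -
      ∑ k : Fin l → K, (∏ i, c (k i)) * (if ∑ i, (k i : ℤ) = 0 then
        1 / 2 * (G (fun i => ((k i : ℤ) : ℝ)) + G (fun i => -((k i : ℤ) : ℝ))) else 0)| ≤
      (l.factorial : ℝ) / 2 * (∑ C : Composition l, |compWeight C|) *
        ∑ k : Fin l → K, (∏ i, |c (k i)|) * errWeight n (fun i => (k i : ℤ)) := by
  rw [cumulantSO_trigPoly hK hc (by omega)]
  refine abs_trace_cumulant_sub_le hn K c (fun j => coeff_neg_pow _ (fun k => ?_) j) hl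
  simp only [coeff_laurentOf, hK, hc]

end TrigPoly

end SOCumulants

end

noncomputable section

namespace SOCumulants

/-! ### Fourier series of even functions, continuously differentiable on `[0, π]` -/

section Fourier

open Filter Topology

theorem neg_pi_lt_pi : -Real.pi < Real.pi := by linarith [Real.pi_pos]

theorem fhat_eq_fourierCoeffOn (f : ℝ → ℝ) (k : ℤ) :
    fhat f k = fourierCoeffOn neg_pi_lt_pi (fun x => (f x : ℂ)) k := by
  have hpi : (Real.pi : ℂ) ≠ 0 := by exact_mod_cast Real.pi_ne_zero
  rw [fourierCoeffOn_eq_integral, fhat, Complex.real_smul]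
  congr 1
  · push_cast
    ring
  · refine intervalIntegral.integral_congr fun x _ => ?_
    simp only [fourier_coe_apply, smul_eq_mul]
    rw [mul_comm]
    congr 2
    push_cast
    field_simp
    ring

theorem fhat_neg {f : ℝ → ℝ} (hf : ∀ x, f (-x) = f x) (k : ℤ) : fhat f (-k) = fhat f k := by
  have h := intervalIntegral.integral_comp_neg (a := -Real.pi) (b := Real.pi)
    (fun x : ℝ => (f x : ℂ) * Complex.exp (-(k * x * Complex.I)))
  rw [neg_neg] at h
  rw [fhat, fhat, ← h]
  congr 1
  refine intervalIntegral.integral_congr fun x _ => ?_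
  simp only [hf]
  push_cast
  congr 2
  ring

theorem conj_fhat (f : ℝ → ℝ) (k : ℤ) : (starRingEnd ℂ) (fhat f k) = fhat f (-k) := by
  rw [fhat, fhat, map_mul, intervalIntegral.integral_of_le neg_pi_lt_pi.le,
    intervalIntegral.integral_of_le neg_pi_lt_pi.le, ← integral_conj]
  congr 1
  · simp [Complex.conj_ofNat]
  · refine integral_congr_ae (Eventually.of_forall fun x => ?_)
    simp only [map_mul, Complex.conj_ofReal, ← Complex.exp_conj]
    congr 2
    simp

/-- The Fourier coefficients of an even function are real. -/
theorem ofReal_re_fhat {f : ℝ → ℝ} (hf : ∀ x, f (-x) = f x) (k : ℤ) :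
    (((fhat f k).re : ℝ) : ℂ) = fhat f k :=
  Complex.conj_eq_iff_re.1 (by rw [conj_fhat, fhat_neg hf])

theorem continuousOn_of_even {f : ℝ → ℝ} (hf : ∀ x, f (-x) = f x)
    (hc : ContinuousOn f (Set.Icc 0 Real.pi)) : ContinuousOn f (Set.Icc (-Real.pi) Real.pi) := by
  have h : f = fun x => f |x| := by
    funext x
    rcases abs_choice x with h | h <;> rw [h]
    rw [hf]
  rw [h]
  exact hc.comp continuous_abs.continuousOn fun x hx => ⟨abs_nonneg x, abs_le.2 hx⟩

/-- An even function, continuously differentiable on `[0, π]`, has a bounded measurable right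
derivative on `(-π, π)`. -/
theorem exists_right_deriv {f : ℝ → ℝ} (hf : ∀ x, f (-x) = f x)
    (hc : ContDiffOn ℝ 1 f (Set.Icc 0 Real.pi)) :
    ∃ g : ℝ → ℝ, Measurable g ∧ (∃ B, ∀ x, |g x| ≤ B) ∧
      ∀ x ∈ Set.Ioo (-Real.pi) Real.pi, HasDerivWithinAt f (g x) (Set.Ioi x) x := by
  have hpi := Real.pi_pos
  set d := derivWithin f (Set.Icc 0 Real.pi) with hd
  have hdc : ContinuousOn d (Set.Icc 0 Real.pi) :=
    hc.continuousOn_derivWithin (uniqueDiffOn_Icc hpi) le_rfl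
  have hdd : ∀ x ∈ Set.Icc 0 Real.pi, HasDerivWithinAt f (d x) (Set.Icc 0 Real.pi) x := fun x hx =>
    (hc.differentiableOn one_ne_zero x hx).hasDerivWithinAt
  set D : ℝ → ℝ := fun x => d (Set.projIcc 0 Real.pi hpi.le x) with hD
  have hDc : Continuous D := hdc.comp_continuous
    (continuous_subtype_val.comp continuous_projIcc) fun x => (Set.projIcc 0 Real.pi hpi.le x).2
  have hDd : ∀ x ∈ Set.Icc 0 Real.pi, D x = d x := fun x hx => by
    simp only [hD, Set.projIcc_of_mem hpi.le hx]
  obtain ⟨B, hB⟩ := isCompact_Icc.exists_bound_of_continuousOn hdc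
  have hDB : ∀ x, |D x| ≤ B := fun x => hB _ (Set.projIcc 0 Real.pi hpi.le x).2
  refine ⟨fun x => if 0 ≤ x then D x else -D (-x),
    Measurable.ite measurableSet_Ici hDc.measurable (hDc.comp continuous_neg).neg.measurable,
    ⟨B, fun x => ?_⟩, fun x hx => ?_⟩
  · dsimp only
    split_ifs
    · exact hDB x
    · rw [abs_neg]
      exact hDB _
  · dsimp only
    by_cases h0 : 0 ≤ x
    · rw [if_pos h0, hDd x ⟨h0, hx.2.le⟩]
      refine (hdd x ⟨h0, hx.2.le⟩).mono_of_mem_nhdsWithin ?_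
      filter_upwards [Ioo_mem_nhdsGT hx.2] with y hy
      exact ⟨h0.trans hy.1.le, hy.2.le⟩
    · push Not at h0
      have hx' : -x ∈ Set.Icc 0 Real.pi := ⟨by linarith, by linarith [hx.1]⟩
      rw [if_neg (not_le.2 h0), hDd _ hx']
      have h1 : HasDerivAt f (d (-x)) (-x) := (hdd _ hx').hasDerivAt
        (Icc_mem_nhds (by linarith) (by linarith [hx.1]))
      have h2 : HasDerivAt (fun y => f (-y)) (d (-x) * -1) x := h1.comp x (hasDerivAt_neg x)
      simp only [hf, mul_neg, mul_one] at h2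
      exact h2.hasDerivWithinAt

/-- Parseval's identity for the bounded right derivative `g`: integration by parts identifies `k
f̂(k)` with `-i ĝ(k)`. -/
theorem summable_sq_mul_fhat {f : ℝ → ℝ} (hf : ∀ x, f (-x) = f x)
    (hc : ContDiffOn ℝ 1 f (Set.Icc 0 Real.pi)) :
    Summable fun k : ℤ => ((k : ℝ) * ‖fhat f k‖) ^ 2 := by
  obtain ⟨g, hg, ⟨B, hB⟩, hd⟩ := exists_right_deriv hf hc
  have hmeas : AEStronglyMeasurable (fun x => (g x : ℂ))
      (volume.restrict (Set.Ioc (-Real.pi) Real.pi)) :=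
    (Complex.measurable_ofReal.comp hg).aestronglyMeasurable
  have hL2 : MemLp (fun x => (g x : ℂ)) 2 (volume.restrict (Set.Ioc (-Real.pi) Real.pi)) :=
    MemLp.of_bound hmeas B (Eventually.of_forall fun x => by
      rw [Complex.norm_real]; exact hB x)
  have hint : IntervalIntegrable (fun x => (g x : ℂ)) volume (-Real.pi) Real.pi := by
    rw [intervalIntegrable_iff_integrableOn_Ioc_of_le neg_pi_lt_pi.le]
    exact hL2.integrable one_le_two
  have hsum := (hasSum_sq_fourierCoeffOn neg_pi_lt_pi hL2).summable
  refine Summable.of_nonneg_of_le (fun k => sq_nonneg _) (fun k => ?_) hsum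
  rcases eq_or_ne k 0 with rfl | hk
  · simp only [Int.cast_zero, zero_mul, ne_eq, OfNat.ofNat_ne_zero, not_false_eq_true, zero_pow]
    positivity
  have hfc : ContinuousOn (fun x => (f x : ℂ)) (Set.uIcc (-Real.pi) Real.pi) := by
    rw [Set.uIcc_of_le neg_pi_lt_pi.le]
    exact Complex.continuous_ofReal.comp_continuousOn (continuousOn_of_even hf hc.continuousOn)
  have h := fourierCoeffOn_of_hasDeriv_right neg_pi_lt_pi hk hfc (f' := fun x => (g x : ℂ))
    (fun x hx => by
      rw [min_eq_left neg_pi_lt_pi.le, max_eq_right neg_pi_lt_pi.le] at hx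
      exact (hd x hx).ofReal_comp) hint
  -- The boundary term vanishes because evenness gives `f (-π) = f π`.
  rw [← fhat_eq_fourierCoeffOn, hf, sub_self, mul_zero, zero_sub] at h
  have hpi : (Real.pi : ℂ) ≠ 0 := by exact_mod_cast Real.pi_ne_zero
  have hkC : (k : ℂ) ≠ 0 := by exact_mod_cast hk
  have h2 : (k : ℂ) * fhat f k =
      -Complex.I * fourierCoeffOn neg_pi_lt_pi (fun x => (g x : ℂ)) k := by
    rw [h]
    push_cast
    field_simp
    rw [Complex.I_sq]
    ring
  have h3 := congrArg norm h2
  rw [norm_mul, norm_mul, norm_neg, Complex.norm_I, one_mul, Complex.norm_intCast] at h3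
  rw [← h3, mul_pow, mul_pow, sq_abs]

theorem exists_bound_mul_fhat {f : ℝ → ℝ} (hf : ∀ x, f (-x) = f x)
    (hc : ContDiffOn ℝ 1 f (Set.Icc 0 Real.pi)) : ∃ B, ∀ k : ℤ, |(k : ℝ)| * ‖fhat f k‖ ≤ B := by
  have h := summable_sq_mul_fhat hf hc
  refine ⟨∑' k : ℤ, ((k : ℝ) * ‖fhat f k‖) ^ 2 + 1, fun k => ?_⟩
  have h1 := h.le_tsum k fun j _ => sq_nonneg _
  have h2 : (|(k : ℝ)| * ‖fhat f k‖) ^ 2 = ((k : ℝ) * ‖fhat f k‖) ^ 2 := by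
    rw [mul_pow, mul_pow, sq_abs]
  nlinarith [sq_nonneg (|(k : ℝ)| * ‖fhat f k‖ - 1)]

/-- For `k ≠ 0`, `‖f̂(k)‖` is the product of `k ‖f̂(k)‖` and `1 / k`, both square summable; the
index `0` gets its own summand. -/
theorem summable_norm_fhat {f : ℝ → ℝ} (hf : ∀ x, f (-x) = f x)
    (hc : ContDiffOn ℝ 1 f (Set.Icc 0 Real.pi)) : Summable fun k : ℤ => ‖fhat f k‖ := by
  have h1 := summable_sq_mul_fhat hf hc
  have h2 : Summable fun k : ℤ => 1 / (k : ℝ) ^ 2 := Real.summable_one_div_int_pow.2 one_lt_two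
  have h3 : Summable fun k : ℤ => if k = 0 then ‖fhat f 0‖ else 0 :=
    summable_of_ne_finset_zero (s := {0}) fun k hk => by
      rw [if_neg (by simpa using hk)]
  refine Summable.of_nonneg_of_le (fun k => norm_nonneg _) (fun k => ?_) ((h1.add h2).add h3)
  rcases eq_or_ne k 0 with rfl | hk
  · simp
  · have hk' : (k : ℝ) ≠ 0 := by exact_mod_cast hk
    rw [if_neg hk, add_zero]
    have h4 : ‖fhat f k‖ = ((k : ℝ) * ‖fhat f k‖) * (1 / k) := by field_simp
    have h5 : 1 / (k : ℝ) ^ 2 = (1 / (k : ℝ)) ^ 2 := by rw [one_div_pow]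
    rw [h5]
    conv_lhs => rw [h4]
    nlinarith [sq_nonneg ((k : ℝ) * ‖fhat f k‖ - 1 / k), sq_nonneg ((k : ℝ) * ‖fhat f k‖),
      sq_nonneg (1 / (k : ℝ))]

theorem hasSum_fhat_cos {f : ℝ → ℝ} (hf : ∀ x, f (-x) = f x)
    (hc : ContDiffOn ℝ 1 f (Set.Icc 0 Real.pi)) {x : ℝ} (hx : x ∈ Set.Icc 0 Real.pi) :
    HasSum (fun k : ℤ => (fhat f k).re * Real.cos (k * x)) (f x) := by
  have hpi := Real.pi_pos
  have hT : Fact (0 < Real.pi - -Real.pi) := ⟨by linarith⟩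
  have hab : -Real.pi + (Real.pi - -Real.pi) = Real.pi := by ring
  have hfc : ContinuousOn (fun x => (f x : ℂ)) (Set.Icc (-Real.pi) Real.pi) :=
    Complex.continuous_ofReal.comp_continuousOn (continuousOn_of_even hf hc.continuousOn)
  have hcont : Continuous (AddCircle.liftIoc (Real.pi - -Real.pi) (-Real.pi)
      fun x => (f x : ℂ)) := by
    refine AddCircle.liftIoc_continuous ?_ ?_
    · rw [hab, hf]
    · rw [hab]
      exact hfc
  set F : C(AddCircle (Real.pi - -Real.pi), ℂ) := ⟨_, hcont⟩ with hF
  have hcoef : ∀ k, fourierCoeff F k = fhat f k := fun k => (fhat_eq_fourierCoeffOn f k).symm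
  have hsum : Summable (fourierCoeff F) := by
    have : fourierCoeff F = fun k => fhat f k := funext hcoef
    rw [this]
    exact (summable_norm_fhat hf hc).of_norm
  have h := has_pointwise_sum_fourier_series_of_summable hsum (x : AddCircle (Real.pi - -Real.pi))
  have hFx : F (x : AddCircle (Real.pi - -Real.pi)) = (f x : ℂ) :=
    AddCircle.liftIoc_coe_apply (f := fun x => (f x : ℂ)) (by
      rw [hab]
      exact ⟨by linarith [hx.1], hx.2⟩)
  rw [hFx] at h
  have h2 := Complex.hasSum_re h
  rw [Complex.ofReal_re] at h2
  convert h2 using 2 with k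
  have hpi' : (Real.pi : ℂ) ≠ 0 := by exact_mod_cast Real.pi_ne_zero
  have he : 2 * Real.pi * Complex.I * k * x / ((Real.pi - -Real.pi : ℝ) : ℂ) =
      ((k * x : ℝ) : ℂ) * Complex.I := by
    push_cast
    field_simp
    ring
  rw [hcoef, smul_eq_mul, fourier_coe_apply, he, ← ofReal_re_fhat hf k, Complex.re_ofReal_mul,
    Complex.exp_ofReal_mul_I_re, Complex.ofReal_re]

end Fourier

end SOCumulants

end

noncomputable section

namespace SOCumulants

/-! ### Multiple series -/

section Series

open Filter Topology

theorem sum_pi_coe {l : ℕ} (K : Finset ℤ) (g : (Fin l → ℤ) → ℝ) :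
    ∑ k : Fin l → K, g (fun i => (k i : ℤ)) = ∑ k ∈ Fintype.piFinset fun _ : Fin l => K, g k :=
  Finset.sum_bij' (fun k _ i => (k i : ℤ)) (fun k hk i => ⟨k i, Fintype.mem_piFinset.1 hk i⟩)
    (fun k _ => Fintype.mem_piFinset.2 fun i => (k i).2) (fun _ _ => Finset.mem_univ _)
    (fun _ _ => rfl) (fun _ _ => rfl) (fun _ _ => rfl)

theorem tendsto_piFinset_Icc (l : ℕ) : Tendsto (fun N : ℕ => Fintype.piFinset fun _ : Fin l =>
    Finset.Icc (-(N : ℤ)) N) atTop atTop := by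
  refine tendsto_atTop_finset_of_monotone (fun M N h => ?_) fun k => ?_
  · exact Fintype.piFinset_subset _ _ fun _ => Finset.Icc_subset_Icc (by simpa using h) (by simpa using h)
  · refine ⟨∑ i, (k i).natAbs, Fintype.mem_piFinset.2 fun i => ?_⟩
    have h := Finset.single_le_sum (f := fun i => (k i).natAbs) (fun _ _ => Nat.zero_le _)
      (Finset.mem_univ i)
    rw [Finset.mem_Icc]
    constructor <;> omega

theorem tendsto_sum_pi {l : ℕ} {g : (Fin l → ℤ) → ℝ} {s : ℝ} (hg : HasSum g s) :
    Tendsto (fun N : ℕ => ∑ k : Fin l → Finset.Icc (-(N : ℤ)) N, g (fun i => (k i : ℤ)))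
      atTop (𝓝 s) := by
  simp only [sum_pi_coe]
  exact hg.comp (tendsto_piFinset_Icc l)

theorem summable_pi_prod {φ : ℤ → ℝ} (h0 : ∀ k, 0 ≤ φ k) (hφ : Summable φ) (l : ℕ) :
    Summable fun k : Fin l → ℤ => ∏ i, φ (k i) := by
  refine summable_of_sum_le (c := (∑' k, φ k) ^ l) (fun k => Finset.prod_nonneg fun i _ => h0 _)
    fun s => ?_
  obtain ⟨N, hN⟩ := ((tendsto_piFinset_Icc l).eventually_ge_atTop s).exists
  refine (Finset.sum_le_sum_of_subset_of_nonneg hN fun k _ _ =>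
    Finset.prod_nonneg fun i _ => h0 _).trans ?_
  rw [← Finset.prod_univ_sum, Finset.prod_const, Finset.card_univ, Fintype.card_fin]
  exact pow_le_pow_left₀ (Finset.sum_nonneg fun k _ => h0 k) (hφ.sum_le_tsum _ fun k _ => h0 k) l

/-- The constraint determines `k i` from the other coordinates, and `|k i| φ (k i)` is bounded by
`B`; a product of summable families in the other coordinates remains. -/
theorem summable_zeroSum {φ : ℤ → ℝ} (h0 : ∀ k, 0 ≤ φ k) (hφ : Summable φ) {B : ℝ}
    (hB : ∀ k : ℤ, |(k : ℝ)| * φ k ≤ B) {l : ℕ} (i : Fin l) :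
    Summable fun k : ZeroSum l => |((k.1 i : ℤ) : ℝ)| * ∏ j, φ (k.1 j) := by
  obtain ⟨m, rfl⟩ : ∃ m, l = m + 1 := ⟨l - 1, by have := i.2; omega⟩
  have hinj : Function.Injective fun (k : ZeroSum (m + 1)) (j : Fin m) => k.1 (i.succAbove j) := by
    intro k k' h
    have h1 : ∀ j, k.1 (i.succAbove j) = k'.1 (i.succAbove j) := fun j => congrFun h j
    have h2 := k.2
    have h3 := k'.2
    rw [Fin.sum_univ_succAbove _ i] at h2 h3
    rw [Finset.sum_congr rfl fun j _ => h1 j] at h2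
    ext j
    rcases Fin.eq_self_or_eq_succAbove i j with rfl | ⟨j, rfl⟩
    · omega
    · exact h1 j
  have hs := ((summable_pi_prod h0 hφ m).comp_injective hinj).mul_left B
  refine Summable.of_nonneg_of_le (fun k => mul_nonneg (abs_nonneg _)
    (Finset.prod_nonneg fun j _ => h0 _)) (fun k => ?_) hs
  rw [Fin.prod_univ_succAbove _ i, ← mul_assoc]
  exact mul_le_mul_of_nonneg_right (hB _) (Finset.prod_nonneg fun j _ => h0 _)

theorem abs_maxPartialSum_le {l : ℕ} (c : Composition l) (k : Fin l → ℝ) :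
    |maxPartialSum c k| ≤ ∑ i, |k i| := by
  have hn : 0 ≤ ∑ i, |k i| := Finset.sum_nonneg fun i _ => abs_nonneg _
  have h0 : 0 ≤ maxPartialSum c k := Finset.le_max' _ _ (Finset.mem_insert_self _ _)
  rw [abs_of_nonneg h0]
  refine Finset.max'_le _ _ _ fun y hy => ?_
  rcases Finset.mem_insert.1 hy with rfl | hy
  · exact hn
  · obtain ⟨j, -, rfl⟩ := Finset.mem_image.1 hy
    exact (Finset.sum_le_sum fun i _ => le_abs_self _).trans
      (Finset.sum_le_sum_of_subset_of_nonneg (Finset.filter_subset _ _) fun i _ _ => abs_nonneg _)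

theorem abs_G_le {l : ℕ} (k : Fin l → ℝ) :
    |G k| ≤ (l.factorial * ∑ C : Composition l, |compWeight C|) * ∑ i, |k i| := by
  have h : ∀ σ : Equiv.Perm (Fin l), |∑ c : Composition l, compWeight c *
      maxPartialSum c (fun i => k (σ i))| ≤ (∑ C : Composition l, |compWeight C|) * ∑ i, |k i| := by
    intro σ
    rw [Finset.sum_mul]
    refine (Finset.abs_sum_le_sum_abs _ _).trans (Finset.sum_le_sum fun c _ => ?_)
    rw [abs_mul]
    refine mul_le_mul_of_nonneg_left ((abs_maxPartialSum_le c _).trans (le_of_eq ?_)) (abs_nonneg _)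
    exact Equiv.sum_comp σ fun i => |k i|
  refine (Finset.abs_sum_le_sum_abs _ _).trans ((Finset.sum_le_sum fun σ _ => h σ).trans
    (le_of_eq ?_))
  rw [Finset.sum_const, Finset.card_univ, Fintype.card_perm, Fintype.card_fin, nsmul_eq_mul,
    mul_assoc]

theorem sum_le_tsum_of_injective {α β : Type*} {e : β → α} (he : Function.Injective e) {φ : β → ℝ}
    (h0 : ∀ b, 0 ≤ φ b) (hφ : Summable φ) {g : α → ℝ} (hg : ∀ b, g (e b) = φ b)
    (hg0 : ∀ x ∉ Set.range e, g x = 0) (s : Finset α) : ∑ x ∈ s, g x ≤ ∑' b, φ b := by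
  have h1 : HasSum g (∑' b, φ b) := by
    rw [← he.hasSum_iff hg0]
    have : g ∘ e = φ := funext hg
    rw [this]
    exact hφ.hasSum
  refine sum_le_hasSum s (fun x _ => ?_) h1
  by_cases hx : x ∈ Set.range e
  · obtain ⟨b, rfl⟩ := hx
    rw [hg]
    exact h0 b
  · rw [hg0 x hx]

/-- Exchanging coordinates shows that each `|k j|` contributes as much as the first coordinate, so
`∑ |k j|` becomes `l` times one series. -/
theorem sum_errWeight_le {φ : ℤ → ℝ} (h0 : ∀ k, 0 ≤ φ k) {n l : ℕ} (hl : 2 ≤ l)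
    (h1 : Summable (fun k : {k : ZeroSum l // (n : ℤ) < ∑ i, |k.1 i|} =>
        (|k.1.1 ⟨0, by omega⟩| : ℝ) * ∏ i, φ (k.1.1 i)))
    (h2 : Summable (fun k : {k : Fin l → ℤ // (n : ℤ) < ∑ i, |k i|} => ∏ i, φ (k.1 i)))
    (K : Finset ℤ) :
    ∑ k : Fin l → K, (∏ i, φ (k i)) * errWeight n (fun i => (k i : ℤ)) ≤
      l * (∑' k : {k : ZeroSum l // (n : ℤ) < ∑ i, |k.1 i|},
        (|k.1.1 ⟨0, by omega⟩| : ℝ) * ∏ i, φ (k.1.1 i)) +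
      ∑' k : {k : Fin l → ℤ // (n : ℤ) < ∑ i, |k i|}, ∏ i, φ (k.1 i) := by
  set o : Fin l := ⟨0, by omega⟩ with ho
  have hnn : ∀ k : Fin l → ℤ, 0 ≤ ∏ i, φ (k i) := fun k => Finset.prod_nonneg fun i _ => h0 _
  set g₁ : Fin l → (Fin l → ℤ) → ℝ := fun j k =>
    if ∑ i, k i = 0 ∧ (n : ℤ) < ∑ i, |k i| then (|k j| : ℝ) * ∏ i, φ (k i) else 0 with hg₁
  set g₂ : (Fin l → ℤ) → ℝ := fun k =>
    if (n : ℤ) < ∑ i, |k i| then ∏ i, φ (k i) else 0 with hg₂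
  have hsplit : ∀ k : Fin l → ℤ, (∏ i, φ (k i)) * errWeight n k = ∑ j, g₁ j k + g₂ k := by
    intro k
    simp only [errWeight, hg₁, hg₂]
    by_cases hz : ∑ i, k i = 0 <;> by_cases hn : (n : ℤ) < ∑ i, |k i|
    · simp only [hz, hn, and_self, if_true, ← Finset.sum_mul]
      push_cast
      ring
    · simp [hz, hn]
    · simp [hz, hn]
    · simp [hz, hn]
  have hswap : ∀ j, ∑ k : Fin l → K, g₁ j (fun i => (k i : ℤ)) =
      ∑ k : Fin l → K, g₁ o (fun i => (k i : ℤ)) := by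
    intro j
    rw [← sum_comp_perm (Equiv.swap o j) fun k => g₁ j (fun i => (k i : ℤ))]
    refine Finset.sum_congr rfl fun k _ => ?_
    have e1 := Equiv.sum_comp (Equiv.swap o j) fun i => (k i : ℤ)
    have e2 := Equiv.sum_comp (Equiv.swap o j) fun i => |(k i : ℤ)|
    have e3 := Equiv.prod_comp (Equiv.swap o j) fun i => φ (k i)
    simp only [hg₁, e1, e2, e3, Equiv.swap_apply_right]
  have hfst : ∑ k : Fin l → K, g₁ o (fun i => (k i : ℤ)) ≤
      ∑' k : {k : ZeroSum l // (n : ℤ) < ∑ i, |k.1 i|}, (|k.1.1 o| : ℝ) * ∏ i, φ (k.1.1 i) := by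
    rw [sum_pi_coe]
    refine sum_le_tsum_of_injective
      (e := fun k : {k : ZeroSum l // (n : ℤ) < ∑ i, |k.1 i|} => k.1.1)
      (fun k k' h => Subtype.ext (Subtype.ext h)) (fun k => mul_nonneg (abs_nonneg _) (hnn _)) h1
      (fun k => by simp only [hg₁, k.1.2, k.2, and_self, if_true]; rfl) (fun k hk => ?_) _
    simp only [hg₁]
    rw [if_neg]
    rintro ⟨ha, hb⟩
    exact hk ⟨⟨⟨k, ha⟩, hb⟩, rfl⟩
  have hsnd : ∑ k : Fin l → K, g₂ (fun i => (k i : ℤ)) ≤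
      ∑' k : {k : Fin l → ℤ // (n : ℤ) < ∑ i, |k i|}, ∏ i, φ (k.1 i) := by
    rw [sum_pi_coe]
    refine sum_le_tsum_of_injective Subtype.val_injective (fun k => hnn _) h2
      (fun k => by simp only [hg₂, k.2, if_true]) (fun k hk => ?_) _
    simp only [hg₂]
    rw [if_neg]
    exact fun hb => hk ⟨⟨k, hb⟩, rfl⟩
  simp only [hsplit]
  rw [Finset.sum_add_distrib, Finset.sum_comm, Finset.sum_congr rfl fun j _ => hswap j,
    Finset.sum_const, Finset.card_univ, Fintype.card_fin, nsmul_eq_mul]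
  exact add_le_add (mul_le_mul_of_nonneg_left hfst (Nat.cast_nonneg l)) hsnd

end Series

/-! ### From trigonometric polynomials to `f`. -/

section Limit

open Filter Topology

/-- The eigenangles are only chosen, with no measurability. The truncated statistics are
nevertheless continuous, being polynomials in traces, and they converge boundedly to the statistic
of `f`. -/
theorem tendsto_cumulantSO_trigPoly {f : ℝ → ℝ} (hf : ∀ x, f (-x) = f x)
    (hc : ContDiffOn ℝ 1 f (Set.Icc 0 Real.pi)) (n : ℕ) {l : ℕ} (hl : 1 ≤ l) :
    Tendsto (fun N : ℕ => cumulantSO l n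
      (trigPoly (Finset.Icc (-(N : ℤ)) N) fun k => (fhat f k).re)) atTop (𝓝 (cumulantSO l n f)) := by
  have hs := summable_norm_fhat hf hc
  have hIcc : Tendsto (fun N : ℕ => Finset.Icc (-(N : ℤ)) N) atTop atTop := by
    refine tendsto_atTop_finset_of_monotone (fun M N h => ?_) fun k => ⟨k.natAbs, ?_⟩
    · exact Finset.Icc_subset_Icc (by simpa using h) (by simpa using h)
    · rw [Finset.mem_Icc]
      constructor <;> omega
  have hbd : ∀ (N : ℕ) (x : ℝ), |trigPoly (Finset.Icc (-(N : ℤ)) N) (fun k => (fhat f k).re) x| ≤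
      ∑' k : ℤ, ‖fhat f k‖ := by
    intro N x
    refine (Finset.abs_sum_le_sum_abs _ _).trans (le_trans (Finset.sum_le_sum fun k _ => ?_)
      (hs.sum_le_tsum _ fun k _ => norm_nonneg _))
    rw [abs_mul]
    calc |(fhat f k).re| * |Real.cos (k * x)| ≤ ‖fhat f k‖ * 1 :=
          mul_le_mul (Complex.abs_re_le_norm _) (Real.abs_cos_le_one _) (abs_nonneg _) (norm_nonneg _)
      _ = ‖fhat f k‖ := mul_one _
  refine tendsto_cumulant (B := n * ∑' k : ℤ, ‖fhat f k‖) (fun N => ?_) (fun N M => ?_)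
    (fun M => ?_) hl
  · have hX : linStat n (trigPoly (Finset.Icc (-(N : ℤ)) N) fun k => (fhat f k).re) =
        fun M : SO (2 * n) => evTr M.1 (tracePoly (Finset.Icc (-(N : ℤ)) N)
          fun k => (fhat f k).re) := funext (linStat_trigPoly n _ _)
    rw [hX]
    exact (continuous_evTr _).aemeasurable
  · refine (Finset.abs_sum_le_sum_abs _ _).trans ((Finset.sum_le_sum fun j _ => hbd N _).trans
      (le_of_eq ?_))
    simp
  · refine tendsto_finsetSum _ fun j _ => ?_
    exact (hasSum_fhat_cos hf hc ((isEigenangles_eigenangle M).1 j)).comp hIcc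

end Limit

end SOCumulants

end

/-! ### The main estimate. -/

theorem lemma3 (l : ℕ) (hl : 2 ≤ l) :
    ∃ K K' : ℝ, ∀ n : ℕ, 1 ≤ n → ∀ f : ℝ → ℝ, Function.Periodic f (2 * Real.pi) →
      (∀ x, f (-x) = f x) → ContDiffOn ℝ 1 f (Set.Icc 0 Real.pi) →
      Summable (fun k : SOCumulants.ZeroSum l => SOCumulants.mainTerm f k.1) ∧
      Summable (fun k : {k : SOCumulants.ZeroSum l // (n : ℤ) < ∑ i, |k.1 i|} =>
        (|k.1.1 ⟨0, by omega⟩| : ℝ) * SOCumulants.absTerm f k.1.1) ∧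
      Summable (fun k : {k : Fin l → ℤ // (n : ℤ) < ∑ i, |k i|} =>
        SOCumulants.absTerm f k.1) ∧
      ‖(SOCumulants.cumulantSO l n f : ℂ) -
          ∑' k : SOCumulants.ZeroSum l, SOCumulants.mainTerm f k.1‖ ≤
        K * (∑' k : {k : SOCumulants.ZeroSum l // (n : ℤ) < ∑ i, |k.1 i|},
          (|k.1.1 ⟨0, by omega⟩| : ℝ) * SOCumulants.absTerm f k.1.1) +
        K' * (∑' k : {k : Fin l → ℤ // (n : ℤ) < ∑ i, |k i|}, SOCumulants.absTerm f k.1) := by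
  open SOCumulants Filter Topology in
  set A : ℝ := (l.factorial : ℝ) / 2 * (∑ C : Composition l, |compWeight C|) with hA
  have hA0 : 0 ≤ A := mul_nonneg (by positivity) (Finset.sum_nonneg fun C _ => abs_nonneg _)
  -- `A` is the constant of `abs_trace_cumulant_sub_le`; the additional `l` comes from
  -- `sum_errWeight_le`.
  refine ⟨A * l, A, fun n hn f _ hf hc => ?_⟩
  set a : ℤ → ℝ := fun k => (fhat f k).re with ha
  have haC : ∀ k, ((a k : ℝ) : ℂ) = fhat f k := ofReal_re_fhat hf
  have haev : ∀ k, a (-k) = a k := fun k => by simp only [ha, fhat_neg hf]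
  have hnorm : ∀ k, |a k| = ‖fhat f k‖ := fun k => by
    rw [← haC, Complex.norm_real, Real.norm_eq_abs]
  have hs := summable_norm_fhat hf hc
  obtain ⟨B, hB⟩ := exists_bound_mul_fhat hf hc
  have hz := fun i : Fin l => summable_zeroSum (φ := fun k => ‖fhat f k‖) (fun k => norm_nonneg (fhat f k)) hs hB i
  have hS1 : Summable (fun k : {k : ZeroSum l // (n : ℤ) < ∑ i, |k.1 i|} =>
      (|k.1.1 ⟨0, by omega⟩| : ℝ) * absTerm f k.1.1) :=
    (hz ⟨0, by omega⟩).comp_injective Subtype.val_injective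
  have hS2 : Summable (fun k : {k : Fin l → ℤ // (n : ℤ) < ∑ i, |k i|} => absTerm f k.1) :=
    (summable_pi_prod (φ := fun k => ‖fhat f k‖) (fun k => norm_nonneg (fhat f k)) hs l).comp_injective Subtype.val_injective
  set g : (Fin l → ℤ) → ℝ := fun k => (∏ i, a (k i)) * (if ∑ i, k i = 0 then
        1 / 2 * (G (fun i => (k i : ℝ)) + G (fun i => -(k i : ℝ))) else 0) with hg
  have hgmain : ∀ k : ZeroSum l, ((g k.1 : ℝ) : ℂ) = mainTerm f k.1 := by
    intro k
    simp only [hg, k.2, if_true, mainTerm, ← haC]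
    push_cast
    rfl
  have hgs : Summable fun k : ZeroSum l => g k.1 := by
    set W : ℝ := l.factorial * ∑ C : Composition l, |compWeight C|
    have hsum : Summable fun k : ZeroSum l =>
        W * ∑ i, |((k.1 i : ℤ) : ℝ)| * ∏ j, ‖fhat f (k.1 j)‖ :=
      (summable_sum fun i _ => hz i).mul_left W
    refine Summable.of_norm_bounded hsum fun k => ?_
    have h1 := abs_G_le (fun i => (k.1 i : ℝ))
    have h2 := abs_G_le (fun i => -(k.1 i : ℝ))
    simp only [abs_neg] at h2
    have h3 := (abs_add_le (G (fun i => (k.1 i : ℝ))) (G (fun i => -(k.1 i : ℝ)))).trans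
      (add_le_add h1 h2)
    simp only [hg, k.2, if_true, norm_mul, Real.norm_eq_abs, Finset.abs_prod, hnorm]
    rw [← Finset.sum_mul, abs_of_nonneg (by norm_num : (0 : ℝ) ≤ 1 / 2)]
    have hP : 0 ≤ ∏ i, ‖fhat f (k.1 i)‖ := Finset.prod_nonneg fun _ _ => norm_nonneg _
    have h4 := mul_le_mul_of_nonneg_right h3 hP
    linarith
  have hmain : HasSum (fun k : ZeroSum l => mainTerm f k.1)
      ((∑' k : ZeroSum l, g k.1 : ℝ) : ℂ) := by
    simp only [← hgmain]
    exact Complex.hasSum_ofReal.2 hgs.hasSum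
  have hg0 : ∀ k ∉ Set.range (Subtype.val : ZeroSum l → (Fin l → ℤ)), g k = 0 := by
    intro k hk
    simp only [hg]
    rw [if_neg fun h => hk ⟨⟨k, h⟩, rfl⟩, mul_zero]
  have hgfull : HasSum g (∑' k : ZeroSum l, g k.1) :=
    (Subtype.val_injective.hasSum_iff hg0).1 hgs.hasSum
  refine ⟨hmain.summable, hS1, hS2, ?_⟩
  rw [hmain.tsum_eq, ← Complex.ofReal_sub, Complex.norm_real, Real.norm_eq_abs]
  -- The error bound for each Fourier truncation is at most the full right-hand side, so it survives
  -- the limit.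
  refine le_of_tendsto ((tendsto_cumulantSO_trigPoly hf hc n (by omega : 1 ≤ l)).sub
    (tendsto_sum_pi hgfull)).abs (Eventually.of_forall fun N => ?_)
  have h1 := abs_cumulantSO_trigPoly_sub_le hn (K := Finset.Icc (-(N : ℤ)) N) (c := a)
    (fun k => by simp only [Finset.mem_Icc]; omega) haev hl
  refine h1.trans ?_
  rw [mul_assoc A, ← mul_add]
  refine mul_le_mul_of_nonneg_left ?_ hA0
  simp only [hnorm]
  exact sum_errWeight_le (φ := fun k => ‖fhat f k‖) (fun k => norm_nonneg (fhat f k)) hl hS1 hS2 _
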